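/- **Setting.** Let $h>0$, let $m,n\ge 1$ be integers, and let $D$ be an open rectangle with sides $mh$ and $nh$ parallel to the axes. The *three-line mesh* on $\overline D$ is obtained by cutting $\overline D$ into $m\times n$ squares of side $h$ and dividing each square into two triangles along its diagonal of slope $-1$. *Local mesh.* For $0<\alpha<\pi/4$ consider the reference triangle $ABC$ with $B=(0,0)$, $C=(1,0)$, $A=(0,1)$ and the points $M=(\tfrac12,0)$, $N=(\tfrac14,\tfrac{\tan\alpha}{4})$, $P=(\tfrac34,\tfrac{\tan\alpha}{4})$. The local mesh of $ABC$ consists of the six triangles $BMN$, $MPN$, $MCP$, $BNA$, $NPA$, $PCA$. *Embedded triangles.* Choose any set of triangles of the three-line mesh and partition each chosen triangle $T$ by a similar copy of the local mesh of $ABC$ with an angle $\alpha_T\in(0,\pi/4)$ (either leg of $T$ may play the role of $BC$). The neighbor of $T$ across the leg that carries the copy of $M$ is bisected by the segment from that point to its opposite vertex, so that the mesh is conforming; all other triangles are kept. Assume that the chosen triangles are separated from each other and from the boundary by one layer of triangles that are not chosen: no two chosen triangles have a common vertex, and no chosen triangle has a vertex on $\partial D$. Let $\mathcal T_h$ be the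 resulting mesh. *Solution operator.* Let $V^h(\overline D)$ be the space of continuous functions on $\overline D$ that are affine on every triangle of $\mathcal T_h$, let $V^h_0(\overline D)$ be the subspace of those vanishing on $\partial D$, and let $V^h(\partial D)$ be the space of restrictions to $\partial D$ of functions in $V^h(\overline D)$. For $f\in (V^h_0(\overline D))^*$ and $u_h^b\in V^h(\partial D)$, the $P_1$ finite element solution $u_h=\mathcal S_h^D(f,u_h^b)$ of the Poisson equation is the unique $u_h\in V^h(\overline D)$ with $u_h|_{\partial D}=u_h^b$ and $$\int_D\nabla u_h\cdot\nabla v=\langle f,v\rangle\qquad\text{for all } v\in V^h_0(\overline D).$$ The functional $f$ is called nonnegative if $\langle f,\varphi\rangle\ge 0$ for all nodal basis functions $\varphi$ in $V_0^h(\overline D)$. **Corollary.** There is an $\alpha_0>0$, independent of the rectangle, of $h$, $m$, $n$ and of the chosen triangles, such that the following holds for every mesh as above in which $\alpha_T<\alpha_0$ for all chosen triangles $T$: the solution operator $\mathcal S_h^D$ is well defined and satisfies wDMP-A, the A-version of the weak discrete maximum principle, that is, $$\min_{\overline D}\mathcal S_h^D(f,u_h^b)\ \ge\ \min_{\partial D}u_h^b\qquad\text{for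 all nonnegative } f\in (V_0^h(\overline D))^*\text{ and all } u_h^b\in V^h(\partial D).$$ -/

import Mathlib

open Set MeasureTheory

noncomputable section

namespace DMP

/-! ### `P1` finite elements for the Poisson equation on a triangulated plane domain -/

/-- A triangle in the plane, given by its three vertices. -/
structure Triangle where
  p : ℝ × ℝ
  q : ℝ × ℝ
  r : ℝ × ℝ

/-- The set of vertices of a triangle. -/
def Triangle.vertices (K : Triangle) : Set (ℝ × ℝ) := {K.p, K.q, K.r}

/-- The closed triangle. -/
def Triangle.carrier (K : Triangle) : Set (ℝ × ℝ) := convexHull ℝ K.vertices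

/-- The vertices of a family of triangles. -/
def meshVertices (𝒯 : Set Triangle) : Set (ℝ × ℝ) := {P | ∃ K ∈ 𝒯, P ∈ K.vertices}

/-- `u` is an affine (that is, "linear" in the finite element sense) function on `s`. -/
def IsAffineOn (u : ℝ × ℝ → ℝ) (s : Set (ℝ × ℝ)) : Prop :=
  ∃ a b c : ℝ, ∀ x ∈ s, u x = a * x.1 + b * x.2 + c

/-- The space of continuous functions on the closure of `D` that are affine on every triangle of
`𝒯`. A function on the closure of `D` is represented by its extension by zero to the plane. -/
def Vh (D : Set (ℝ × ℝ)) (𝒯 : Set Triangle) : Submodule ℝ (ℝ × ℝ → ℝ) where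
  carrier := {u | ContinuousOn u (closure D) ∧ (∀ K ∈ 𝒯, IsAffineOn u K.carrier) ∧
    ∀ x, x ∉ closure D → u x = 0}
  zero_mem' := ⟨continuousOn_const, fun _ _ => ⟨0, 0, 0, by simp⟩, fun _ _ => rfl⟩
  add_mem' := by
    rintro u v ⟨hu, hu', hu0⟩ ⟨hv, hv', hv0⟩
    refine ⟨hu.add hv, fun K hK => ?_, fun x hx => by simp [hu0 x hx, hv0 x hx]⟩
    obtain ⟨a, b, c, h⟩ := hu' K hK
    obtain ⟨a', b', c', h'⟩ := hv' K hK
    refine ⟨a + a', b + b', c + c', fun x hx => ?_⟩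
    rw [Pi.add_apply, h x hx, h' x hx]
    ring
  smul_mem' := by
    rintro t u ⟨hu, hu', hu0⟩
    refine ⟨hu.const_smul t, fun K hK => ?_, fun x hx => by simp [hu0 x hx]⟩
    obtain ⟨a, b, c, h⟩ := hu' K hK
    refine ⟨t * a, t * b, t * c, fun x hx => ?_⟩
    rw [Pi.smul_apply, h x hx, smul_eq_mul]
    ring

/-- The functions of `Vh` that vanish on the boundary of `D`. -/
def V0 (D : Set (ℝ × ℝ)) (𝒯 : Set Triangle) : Submodule ℝ (ℝ × ℝ → ℝ) where
  carrier := {u | u ∈ Vh D 𝒯 ∧ ∀ x ∈ frontier D, u x = 0}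
  zero_mem' := ⟨(Vh D 𝒯).zero_mem, fun _ _ => rfl⟩
  add_mem' := fun {u v} hu hv =>
    ⟨(Vh D 𝒯).add_mem hu.1 hv.1, fun x hx => by simp [hu.2 x hx, hv.2 x hx]⟩
  smul_mem' := fun t u hu =>
    ⟨(Vh D 𝒯).smul_mem t hu.1, fun x hx => by simp [hu.2 x hx]⟩

/-- The space of the restrictions to the boundary of `D` of the functions of `Vh`. -/
def VhBoundary (D : Set (ℝ × ℝ)) (𝒯 : Set Triangle) : Submodule ℝ (frontier D → ℝ) :=
  (Vh D 𝒯).map (LinearMap.funLeft ℝ ℝ (Subtype.val : frontier D → ℝ × ℝ))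

/-- The bilinear form of the Poisson equation, `∫_D (∂₁u ∂₁v + ∂₂u ∂₂v)`. -/
def dirichletForm (D : Set (ℝ × ℝ)) (u v : ℝ × ℝ → ℝ) : ℝ :=
  ∫ x in D, (fderiv ℝ u x (1, 0) * fderiv ℝ v x (1, 0)
    + fderiv ℝ u x (0, 1) * fderiv ℝ v x (0, 1))

/-- `S` is the `P1` finite element solution operator of the Poisson equation on `D`: the function
`S f ub` is the unique `u` in `Vh` which is equal to `ub` on the boundary of `D` and satisfies
`a(u, v) = ⟨f, v⟩` for all `v` in `V0`. -/
def IsPoissonSolutionOperator (D : Set (ℝ × ℝ)) (𝒯 : Set Triangle)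
    (S : Module.Dual ℝ (V0 D 𝒯) → VhBoundary D 𝒯 → Vh D 𝒯) : Prop :=
  ∀ (f : Module.Dual ℝ (V0 D 𝒯)) (ub : VhBoundary D 𝒯) (u : Vh D 𝒯),
    S f ub = u ↔
      (∀ x : frontier D, (u : ℝ × ℝ → ℝ) x = (ub : frontier D → ℝ) x) ∧
        ∀ v : V0 D 𝒯, dirichletForm D (u : ℝ × ℝ → ℝ) (v : ℝ × ℝ → ℝ) = f v

/-- `φ` has the nodal values of the basis function of the vertex `P`: it is `1` at `P` and `0` at
all the other vertices. -/
def IsNodalAt (𝒯 : Set Triangle) (P : ℝ × ℝ) (φ : ℝ × ℝ → ℝ) : Prop :=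
  φ P = 1 ∧ ∀ Q ∈ meshVertices 𝒯, Q ≠ P → φ Q = 0

/-- A functional on `V0` is nonnegative if it is nonnegative on the nodal basis functions. -/
def IsNonnegFunctional (D : Set (ℝ × ℝ)) (𝒯 : Set Triangle)
    (f : Module.Dual ℝ (V0 D 𝒯)) : Prop :=
  ∀ P ∈ meshVertices 𝒯, ∀ φ : V0 D 𝒯, IsNodalAt 𝒯 P (φ : ℝ × ℝ → ℝ) → 0 ≤ f φ

/-- The A-version of the weak discrete maximum principle: for nonnegative `f` and every boundary
function `ub`, the minimum of `ub` over the boundary (which is attained, at `y`) is a lower bound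
of `S f ub` on the closure of `D`. -/
def WDMPA (D : Set (ℝ × ℝ)) (𝒯 : Set Triangle)
    (S : Module.Dual ℝ (V0 D 𝒯) → VhBoundary D 𝒯 → Vh D 𝒯) : Prop :=
  ∀ f : Module.Dual ℝ (V0 D 𝒯), IsNonnegFunctional D 𝒯 f → ∀ ub : VhBoundary D 𝒯,
    ∃ y : frontier D, (∀ z : frontier D, (ub : frontier D → ℝ) y ≤ (ub : frontier D → ℝ) z) ∧
      ∀ x ∈ closure D, (ub : frontier D → ℝ) y ≤ (S f ub : ℝ × ℝ → ℝ) x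

/-! ### The three-line mesh with embedded subdivided triangles -/

/-- A triangle of the three-line mesh of unit squares, every square `[i, i+1] × [j, j+1]` being
divided along its diagonal from `(i+1, j)` to `(i, j+1)` into a lower and an upper triangle. -/
structure GridTriangle where
  i : ℤ
  j : ℤ
  upper : Bool

namespace GridTriangle

/-- The vertex at the right angle. -/
def corner (T : GridTriangle) : ℤ × ℤ := if T.upper then (T.i + 1, T.j + 1) else (T.i, T.j)

/-- The other end of the horizontal leg. -/
def horizontalEnd (T : GridTriangle) : ℤ × ℤ :=
  if T.upper then (T.i, T.j + 1) else (T.i + 1, T.j)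

/-- The other end of the vertical leg. -/
def verticalEnd (T : GridTriangle) : ℤ × ℤ :=
  if T.upper then (T.i + 1, T.j) else (T.i, T.j + 1)

/-- The three vertices of a grid triangle. -/
def vertices (T : GridTriangle) : Set (ℤ × ℤ) := {T.corner, T.horizontalEnd, T.verticalEnd}

/-- The triangle is one of those of the grid of `m × n` squares. -/
def InGrid (m n : ℕ) (T : GridTriangle) : Prop := 0 ≤ T.i ∧ T.i < m ∧ 0 ≤ T.j ∧ T.j < n

/-- The grid triangle on the other side of the vertical (if `vert` is true) or horizontal leg. -/
def acrossLeg (T : GridTriangle) (vert : Bool) : GridTriangle :=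
  if T.upper then
    if vert then ⟨T.i + 1, T.j, false⟩ else ⟨T.i, T.j + 1, false⟩
  else
    if vert then ⟨T.i - 1, T.j, true⟩ else ⟨T.i, T.j - 1, true⟩

end GridTriangle

/-- The data of a three-line mesh of `m × n` squares of side `h` on a rectangle with lower left
vertex `(x₀, y₀)`, in which certain triangles are further partitioned. -/
structure EmbeddedMesh where
  x₀ : ℝ
  y₀ : ℝ
  h : ℝ
  h_pos : 0 < h
  m : ℕ
  n : ℕ
  m_pos : 0 < m
  n_pos : 0 < n
  /-- The triangles that are further partitioned. -/
  partitioned : Set GridTriangle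
  partitioned_inGrid : ∀ T ∈ partitioned, T.InGrid m n
  /-- Whether the vertical or the horizontal leg of a partitioned triangle carries the added
  midpoint. -/
  vert : GridTriangle → Bool
  /-- The angle of the local mesh of a partitioned triangle. -/
  α : GridTriangle → ℝ
  α_pos : ∀ T ∈ partitioned, 0 < α T
  /-- This says that the added points lie in the triangle, so that the mesh is nondegenerate. -/
  α_lt : ∀ T ∈ partitioned, α T < Real.pi / 4
  /-- Any two partitioned triangles are separated by a layer of unpartitioned ones: no triangle
  that touches a partitioned triangle is another partitioned triangle. -/
  separated : ∀ T ∈ partitioned, ∀ T' ∈ partitioned, T' ≠ T → Disjoint T.vertices T'.vertices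
  /-- A layer of unpartitioned triangles separates the partitioned triangles from the boundary:
  no partitioned triangle touches the boundary. -/
  separated_boundary : ∀ T ∈ partitioned, ∀ v ∈ T.vertices, 0 < v.1 ∧ v.1 < m ∧ 0 < v.2 ∧ v.2 < n

namespace EmbeddedMesh

/-- The open rectangle. -/
def domain (𝓜 : EmbeddedMesh) : Set (ℝ × ℝ) :=
  Ioo 𝓜.x₀ (𝓜.x₀ + 𝓜.m * 𝓜.h) ×ˢ Ioo 𝓜.y₀ (𝓜.y₀ + 𝓜.n * 𝓜.h)

/-- The point of the plane at a grid position. -/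
def node (𝓜 : EmbeddedMesh) (v : ℤ × ℤ) : ℝ × ℝ := (𝓜.x₀ + v.1 * 𝓜.h, 𝓜.y₀ + v.2 * 𝓜.h)

/-- The plain triangle of the three-line mesh. -/
def plainTriangle (𝓜 : EmbeddedMesh) (T : GridTriangle) : Triangle :=
  ⟨𝓜.node T.corner, 𝓜.node T.horizontalEnd, 𝓜.node T.verticalEnd⟩

/-- The image of the point `(s, t)` under the similarity that maps the reference triangle `ABC`,
with `B = (0, 0)`, `C = (1, 0)` and `A = (0, 1)`, to the triangle `T`, where `BC` is mapped to the
leg of `T` that carries the added midpoint. -/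
def refPoint (𝓜 : EmbeddedMesh) (T : GridTriangle) (s t : ℝ) : ℝ × ℝ :=
  let b := 𝓜.node T.corner
  let c := 𝓜.node (if 𝓜.vert T then T.verticalEnd else T.horizontalEnd)
  let a := 𝓜.node (if 𝓜.vert T then T.horizontalEnd else T.verticalEnd)
  b + s • (c - b) + t • (a - b)

/-- The triangles that a partitioned triangle `T` contributes. With the points `M = (1/2, 0)`,
`N = (1/4, tan α / 4)` and `P = (3/4, tan α / 4)` of the reference configuration, these are the six
triangles of the local mesh of `ABC`, and the two halves of the neighbor `B C A'`, where
`A' = (1, -1)`, which is divided by the segment `M A'` because `M` lies on its edge `BC`. -/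
def localMesh (𝓜 : EmbeddedMesh) (T : GridTriangle) : Set Triangle :=
  let B := 𝓜.refPoint T 0 0
  let C := 𝓜.refPoint T 1 0
  let A := 𝓜.refPoint T 0 1
  let A' := 𝓜.refPoint T 1 (-1)
  let M := 𝓜.refPoint T (1 / 2) 0
  let N := 𝓜.refPoint T (1 / 4) (Real.tan (𝓜.α T) / 4)
  let P := 𝓜.refPoint T (3 / 4) (Real.tan (𝓜.α T) / 4)
  {⟨B, M, N⟩, ⟨M, P, N⟩, ⟨M, C, P⟩, ⟨B, N, A⟩, ⟨N, P, A⟩, ⟨P, C, A⟩, ⟨B, M, A'⟩, ⟨M, C, A'⟩}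

/-- All triangles of the mesh: the local meshes, and the triangles of the three-line mesh that are
neither partitioned nor bisected by the added midpoint of a neighbor. -/
def triangles (𝓜 : EmbeddedMesh) : Set Triangle :=
  (⋃ T ∈ 𝓜.partitioned, 𝓜.localMesh T) ∪
    {K | ∃ T : GridTriangle, T.InGrid 𝓜.m 𝓜.n ∧ T ∉ 𝓜.partitioned ∧
      (∀ T' ∈ 𝓜.partitioned, T ≠ T'.acrossLeg (𝓜.vert T')) ∧ K = 𝓜.plainTriangle T}

end EmbeddedMesh

end DMP

end

/-!
# The weak discrete maximum principle on meshes with embedded thin triangles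

A finite element function `u` is described by its values `U` at the nodes of the three-line mesh and,
for every partitioned triangle `T`, by the deviations of `u` from the linear interpolant of `U` at
the three added vertices `M`, `N` and `P`. In these terms (`EmbeddedMesh.dirichletForm_eq`) the
Dirichlet form is the five-point form of the three-line mesh plus, for every `T`, the form of a
`3 × 3` matrix `κ_t` in the deviations and a coupling between the deviation at `M` and the jump
`s_T(U) = U_A + U_A' - U_B - U_C` of the normal derivative of the interpolant across the leg `BC`.
The separation of the partitioned triangles makes these local contributions independent of each
other. The angle enters through `t = tan α_T` only.

As `t` tends to zero, `t κ_t` converges to an invertible matrix whose inverse has positive entries.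
For small `t`, `κ_t` therefore has an inverse with nonnegative small entries
(`exists_bubbleForm_inverse`): the thin triangles, although they violate the usual angle condition,
force `u` to be almost linear along `BC`. The equations at the added vertices hence express the
deviations by `s_T(U) / 2` and the right hand side with nonnegative coefficients. Inserted into the
equations at the grid nodes, they turn a nonnegative right hand side into the inequalities

  `4 U_v - ∑_{l adjacent to v} U_l - ∑_T g_T s_T(δ_v) s_T(U) ≥ 0`

with small `g_T ≥ 0`. The perturbation has positive off-diagonal entries, so that the matrix is not
an M-matrix. However, the entries of the wrong sign join neighbors, or nodes which have a common
neighbor in the interior, and with the sum `N` over the neighbors they are dominated by the terms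
`N` and `N²` of the product of the M-matrices `4 - (3 / 8) N` and `1 - (3 / 32) N`. The two factors
are monotone, which gives a minimum principle for `U` (`le_of_perturbed_superharmonic`). The values
at `M`, `N` and `P` are then bounded from below, because they are, up to nonnegative terms, convex
combinations of values of `U` (`EmbeddedMesh.exists_hasMaxPrinciple`).

The minimum principle for `u` and for `-u` yields uniqueness of the finite element solution, and
existence follows because the spaces are finite dimensional
(`EmbeddedMesh.HasMaxPrinciple.existsUnique`).
-/

namespace DMP

/-! ### Triangles: barycentric coordinates, area, and the energy of affine functions -/

theorem Triangle.mem_carrier_iff (K : Triangle) (x : ℝ × ℝ) :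
    x ∈ K.carrier ↔ ∃ a b c : ℝ, 0 ≤ a ∧ 0 ≤ b ∧ 0 ≤ c ∧ a + b + c = 1 ∧
      x.1 = a * K.p.1 + b * K.q.1 + c * K.r.1 ∧ x.2 = a * K.p.2 + b * K.q.2 + c * K.r.2 := by
  rw [Triangle.carrier, Triangle.vertices, convexHull_insert (by simp), convexHull_pair]
  simp only [convexJoin_singleton_left, mem_iUnion, segment_eq_image, mem_image]
  constructor
  · rintro ⟨y, ⟨θ, ⟨hθ0, hθ1⟩, rfl⟩, η, ⟨hη0, hη1⟩, rfl⟩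
    refine ⟨1 - η, η * (1 - θ), η * θ, by linarith, mul_nonneg hη0 (by linarith),
      mul_nonneg hη0 hθ0, by ring, ?_, ?_⟩ <;> simp <;> ring
  · rintro ⟨a, b, c, ha, hb, hc, habc, h1, h2⟩
    rcases eq_or_lt_of_le (add_nonneg hb hc) with h0 | h0
    · refine ⟨K.q, ⟨0, by simp, by simp⟩, 0, by simp, ?_⟩
      have hb0 : b = 0 := by linarith
      have hc0 : c = 0 := by linarith
      have ha1 : a = 1 := by linarith
      subst hb0 hc0 ha1
      ext
      · simp [h1]
      · simp [h2]
    · refine ⟨_, ⟨c / (b + c), ⟨by positivity, (div_le_one h0).2 (by linarith)⟩, rfl⟩, b + c,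
        ⟨h0.le, by linarith⟩, ?_⟩
      have ha1 : a = 1 - (b + c) := by linarith
      ext
      · simp [h1, ha1]; field_simp; ring
      · simp [h2, ha1]; field_simp; ring

/-- The open triangle, described by positive barycentric coordinates. -/
def Triangle.cell (K : Triangle) : Set (ℝ × ℝ) :=
  {x | ∃ a b c : ℝ, 0 < a ∧ 0 < b ∧ 0 < c ∧ a + b + c = 1 ∧
      x.1 = a * K.p.1 + b * K.q.1 + c * K.r.1 ∧ x.2 = a * K.p.2 + b * K.q.2 + c * K.r.2}

/-- Twice the signed area of a triangle. -/
def Triangle.det (K : Triangle) : ℝ :=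
  (K.q.1 - K.p.1) * (K.r.2 - K.p.2) - (K.r.1 - K.p.1) * (K.q.2 - K.p.2)

theorem Triangle.cell_subset_carrier (K : Triangle) : K.cell ⊆ K.carrier := by
  rintro x ⟨a, b, c, ha, hb, hc, h⟩
  exact (K.mem_carrier_iff x).2 ⟨a, b, c, ha.le, hb.le, hc.le, h⟩

/-- The linear map which takes `x - p` to the barycentric coordinates of `x` with respect to the
vertices `q` and `r`. -/
noncomputable def Triangle.toRef (K : Triangle) : ℝ × ℝ →ₗ[ℝ] ℝ × ℝ :=
  Matrix.toLin (Module.Basis.finTwoProd ℝ) (Module.Basis.finTwoProd ℝ)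
    !![(K.r.2 - K.p.2) / K.det, -(K.r.1 - K.p.1) / K.det;
      -(K.q.2 - K.p.2) / K.det, (K.q.1 - K.p.1) / K.det]

theorem Triangle.toRef_apply (K : Triangle) (v : ℝ × ℝ) :
    K.toRef v = ((K.r.2 - K.p.2) / K.det * v.1 + -(K.r.1 - K.p.1) / K.det * v.2,
      -(K.q.2 - K.p.2) / K.det * v.1 + (K.q.1 - K.p.1) / K.det * v.2) :=
  Matrix.toLin_finTwoProd_apply _ _ _ _ _

theorem Triangle.det_toRef (K : Triangle) (hK : K.det ≠ 0) : LinearMap.det K.toRef = K.det⁻¹ := by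
  rw [Triangle.toRef, LinearMap.det_toLin, Matrix.det_fin_two_of]
  field_simp
  rw [Triangle.det]; ring

theorem Triangle.toRef_comb (K : Triangle) (hK : K.det ≠ 0) {x : ℝ × ℝ} {a b c : ℝ}
    (habc : a + b + c = 1) (h1 : x.1 = a * K.p.1 + b * K.q.1 + c * K.r.1)
    (h2 : x.2 = a * K.p.2 + b * K.q.2 + c * K.r.2) : K.toRef (x - K.p) = (b, c) := by
  have ha : a = 1 - b - c := by linarith
  subst ha
  rw [Triangle.toRef_apply]
  ext
  · simp only [Prod.fst_sub, Prod.snd_sub, h1, h2]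
    field_simp
    rw [Triangle.det]; ring
  · simp only [Prod.fst_sub, Prod.snd_sub, h1, h2]
    field_simp
    rw [Triangle.det]; ring

theorem Triangle.comb_toRef (K : Triangle) (hK : K.det ≠ 0) (x : ℝ × ℝ) :
    x.1 = (1 - (K.toRef (x - K.p)).1 - (K.toRef (x - K.p)).2) * K.p.1
      + (K.toRef (x - K.p)).1 * K.q.1 + (K.toRef (x - K.p)).2 * K.r.1 ∧
    x.2 = (1 - (K.toRef (x - K.p)).1 - (K.toRef (x - K.p)).2) * K.p.2
      + (K.toRef (x - K.p)).1 * K.q.2 + (K.toRef (x - K.p)).2 * K.r.2 := by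
  rw [Triangle.toRef_apply]
  constructor
  · simp only [Prod.fst_sub, Prod.snd_sub]
    field_simp
    rw [Triangle.det]; ring
  · simp only [Prod.fst_sub, Prod.snd_sub]
    field_simp
    rw [Triangle.det]; ring

/-- The open reference triangle with the vertices `(0, 0)`, `(1, 0)` and `(0, 1)`. -/
def openSimplex : Set (ℝ × ℝ) := {y | 0 < y.1 ∧ 0 < y.2 ∧ y.1 + y.2 < 1}

/-- The closed reference triangle with the vertices `(0, 0)`, `(1, 0)` and `(0, 1)`. -/
def closedSimplex : Set (ℝ × ℝ) := {y | 0 ≤ y.1 ∧ 0 ≤ y.2 ∧ y.1 + y.2 ≤ 1}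

theorem Triangle.cell_eq_preimage (K : Triangle) (hK : K.det ≠ 0) :
    K.cell = (fun x => x - K.p) ⁻¹' (K.toRef ⁻¹' openSimplex) := by
  ext x
  constructor
  · rintro ⟨a, b, c, ha, hb, hc, habc, h1, h2⟩
    simp only [mem_preimage, K.toRef_comb hK habc h1 h2]
    exact ⟨hb, hc, by simp only; linarith⟩
  · rintro ⟨hb, hc, hbc⟩
    exact ⟨_, _, _, by linarith, hb, hc, by ring, K.comb_toRef hK x⟩

theorem Triangle.carrier_eq_preimage (K : Triangle) (hK : K.det ≠ 0) :
    K.carrier = (fun x => x - K.p) ⁻¹' (K.toRef ⁻¹' closedSimplex) := by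
  ext x
  rw [K.mem_carrier_iff]
  constructor
  · rintro ⟨a, b, c, ha, hb, hc, habc, h1, h2⟩
    simp only [mem_preimage, K.toRef_comb hK habc h1 h2]
    exact ⟨hb, hc, by simp only; linarith⟩
  · rintro ⟨hb, hc, hbc⟩
    exact ⟨_, _, _, by linarith, hb, hc, by ring, K.comb_toRef hK x⟩

theorem isOpen_openSimplex : IsOpen openSimplex := by
  refine (isOpen_lt continuous_const continuous_fst).inter
    ((isOpen_lt continuous_const continuous_snd).inter
      (isOpen_lt (continuous_fst.add continuous_snd) continuous_const))

theorem volume_openSimplex : volume openSimplex = ENNReal.ofReal (1 / 2) := by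
  have : openSimplex = regionBetween (fun _ => (0 : ℝ)) (fun x => 1 - x) (Ioo 0 1) := by
    ext ⟨x, y⟩
    simp only [openSimplex, regionBetween, mem_ofPred_eq, mem_Ioo]
    constructor
    · rintro ⟨h1, h2, h3⟩; exact ⟨⟨h1, by linarith⟩, h2, by linarith⟩
    · rintro ⟨⟨h1, _⟩, h2, h3⟩; exact ⟨h1, h2, by linarith⟩
  rw [this, Measure.volume_eq_prod, volume_regionBetween_eq_integral]
  · congr 1
    rw [← integral_Ioc_eq_integral_Ioo, ← intervalIntegral.integral_of_le zero_le_one]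
    simp only [Pi.sub_apply, sub_zero]
    rw [intervalIntegral.integral_sub (by simp) (by simp)]
    norm_num
  · exact integrableOn_const (by simp)
  · exact (continuous_const.sub continuous_id).integrableOn_Icc.mono_set Ioo_subset_Icc_self
  · exact measurableSet_Ioo
  · intro x hx; simpa using hx.2.le

theorem volume_closedSimplex_diff : volume (closedSimplex \ openSimplex) = 0 := by
  have hx : volume {y : ℝ × ℝ | y.1 = 0} = 0 := by
    rw [Measure.volume_eq_prod, show {y : ℝ × ℝ | y.1 = 0} = {0} ×ˢ univ by ext; simp,
      Measure.prod_prod]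
    simp
  have hy : volume {y : ℝ × ℝ | y.2 = 0} = 0 := by
    rw [Measure.volume_eq_prod, show {y : ℝ × ℝ | y.2 = 0} = univ ×ˢ {0} by ext; simp,
      Measure.prod_prod]
    simp
  have hxy : volume {y : ℝ × ℝ | y.1 + y.2 = 1} = 0 := by
    rw [Measure.volume_eq_prod, Measure.measure_prod_null]
    · refine Filter.Eventually.of_forall fun x => ?_
      have : Prod.mk x ⁻¹' {y : ℝ × ℝ | y.1 + y.2 = 1} = {1 - x} := by
        ext y
        simp only [mem_preimage, mem_ofPred_eq, mem_singleton_iff]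
        constructor <;> intro h <;> linarith
      simp [this]
    · exact measurableSet_eq_fun (measurable_fst.add measurable_snd) measurable_const
  refine measure_mono_null ?_ (measure_union_null hx (measure_union_null hy hxy))
  rintro y ⟨⟨h1, h2, h3⟩, h⟩
  by_contra hcon
  simp only [mem_union, mem_ofPred_eq, not_or] at hcon
  exact h ⟨lt_of_le_of_ne h1 (Ne.symm hcon.1), lt_of_le_of_ne h2 (Ne.symm hcon.2.1),
    lt_of_le_of_ne h3 hcon.2.2⟩

theorem Triangle.volume_preimage (K : Triangle) (hK : K.det ≠ 0) (s : Set (ℝ × ℝ)) :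
    volume ((fun x => x - K.p) ⁻¹' (K.toRef ⁻¹' s)) = ENNReal.ofReal |K.det| * volume s := by
  simp only [sub_eq_add_neg]
  rw [measure_preimage_add_right, Measure.addHaar_preimage_linearMap, K.det_toRef hK, inv_inv]
  rw [K.det_toRef hK]
  exact inv_ne_zero hK

theorem Triangle.volume_cell (K : Triangle) (hK : K.det ≠ 0) :
    volume K.cell = ENNReal.ofReal (|K.det| / 2) := by
  rw [K.cell_eq_preimage hK, K.volume_preimage hK, volume_openSimplex,
    ← ENNReal.ofReal_mul (abs_nonneg _)]
  congr 1; ring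

theorem Triangle.volume_carrier_diff_cell (K : Triangle) (hK : K.det ≠ 0) :
    volume (K.carrier \ K.cell) = 0 := by
  rw [K.carrier_eq_preimage hK, K.cell_eq_preimage hK, ← preimage_sdiff, ← preimage_sdiff,
    K.volume_preimage hK, volume_closedSimplex_diff, mul_zero]

theorem Triangle.isOpen_cell (K : Triangle) (hK : K.det ≠ 0) : IsOpen K.cell := by
  rw [K.cell_eq_preimage hK]
  exact (isOpen_openSimplex.preimage (LinearMap.continuous_of_finiteDimensional _)).preimage
    (continuous_id.sub continuous_const)

/-- The integrand of the Dirichlet form. -/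
noncomputable def gradDot (u v : ℝ × ℝ → ℝ) (x : ℝ × ℝ) : ℝ :=
  fderiv ℝ u x (1, 0) * fderiv ℝ v x (1, 0) + fderiv ℝ u x (0, 1) * fderiv ℝ v x (0, 1)

/-- The Dirichlet energy of two functions that are affine on the triangle, as a function of the
values at its vertices: the inverse of the Gram matrix of two edge vectors gives the inner product
of the gradients. -/
noncomputable def Triangle.energy (K : Triangle) (u v : ℝ × ℝ → ℝ) : ℝ :=
  (((K.r.1 - K.p.1) ^ 2 + (K.r.2 - K.p.2) ^ 2) * ((u K.q - u K.p) * (v K.q - v K.p))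
    - ((K.q.1 - K.p.1) * (K.r.1 - K.p.1) + (K.q.2 - K.p.2) * (K.r.2 - K.p.2))
      * ((u K.q - u K.p) * (v K.r - v K.p) + (u K.r - u K.p) * (v K.q - v K.p))
    + ((K.q.1 - K.p.1) ^ 2 + (K.q.2 - K.p.2) ^ 2) * ((u K.r - u K.p) * (v K.r - v K.p)))
    / (2 * |K.det|)

theorem fderiv_of_eqOn_affine {u : ℝ × ℝ → ℝ} {s : Set (ℝ × ℝ)} (hs : IsOpen s) {a b c : ℝ}
    (h : ∀ x ∈ s, u x = a * x.1 + b * x.2 + c) {x : ℝ × ℝ} (hx : x ∈ s) :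
    fderiv ℝ u x (1, 0) = a ∧ fderiv ℝ u x (0, 1) = b := by
  have h1 : u =ᶠ[nhds x] fun x => a * x.1 + b * x.2 + c :=
    Filter.eventuallyEq_of_mem (hs.mem_nhds hx) h
  have h2 : HasFDerivAt (fun x : ℝ × ℝ => a * x.1 + b * x.2 + c)
      (a • ContinuousLinearMap.fst ℝ ℝ ℝ + b • ContinuousLinearMap.snd ℝ ℝ ℝ) x :=
    ((hasFDerivAt_fst.const_mul a).add (hasFDerivAt_snd.const_mul b)).add_const c
  rw [h1.fderiv_eq, h2.fderiv]
  simp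

theorem Triangle.p_mem (K : Triangle) : K.p ∈ K.carrier :=
  subset_convexHull ℝ _ (by simp [Triangle.vertices])
theorem Triangle.q_mem (K : Triangle) : K.q ∈ K.carrier :=
  subset_convexHull ℝ _ (by simp [Triangle.vertices])
theorem Triangle.r_mem (K : Triangle) : K.r ∈ K.carrier :=
  subset_convexHull ℝ _ (by simp [Triangle.vertices])

theorem Triangle.gradDot_eq (K : Triangle) (hK : K.det ≠ 0) {u v : ℝ × ℝ → ℝ}
    (hu : IsAffineOn u K.carrier) (hv : IsAffineOn v K.carrier) {x : ℝ × ℝ} (hx : x ∈ K.cell) :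
    gradDot u v x = K.energy u v / (|K.det| / 2) := by
  obtain ⟨a, b, c, h⟩ := hu
  obtain ⟨a', b', c', h'⟩ := hv
  have hs := K.isOpen_cell hK
  obtain ⟨e1, e2⟩ := fderiv_of_eqOn_affine hs (fun y hy => h y (K.cell_subset_carrier hy)) hx
  obtain ⟨e1', e2'⟩ := fderiv_of_eqOn_affine hs (fun y hy => h' y (K.cell_subset_carrier hy)) hx
  rw [gradDot, e1, e2, e1', e2', Triangle.energy, h _ K.p_mem, h _ K.q_mem, h _ K.r_mem,
    h' _ K.p_mem, h' _ K.q_mem, h' _ K.r_mem]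
  have hd : |K.det| ≠ 0 := abs_ne_zero.2 hK
  field_simp
  rw [sq_abs, Triangle.det]
  ring

theorem Triangle.integrableOn_cell (K : Triangle) (hK : K.det ≠ 0) {u v : ℝ × ℝ → ℝ}
    (hu : IsAffineOn u K.carrier) (hv : IsAffineOn v K.carrier) :
    IntegrableOn (gradDot u v) K.cell := by
  have : IntegrableOn (fun _ : ℝ × ℝ => K.energy u v / (|K.det| / 2)) K.cell :=
    integrableOn_const (by rw [K.volume_cell hK]; exact ENNReal.ofReal_ne_top)
  exact this.congr_fun (fun x hx => (K.gradDot_eq hK hu hv hx).symm)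
    (K.isOpen_cell hK).measurableSet

theorem Triangle.integral_cell (K : Triangle) (hK : K.det ≠ 0) {u v : ℝ × ℝ → ℝ}
    (hu : IsAffineOn u K.carrier) (hv : IsAffineOn v K.carrier) :
    ∫ x in K.cell, gradDot u v x = K.energy u v := by
  rw [setIntegral_congr_fun (K.isOpen_cell hK).measurableSet
    (fun x hx => K.gradDot_eq hK hu hv hx), setIntegral_const, measureReal_def, K.volume_cell hK,
    ENNReal.toReal_ofReal (by positivity), smul_eq_mul]
  have hd : |K.det| ≠ 0 := abs_ne_zero.2 hK
  field_simp

/-- An integral over an open set which is partitioned into triangles is the sum of the integrals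
over the triangles. -/
theorem setIntegral_eq_sum_cells {ι : Type*} (s : Finset ι) (K : ι → Triangle)
    (hK : ∀ k ∈ s, (K k).det ≠ 0) {O : Set (ℝ × ℝ)} (hO : ∀ k ∈ s, (K k).cell ⊆ O)
    (hcov : O ⊆ ⋃ k ∈ s, (K k).carrier)
    (hdisj : ∀ k ∈ s, ∀ l ∈ s, k ≠ l → Disjoint (K k).cell (K l).cell) {g : ℝ × ℝ → ℝ}
    (hg : ∀ k ∈ s, IntegrableOn g (K k).cell) :
    IntegrableOn g O ∧ ∫ x in O, g x = ∑ k ∈ s, ∫ x in (K k).cell, g x := by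
  have hae : O =ᵐ[volume] ⋃ k ∈ s, (K k).cell := by
    refine Filter.EventuallyLE.antisymm ?_ (iUnion₂_subset hO).eventuallyLE
    rw [ae_le_set]
    refine measure_mono_null (t := ⋃ k ∈ s, (K k).carrier \ (K k).cell) ?_ ?_
    · rintro x ⟨hx, hx'⟩
      obtain ⟨k, hk, hxk⟩ := mem_iUnion₂.1 (hcov hx)
      exact mem_iUnion₂.2 ⟨k, hk, hxk, fun h => hx' (mem_iUnion₂.2 ⟨k, hk, h⟩)⟩
    · exact (measure_biUnion_null_iff s.countable_toSet).2 fun k hk =>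
        (K k).volume_carrier_diff_cell (hK k hk)
  constructor
  · rw [integrableOn_congr_set_ae hae]
    exact integrableOn_finset_iUnion.2 hg
  · rw [setIntegral_congr_set hae]
    exact integral_biUnion_finset s (fun k hk => ((K k).isOpen_cell (hK k hk)).measurableSet)
      (fun k hk l hl hkl => hdisj k hk l hl hkl) hg

/-! ### Grid triangles and their reference coordinates -/

/-- The triangle `B C A` of the reference configuration. -/
def refTriangle : Triangle := ⟨(0, 0), (1, 0), (0, 1)⟩

/-- The neighbor of the reference triangle across the leg from `(0, 0)` to `(1, 0)`. -/
def refNeighbor : Triangle := ⟨(1, 0), (0, 0), (1, -1)⟩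

theorem mem_carrier_refTriangle (x : ℝ × ℝ) :
    x ∈ refTriangle.carrier ↔ 0 ≤ x.1 ∧ 0 ≤ x.2 ∧ x.1 + x.2 ≤ 1 := by
  rw [Triangle.mem_carrier_iff]
  constructor
  · rintro ⟨a, b, c, ha, hb, hc, h, h1, h2⟩
    simp only [refTriangle] at h1 h2
    exact ⟨by linarith, by linarith, by linarith⟩
  · rintro ⟨h1, h2, h3⟩
    exact ⟨1 - x.1 - x.2, x.1, x.2, by linarith, h1, h2, by ring, by simp [refTriangle],
      by simp [refTriangle]⟩

theorem mem_cell_refTriangle (x : ℝ × ℝ) :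
    x ∈ refTriangle.cell ↔ 0 < x.1 ∧ 0 < x.2 ∧ x.1 + x.2 < 1 := by
  constructor
  · rintro ⟨a, b, c, ha, hb, hc, h, h1, h2⟩
    simp only [refTriangle] at h1 h2
    exact ⟨by linarith, by linarith, by linarith⟩
  · rintro ⟨h1, h2, h3⟩
    exact ⟨1 - x.1 - x.2, x.1, x.2, by linarith, h1, h2, by ring, by simp [refTriangle],
      by simp [refTriangle]⟩

theorem mem_carrier_refNeighbor (x : ℝ × ℝ) :
    x ∈ refNeighbor.carrier ↔ x.1 ≤ 1 ∧ x.2 ≤ 0 ∧ 0 ≤ x.1 + x.2 := by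
  rw [Triangle.mem_carrier_iff]
  constructor
  · rintro ⟨a, b, c, ha, hb, hc, h, h1, h2⟩
    simp only [refNeighbor] at h1 h2
    exact ⟨by linarith, by linarith, by linarith⟩
  · rintro ⟨h1, h2, h3⟩
    exact ⟨x.1 + x.2, 1 - x.1, -x.2, by linarith, by linarith, by linarith, by ring,
      by simp [refNeighbor], by simp [refNeighbor]⟩

theorem mem_cell_refNeighbor (x : ℝ × ℝ) :
    x ∈ refNeighbor.cell ↔ x.1 < 1 ∧ x.2 < 0 ∧ 0 < x.1 + x.2 := by
  constructor
  · rintro ⟨a, b, c, ha, hb, hc, h, h1, h2⟩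
    simp only [refNeighbor] at h1 h2
    exact ⟨by linarith, by linarith, by linarith⟩
  · rintro ⟨h1, h2, h3⟩
    exact ⟨x.1 + x.2, 1 - x.1, -x.2, by linarith, by linarith, by linarith, by ring,
      by simp [refNeighbor], by simp [refNeighbor]⟩

/-- The orientation of the legs of a grid triangle, as seen from the right angle. -/
def GridTriangle.sign (T : GridTriangle) : ℝ := if T.upper then -1 else 1

theorem GridTriangle.sign_mul_self (T : GridTriangle) : T.sign * T.sign = 1 := by
  unfold GridTriangle.sign; split_ifs <;> norm_num

namespace EmbeddedMesh
variable (𝓜 : EmbeddedMesh)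

theorem h_ne : 𝓜.h ≠ 0 := 𝓜.h_pos.ne'

/-- The inverse of `refPoint`: the reference coordinates of a point with respect to a grid
triangle. -/
noncomputable def refCoord (T : GridTriangle) (x : ℝ × ℝ) : ℝ × ℝ :=
  let X := T.sign * ((x.1 - 𝓜.x₀) / 𝓜.h - T.corner.1)
  let Y := T.sign * ((x.2 - 𝓜.y₀) / 𝓜.h - T.corner.2)
  if 𝓜.vert T then (Y, X) else (X, Y)

theorem refPoint_eq (T : GridTriangle) (s y : ℝ) : 𝓜.refPoint T s y =
    (𝓜.x₀ + 𝓜.h * (T.corner.1 + T.sign * (if 𝓜.vert T then y else s)),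
      𝓜.y₀ + 𝓜.h * (T.corner.2 + T.sign * (if 𝓜.vert T then s else y))) := by
  obtain ⟨i, j, b⟩ := T
  cases hv : 𝓜.vert ⟨i, j, b⟩ <;> cases b <;>
    ext <;> simp [refPoint, node, hv, GridTriangle.corner, GridTriangle.sign,
      GridTriangle.horizontalEnd, GridTriangle.verticalEnd] <;> ring

theorem refCoord_refPoint (T : GridTriangle) (s y : ℝ) :
    𝓜.refCoord T (𝓜.refPoint T s y) = (s, y) := by
  have h := 𝓜.h_ne
  have hs := T.sign_mul_self
  rw [refPoint_eq, refCoord]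
  have e : ∀ a b c : ℝ, T.sign * ((a + 𝓜.h * (b + T.sign * c) - a) / 𝓜.h - b) = c := by
    intro a b c
    have : (a + 𝓜.h * (b + T.sign * c) - a) / 𝓜.h - b = T.sign * c := by field_simp; ring
    rw [this, ← mul_assoc, hs, one_mul]
  simp only [e]
  split_ifs <;> rfl

theorem refPoint_refCoord (T : GridTriangle) (x : ℝ × ℝ) :
    𝓜.refPoint T (𝓜.refCoord T x).1 (𝓜.refCoord T x).2 = x := by
  have h := 𝓜.h_ne
  have hs := T.sign_mul_self
  rw [refPoint_eq, refCoord]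
  have e : ∀ a b c : ℝ, a + 𝓜.h * (b + T.sign * (T.sign * ((c - a) / 𝓜.h - b))) = c := by
    intro a b c
    rw [← mul_assoc T.sign, hs]
    field_simp
    ring
  ext
  · split_ifs <;> simp only [e]
  · split_ifs <;> simp only [e]

/-- The image of a triangle of the reference configuration. -/
def place (T : GridTriangle) (K : Triangle) : Triangle :=
  ⟨𝓜.refPoint T K.p.1 K.p.2, 𝓜.refPoint T K.q.1 K.q.2, 𝓜.refPoint T K.r.1 K.r.2⟩

/-- Reference coordinates respect affine combinations. -/
theorem refPoint_comb (T : GridTriangle) {a b c : ℝ} (h : a + b + c = 1) (p q r : ℝ × ℝ)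
    (x : ℝ × ℝ) :
    (x.1 = a * (𝓜.refPoint T p.1 p.2).1 + b * (𝓜.refPoint T q.1 q.2).1
        + c * (𝓜.refPoint T r.1 r.2).1 ∧
      x.2 = a * (𝓜.refPoint T p.1 p.2).2 + b * (𝓜.refPoint T q.1 q.2).2
        + c * (𝓜.refPoint T r.1 r.2).2) ↔
    (𝓜.refCoord T x).1 = a * p.1 + b * q.1 + c * r.1 ∧
      (𝓜.refCoord T x).2 = a * p.2 + b * q.2 + c * r.2 := by
  have key : ((a * (𝓜.refPoint T p.1 p.2).1 + b * (𝓜.refPoint T q.1 q.2).1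
        + c * (𝓜.refPoint T r.1 r.2).1, a * (𝓜.refPoint T p.1 p.2).2
        + b * (𝓜.refPoint T q.1 q.2).2 + c * (𝓜.refPoint T r.1 r.2).2) : ℝ × ℝ) =
      𝓜.refPoint T (a * p.1 + b * q.1 + c * r.1) (a * p.2 + b * q.2 + c * r.2) := by
    have ha : a = 1 - b - c := by linarith
    subst ha
    simp only [refPoint_eq]
    ext
    · simp only; split_ifs <;> ring
    · simp only; split_ifs <;> ring
  constructor
  · rintro ⟨h1, h2⟩
    have hx : x = 𝓜.refPoint T (a * p.1 + b * q.1 + c * r.1) (a * p.2 + b * q.2 + c * r.2) := by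
      rw [← key]; exact Prod.ext h1 h2
    rw [hx, refCoord_refPoint]
    exact ⟨rfl, rfl⟩
  · rintro ⟨h1, h2⟩
    have hx := 𝓜.refPoint_refCoord T x
    rw [h1, h2, ← key] at hx
    rw [Prod.ext_iff] at hx
    exact ⟨hx.1.symm, hx.2.symm⟩

theorem mem_carrier_place (T : GridTriangle) (K : Triangle) (x : ℝ × ℝ) :
    x ∈ (𝓜.place T K).carrier ↔ 𝓜.refCoord T x ∈ K.carrier := by
  rw [Triangle.mem_carrier_iff, Triangle.mem_carrier_iff]
  refine exists_congr fun a => exists_congr fun b => exists_congr fun c => ?_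
  constructor
  · rintro ⟨ha, hb, hc, h, hx⟩
    exact ⟨ha, hb, hc, h, (𝓜.refPoint_comb T h K.p K.q K.r x).1 hx⟩
  · rintro ⟨ha, hb, hc, h, hx⟩
    exact ⟨ha, hb, hc, h, (𝓜.refPoint_comb T h K.p K.q K.r x).2 hx⟩

theorem mem_cell_place (T : GridTriangle) (K : Triangle) (x : ℝ × ℝ) :
    x ∈ (𝓜.place T K).cell ↔ 𝓜.refCoord T x ∈ K.cell := by
  refine exists_congr fun a => exists_congr fun b => exists_congr fun c => ?_
  constructor
  · rintro ⟨ha, hb, hc, h, hx⟩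
    exact ⟨ha, hb, hc, h, (𝓜.refPoint_comb T h K.p K.q K.r x).1 hx⟩
  · rintro ⟨ha, hb, hc, h, hx⟩
    exact ⟨ha, hb, hc, h, (𝓜.refPoint_comb T h K.p K.q K.r x).2 hx⟩

theorem det_place (T : GridTriangle) (K : Triangle) :
    (𝓜.place T K).det = (if 𝓜.vert T then -1 else 1) * 𝓜.h ^ 2 * K.det := by
  have hs : T.sign ^ 2 = 1 := by rw [sq, T.sign_mul_self]
  simp only [place, Triangle.det, refPoint_eq]
  split_ifs
  · linear_combination (-1 * 𝓜.h ^ 2 *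
      ((K.q.1 - K.p.1) * (K.r.2 - K.p.2) - (K.r.1 - K.p.1) * (K.q.2 - K.p.2))) * hs
  · linear_combination (𝓜.h ^ 2 *
      ((K.q.1 - K.p.1) * (K.r.2 - K.p.2) - (K.r.1 - K.p.1) * (K.q.2 - K.p.2))) * hs

theorem abs_det_place (T : GridTriangle) (K : Triangle) :
    |(𝓜.place T K).det| = 𝓜.h ^ 2 * |K.det| := by
  rw [det_place, abs_mul, abs_mul, abs_of_pos (pow_pos 𝓜.h_pos 2)]
  split_ifs <;> simp

theorem det_place_ne (T : GridTriangle) (K : Triangle) (hK : K.det ≠ 0) :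
    (𝓜.place T K).det ≠ 0 := by
  rw [← abs_ne_zero, abs_det_place]
  exact mul_ne_zero (pow_ne_zero _ 𝓜.h_ne) (abs_ne_zero.2 hK)

/-- The energy is invariant under similarities. -/
theorem energy_place (T : GridTriangle) (K : Triangle) (hK : K.det ≠ 0) (u v : ℝ × ℝ → ℝ) :
    (𝓜.place T K).energy u v = K.energy (fun x => u (𝓜.refPoint T x.1 x.2))
      (fun x => v (𝓜.refPoint T x.1 x.2)) := by
  have hs : T.sign ^ 2 = 1 := by rw [sq, T.sign_mul_self]
  have e1 : ∀ p q : ℝ × ℝ, ((𝓜.refPoint T q.1 q.2).1 - (𝓜.refPoint T p.1 p.2).1) ^ 2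
      + ((𝓜.refPoint T q.1 q.2).2 - (𝓜.refPoint T p.1 p.2).2) ^ 2
      = 𝓜.h ^ 2 * ((q.1 - p.1) ^ 2 + (q.2 - p.2) ^ 2) := by
    intro p q
    simp only [refPoint_eq]
    split_ifs <;> linear_combination 𝓜.h ^ 2 * ((q.1 - p.1) ^ 2 + (q.2 - p.2) ^ 2) * hs
  have e2 : ∀ p q r : ℝ × ℝ, ((𝓜.refPoint T q.1 q.2).1 - (𝓜.refPoint T p.1 p.2).1)
        * ((𝓜.refPoint T r.1 r.2).1 - (𝓜.refPoint T p.1 p.2).1)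
      + ((𝓜.refPoint T q.1 q.2).2 - (𝓜.refPoint T p.1 p.2).2)
        * ((𝓜.refPoint T r.1 r.2).2 - (𝓜.refPoint T p.1 p.2).2)
      = 𝓜.h ^ 2 * ((q.1 - p.1) * (r.1 - p.1) + (q.2 - p.2) * (r.2 - p.2)) := by
    intro p q r
    simp only [refPoint_eq]
    split_ifs <;> linear_combination
      𝓜.h ^ 2 * ((q.1 - p.1) * (r.1 - p.1) + (q.2 - p.2) * (r.2 - p.2)) * hs
  have hd : |K.det| ≠ 0 := abs_ne_zero.2 hK
  have hh := 𝓜.h_ne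
  simp only [Triangle.energy]
  rw [abs_det_place]
  simp only [place, e1, e2]
  field_simp

theorem isAffineOn_place (T : GridTriangle) {K : Triangle} {β : ℝ × ℝ → ℝ}
    (h : IsAffineOn β K.carrier) : IsAffineOn (fun x => β (𝓜.refCoord T x))
      (𝓜.place T K).carrier := by
  obtain ⟨a, b, c, h⟩ := h
  by_cases hv : 𝓜.vert T
  · refine ⟨b * T.sign / 𝓜.h, a * T.sign / 𝓜.h,
      b * T.sign * (-𝓜.x₀ / 𝓜.h - T.corner.1) + a * T.sign * (-𝓜.y₀ / 𝓜.h - T.corner.2) + c,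
      fun x hx => ?_⟩
    refine (h _ ((𝓜.mem_carrier_place T K x).1 hx)).trans ?_
    simp only [refCoord, hv, if_true]
    ring
  · refine ⟨a * T.sign / 𝓜.h, b * T.sign / 𝓜.h,
      a * T.sign * (-𝓜.x₀ / 𝓜.h - T.corner.1) + b * T.sign * (-𝓜.y₀ / 𝓜.h - T.corner.2) + c,
      fun x hx => ?_⟩
    refine (h _ ((𝓜.mem_carrier_place T K x).1 hx)).trans ?_
    simp only [refCoord, hv, Bool.false_eq_true, if_false]
    ring

theorem continuous_refCoord (T : GridTriangle) : Continuous (𝓜.refCoord T) := by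
  unfold refCoord
  by_cases hv : 𝓜.vert T
  · simp only [hv, if_true]; fun_prop
  · simp only [hv, Bool.false_eq_true, if_false]; fun_prop

/-- A point in units of the grid. -/
noncomputable def gridCoord (x : ℝ × ℝ) : ℝ × ℝ := ((x.1 - 𝓜.x₀) / 𝓜.h, (x.2 - 𝓜.y₀) / 𝓜.h)

theorem gridCoord_node (v : ℤ × ℤ) : 𝓜.gridCoord (𝓜.node v) = ((v.1 : ℝ), (v.2 : ℝ)) := by
  have := 𝓜.h_ne
  simp only [gridCoord, node]
  ext <;> simp <;> field_simp

theorem carrier_plainTriangle (T : GridTriangle) :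
    (𝓜.plainTriangle T).carrier = (𝓜.place T refTriangle).carrier := by
  rw [Triangle.carrier, Triangle.carrier]
  congr 1
  by_cases hv : 𝓜.vert T
  · simp only [plainTriangle, place, refTriangle, Triangle.vertices, refPoint, hv, if_true]
    simp [Set.pair_comm]
  · simp only [plainTriangle, place, refTriangle, Triangle.vertices, refPoint, hv]
    simp

theorem cell_congr_swap (p q r : ℝ × ℝ) : (⟨p, q, r⟩ : Triangle).cell = (⟨p, r, q⟩ : Triangle).cell := by
  ext x
  constructor <;>
  · rintro ⟨a, b, c, ha, hb, hc, h, h1, h2⟩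
    exact ⟨a, c, b, ha, hc, hb, by linarith, by simp only at h1 ⊢; linarith,
      by simp only at h2 ⊢; linarith⟩

theorem carrier_congr_swap (p q r : ℝ × ℝ) :
    (⟨p, q, r⟩ : Triangle).carrier = (⟨p, r, q⟩ : Triangle).carrier := by
  rw [Triangle.carrier, Triangle.carrier, Triangle.vertices, Triangle.vertices]
  simp [Set.pair_comm]

theorem cell_plainTriangle (T : GridTriangle) :
    (𝓜.plainTriangle T).cell = (𝓜.place T refTriangle).cell := by
  by_cases hv : 𝓜.vert T
  · simp only [plainTriangle, place, refTriangle, refPoint, hv, if_true]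
    rw [cell_congr_swap]
    simp
  · simp only [plainTriangle, place, refTriangle, refPoint, hv]
    simp

/-- The neighbor across the leg that carries the added midpoint. -/
def nbr (T : GridTriangle) : GridTriangle := T.acrossLeg (𝓜.vert T)

/-- The neighbor is the image of the reference neighbor, but for the order of the vertices. -/
theorem plainTriangle_nbr (T : GridTriangle) :
    𝓜.plainTriangle (𝓜.nbr T) = 𝓜.place T refNeighbor ∨
    𝓜.plainTriangle (𝓜.nbr T) = ⟨(𝓜.place T refNeighbor).p, (𝓜.place T refNeighbor).r,
      (𝓜.place T refNeighbor).q⟩ := by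
  simp only [place, refPoint_eq, refNeighbor, plainTriangle, nbr]
  obtain ⟨i, j, b⟩ := T
  cases hv : 𝓜.vert ⟨i, j, b⟩ <;> cases b <;>
    simp [node, GridTriangle.corner, GridTriangle.sign, GridTriangle.acrossLeg,
      GridTriangle.horizontalEnd, GridTriangle.verticalEnd] <;> (ring_nf; simp)

theorem carrier_plainTriangle_nbr (T : GridTriangle) :
    (𝓜.plainTriangle (𝓜.nbr T)).carrier = (𝓜.place T refNeighbor).carrier := by
  rcases 𝓜.plainTriangle_nbr T with h | h
  · rw [h]
  · rw [h, carrier_congr_swap]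

theorem cell_plainTriangle_nbr (T : GridTriangle) :
    (𝓜.plainTriangle (𝓜.nbr T)).cell = (𝓜.place T refNeighbor).cell := by
  rcases 𝓜.plainTriangle_nbr T with h | h
  · rw [h]
  · rw [h, cell_congr_swap]

end EmbeddedMesh

/-! ### The local mesh of the reference triangle -/

/-- The six triangles of the local mesh of the reference triangle, where `t` is the tangent of the
angle. -/
noncomputable def innerPiece (t : ℝ) : Fin 6 → Triangle :=
  ![⟨(0, 0), (1 / 2, 0), (1 / 4, t / 4)⟩, ⟨(1 / 2, 0), (3 / 4, t / 4), (1 / 4, t / 4)⟩,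
    ⟨(1 / 2, 0), (1, 0), (3 / 4, t / 4)⟩, ⟨(0, 0), (1 / 4, t / 4), (0, 1)⟩,
    ⟨(1 / 4, t / 4), (3 / 4, t / 4), (0, 1)⟩, ⟨(3 / 4, t / 4), (1, 0), (0, 1)⟩]

/-- The two halves of the bisected neighbor of the reference triangle. -/
noncomputable def outerPiece : Fin 2 → Triangle :=
  ![⟨(0, 0), (1 / 2, 0), (1, -1)⟩, ⟨(1 / 2, 0), (1, 0), (1, -1)⟩]

theorem det_innerPiece (t : ℝ) (k : Fin 6) : (innerPiece t k).det =
    ![t / 8, t / 8, t / 8, 1 / 4, (4 - t) / 8, (1 - t) / 4] k := by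
  fin_cases k <;> simp [innerPiece, Triangle.det] <;> ring

theorem det_outerPiece (k : Fin 2) : (outerPiece k).det = -(1 / 2) := by
  fin_cases k <;> simp [outerPiece, Triangle.det] <;> ring

theorem det_innerPiece_pos {t : ℝ} (h0 : 0 < t) (h1 : t < 1) (k : Fin 6) :
    0 < (innerPiece t k).det := by
  rw [det_innerPiece]
  fin_cases k <;> simp <;> linarith

theorem carrier_innerPiece_subset {t : ℝ} (h0 : 0 < t) (h1 : t < 1) (k : Fin 6) :
    (innerPiece t k).carrier ⊆ refTriangle.carrier := by
  intro x hx
  rw [mem_carrier_refTriangle]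
  rw [Triangle.mem_carrier_iff] at hx
  obtain ⟨a, b, c, ha, hb, hc, h, e1, e2⟩ := hx
  have hat := mul_nonneg ha h0.le
  have hbt := mul_nonneg hb h0.le
  have hct := mul_nonneg hc h0.le
  have hat' := mul_nonneg ha (sub_nonneg.2 h1.le)
  have hbt' := mul_nonneg hb (sub_nonneg.2 h1.le)
  have hct' := mul_nonneg hc (sub_nonneg.2 h1.le)
  rw [e1, e2]
  fin_cases k <;> simp [innerPiece] <;> refine ⟨?_, ?_, ?_⟩ <;> linarith

theorem carrier_outerPiece_subset (k : Fin 2) :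
    (outerPiece k).carrier ⊆ refNeighbor.carrier := by
  intro x hx
  rw [mem_carrier_refNeighbor]
  rw [Triangle.mem_carrier_iff] at hx
  obtain ⟨a, b, c, ha, hb, hc, h, e1, e2⟩ := hx
  rw [e1, e2]
  fin_cases k <;> simp [outerPiece] <;> (try refine ⟨?_, ?_, ?_⟩) <;> linarith

/-- The linear inequalities which describe the interiors of the triangles of the local mesh. -/
def innerIneq (t : ℝ) (x : ℝ × ℝ) : Fin 6 → Prop :=
  ![0 < x.2 ∧ x.2 < t * x.1 ∧ x.2 < t * (1 / 2 - x.1),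
    x.2 < t / 4 ∧ t * (1 / 2 - x.1) < x.2 ∧ t * (x.1 - 1 / 2) < x.2,
    0 < x.2 ∧ x.2 < t * (x.1 - 1 / 2) ∧ x.2 < t * (1 - x.1),
    0 < x.1 ∧ t * x.1 < x.2 ∧ (4 - t) * x.1 < 1 - x.2,
    t / 4 < x.2 ∧ 1 - x.2 < (4 - t) * x.1 ∧ (4 - t) * x.1 < 3 * (1 - x.2),
    x.1 + x.2 < 1 ∧ 3 * (1 - x.2) < (4 - t) * x.1 ∧ t * (1 - x.1) < x.2]

theorem innerIneq_of_mem_cell {t : ℝ} (h0 : 0 < t) (h1 : t < 1) (k : Fin 6) {x : ℝ × ℝ}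
    (hx : x ∈ (innerPiece t k).cell) : innerIneq t x k := by
  obtain ⟨a, b, c, ha, hb, hc, h, e1, e2⟩ := hx
  have hat := mul_pos ha h0
  have hbt := mul_pos hb h0
  have hct := mul_pos hc h0
  have hat' := mul_pos ha (sub_pos.2 h1)
  have hbt' := mul_pos hb (sub_pos.2 h1)
  have hct' := mul_pos hc (sub_pos.2 h1)
  have hc1 : c = 1 - a - b := by linarith
  subst hc1
  fin_cases k <;> simp [innerPiece] at e1 e2 <;> simp [innerIneq, e1, e2] <;>
    refine ⟨?_, ?_, ?_⟩ <;> linarith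

theorem disjoint_cell_innerPiece {t : ℝ} (h0 : 0 < t) (h1 : t < 1) {k l : Fin 6} (hkl : k ≠ l) :
    Disjoint (innerPiece t k).cell (innerPiece t l).cell := by
  rw [Set.disjoint_left]
  intro x hk hl
  replace hk := innerIneq_of_mem_cell h0 h1 k hk
  replace hl := innerIneq_of_mem_cell h0 h1 l hl
  fin_cases k <;> fin_cases l <;> simp [innerIneq] at hk hl hkl <;> obtain ⟨k1, k2, k3⟩ := hk <;>
    obtain ⟨l1, l2, l3⟩ := hl <;> nlinarith

theorem refTriangle_subset_inner {t : ℝ} (h0 : 0 < t) (h1 : t < 1) {x : ℝ × ℝ}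
    (hx : x ∈ refTriangle.carrier) : ∃ k, x ∈ (innerPiece t k).carrier := by
  obtain ⟨x, y⟩ := x
  rw [mem_carrier_refTriangle] at hx
  simp only at hx
  obtain ⟨hx, hy, hxy⟩ := hx
  simp only [Triangle.mem_carrier_iff]
  have hq : 0 < 4 - t := by linarith
  have hr : 0 < 1 - t := by linarith
  have fin : ∀ {e f : ℝ}, 0 ≤ e → 0 < f → 0 ≤ e / f := fun he hf => div_nonneg he hf.le
  -- The point lies in the triangle `k` as soon as it satisfies the inequalities of that triangle.
  have h0' : y ≤ t * x → y ≤ t * (1 / 2 - x) → ∃ k, ∃ a b c : ℝ, 0 ≤ a ∧ 0 ≤ b ∧ 0 ≤ c ∧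
      a + b + c = 1 ∧ x = a * (innerPiece t k).p.1 + b * (innerPiece t k).q.1
        + c * (innerPiece t k).r.1 ∧ y = a * (innerPiece t k).p.2 + b * (innerPiece t k).q.2
        + c * (innerPiece t k).r.2 := by
    intro h2 h3
    refine ⟨0, (t * (1 - 2 * x) - 2 * y) / t, 2 * (t * x - y) / t, 4 * y / t,
      fin (by linarith) h0, fin (by linarith) h0, by positivity, ?_, ?_, ?_⟩
    · field_simp; ring
    · simp [innerPiece]; field_simp; ring
    · simp [innerPiece]; field_simp
  have h1' : y ≤ t / 4 → t * (1 / 2 - x) ≤ y → t * (x - 1 / 2) ≤ y → ∃ k, ∃ a b c : ℝ, 0 ≤ a ∧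
      0 ≤ b ∧ 0 ≤ c ∧ a + b + c = 1 ∧ x = a * (innerPiece t k).p.1 + b * (innerPiece t k).q.1
        + c * (innerPiece t k).r.1 ∧ y = a * (innerPiece t k).p.2 + b * (innerPiece t k).q.2
        + c * (innerPiece t k).r.2 := by
    intro h2 h3 h4
    refine ⟨1, (t - 4 * y) / t, (2 * y + 2 * (t * x) - t) / t, (2 * y - 2 * (t * x) + t) / t,
      fin (by linarith) h0, fin (by linarith) h0, fin (by linarith) h0, ?_, ?_, ?_⟩
    · field_simp; ring
    · simp [innerPiece]; field_simp; ring
    · simp [innerPiece]; field_simp; ring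
  have h2' : y ≤ t * (x - 1 / 2) → y ≤ t * (1 - x) → ∃ k, ∃ a b c : ℝ, 0 ≤ a ∧ 0 ≤ b ∧ 0 ≤ c ∧
      a + b + c = 1 ∧ x = a * (innerPiece t k).p.1 + b * (innerPiece t k).q.1
        + c * (innerPiece t k).r.1 ∧ y = a * (innerPiece t k).p.2 + b * (innerPiece t k).q.2
        + c * (innerPiece t k).r.2 := by
    intro h2 h3
    refine ⟨2, (2 * t - 2 * (t * x) - 2 * y) / t, (2 * (t * x) - t - 2 * y) / t, 4 * y / t,
      fin (by linarith) h0, fin (by linarith) h0, by positivity, ?_, ?_, ?_⟩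
    · field_simp; ring
    · simp [innerPiece]; field_simp; ring
    · simp [innerPiece]; field_simp
  have h3' : t * x ≤ y → (4 - t) * x ≤ 1 - y → ∃ k, ∃ a b c : ℝ, 0 ≤ a ∧ 0 ≤ b ∧ 0 ≤ c ∧
      a + b + c = 1 ∧ x = a * (innerPiece t k).p.1 + b * (innerPiece t k).q.1
        + c * (innerPiece t k).r.1 ∧ y = a * (innerPiece t k).p.2 + b * (innerPiece t k).q.2
        + c * (innerPiece t k).r.2 := by
    intro h2 h3
    refine ⟨3, 1 - y - (4 - t) * x, 4 * x, y - t * x,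
      by linarith, by linarith, by linarith, ?_, ?_, ?_⟩
    · ring
    · simp [innerPiece]; ring
    · simp [innerPiece]; ring
  have h4' : t / 4 ≤ y → 1 - y ≤ (4 - t) * x → (4 - t) * x ≤ 3 * (1 - y) → ∃ k, ∃ a b c : ℝ,
      0 ≤ a ∧ 0 ≤ b ∧ 0 ≤ c ∧
      a + b + c = 1 ∧ x = a * (innerPiece t k).p.1 + b * (innerPiece t k).q.1
        + c * (innerPiece t k).r.1 ∧ y = a * (innerPiece t k).p.2 + b * (innerPiece t k).q.2
        + c * (innerPiece t k).r.2 := by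
    intro h2 h3 h4
    refine ⟨4, (6 * (1 - y) - 2 * ((4 - t) * x)) / (4 - t), (2 * ((4 - t) * x) - 2 * (1 - y)) / (4 - t),
      (4 * y - t) / (4 - t), fin (by linarith) hq, fin (by linarith) hq, fin (by linarith) hq,
      ?_, ?_, ?_⟩
    · field_simp; ring
    · simp [innerPiece]; field_simp; ring
    · simp [innerPiece]; field_simp; ring
  have h5' : 3 * (1 - y) ≤ (4 - t) * x → t * (1 - x) ≤ y → ∃ k, ∃ a b c : ℝ,
      0 ≤ a ∧ 0 ≤ b ∧ 0 ≤ c ∧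
      a + b + c = 1 ∧ x = a * (innerPiece t k).p.1 + b * (innerPiece t k).q.1
        + c * (innerPiece t k).r.1 ∧ y = a * (innerPiece t k).p.2 + b * (innerPiece t k).q.2
        + c * (innerPiece t k).r.2 := by
    intro h3 h4
    refine ⟨5, 4 * (1 - x - y) / (1 - t), ((4 - t) * x - 3 * (1 - y)) / (1 - t),
      (y - t * (1 - x)) / (1 - t), fin (by linarith) hr, fin (by linarith) hr, fin (by linarith) hr,
      ?_, ?_, ?_⟩
    · field_simp; ring
    · simp [innerPiece]; field_simp; ring
    · simp [innerPiece]; field_simp; ring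
  rcases le_total y (t / 4) with hy4 | hy4
  · rcases le_total (t * x) y with h2 | h2
    · refine h3' h2 ?_
      have : x ≤ 1 / 4 := le_of_mul_le_mul_left (by linarith) h0
      nlinarith
    · rcases le_total (t * (1 - x)) y with h3 | h3
      · refine h5' ?_ h3
        have : 3 / 4 ≤ x := by
          have : 1 - x ≤ 1 / 4 := le_of_mul_le_mul_left (by linarith) h0
          linarith
        nlinarith
      · rcases le_total y (t * (1 / 2 - x)) with h4 | h4
        · exact h0' h2 h4
        · rcases le_total y (t * (x - 1 / 2)) with h5 | h5
          · exact h2' h5 h3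
          · exact h1' hy4 h4 h5
  · rcases le_total ((4 - t) * x) (1 - y) with h2 | h2
    · refine h3' ?_ h2
      nlinarith
    · rcases le_total ((4 - t) * x) (3 * (1 - y)) with h3 | h3
      · exact h4' hy4 h2 h3
      · refine h5' h3 ?_
        rcases le_total x (3 / 4) with h4 | h4 <;> nlinarith

theorem refNeighbor_subset_outer {x : ℝ × ℝ} (hx : x ∈ refNeighbor.carrier) :
    ∃ k, x ∈ (outerPiece k).carrier := by
  rw [mem_carrier_refNeighbor] at hx
  obtain ⟨h1, h2, h3⟩ := hx
  simp only [Triangle.mem_carrier_iff]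
  rcases le_total (2 * x.1 + x.2) 1 with h | h
  · exact ⟨0, 1 - 2 * x.1 - x.2, 2 * (x.1 + x.2), -x.2, by linarith, by linarith, by linarith,
      by ring, by simp [outerPiece]; ring, by simp [outerPiece]⟩
  · exact ⟨1, 2 * (1 - x.1), 2 * x.1 + x.2 - 1, -x.2, by linarith, by linarith, by linarith,
      by ring, by simp [outerPiece]; ring, by simp [outerPiece]⟩

theorem disjoint_cell_outerPiece {k l : Fin 2} (hkl : k ≠ l) :
    Disjoint (outerPiece k).cell (outerPiece l).cell := by
  rw [Set.disjoint_left]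
  rintro x ⟨a, b, c, ha, hb, hc, h, e1, e2⟩ ⟨a', b', c', ha', hb', hc', h', e1', e2'⟩
  fin_cases k <;> fin_cases l <;> simp [outerPiece] at hkl e1 e2 e1' e2' <;> linarith

theorem cell_outer_subset (k : Fin 2) : (outerPiece k).cell ⊆ refNeighbor.cell := by
  rintro x ⟨a, b, c, ha, hb, hc, h, e1, e2⟩
  rw [mem_cell_refNeighbor, e1, e2]
  fin_cases k <;> simp [outerPiece] <;> (try refine ⟨?_, ?_, ?_⟩) <;> linarith

theorem cell_inner_subset {t : ℝ} (h0 : 0 < t) (h1 : t < 1) (k : Fin 6) :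
    (innerPiece t k).cell ⊆ refTriangle.cell := by
  rintro x ⟨a, b, c, ha, hb, hc, h, e1, e2⟩
  rw [mem_cell_refTriangle, e1, e2]
  have hat := mul_pos ha h0
  have hbt := mul_pos hb h0
  have hct := mul_pos hc h0
  have hat' := mul_pos ha (sub_pos.2 h1)
  have hbt' := mul_pos hb (sub_pos.2 h1)
  have hct' := mul_pos hc (sub_pos.2 h1)
  fin_cases k <;> simp [innerPiece] <;> refine ⟨?_, ?_, ?_⟩ <;> linarith

/-- The stiffness matrix of the added vertices `M`, `N` and `P` of the local mesh, as a bilinear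
form in the deviations from linear interpolation at these vertices. -/
noncomputable def bubbleForm (t m n p m' n' p' : ℝ) : ℝ :=
  (3 / (2 * t) + t / 2 + 3) * (m * m')
    - 1 / t * (m * n' + n * m' + m * p' + p * m')
    + ((1 - t ^ 2) / (4 * t) - 3 / (4 * (4 - t)) - (4 - t) / 4) * (n * p' + p * n')
    + (5 / (4 * t) + t / 4 + 9 / (4 * (4 - t)) + (4 - t) / 4 + 2) * (n * n')
    + (5 / (4 * t) + t / 4 + 1 / (4 * (4 - t)) + (4 - t) / 4 + 4 / (1 - t)) * (p * p')

set_option maxHeartbeats 1000000 in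
/-- The energy on the local mesh and the bisected neighbor, in terms of the linear interpolants and
of the deviations from them. The interpolants are orthogonal to the deviations up to the term that
Green's formula gives: the jump of the normal derivative of the interpolant across the leg from
`(0, 0)` to `(1, 0)`, tested with the deviation, whose integral over the leg is half of its value
at the midpoint. -/
theorem energy_local {t : ℝ} (h0 : 0 < t) (h1 : t < 1) (u v : ℝ × ℝ → ℝ)
    {uA uB uC uA' um un up vA vB vC vA' vm vn vp : ℝ}
    (huA : u (0, 1) = uA) (huB : u (0, 0) = uB) (huC : u (1, 0) = uC) (huA' : u (1, -1) = uA')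
    (hum : u (1 / 2, 0) = (uB + uC) / 2 + um)
    (hun : u (1 / 4, t / 4) = (3 / 4 - t / 4) * uB + 1 / 4 * uC + t / 4 * uA + un)
    (hup : u (3 / 4, t / 4) = (1 / 4 - t / 4) * uB + 3 / 4 * uC + t / 4 * uA + up)
    (hvA : v (0, 1) = vA) (hvB : v (0, 0) = vB) (hvC : v (1, 0) = vC) (hvA' : v (1, -1) = vA')
    (hvm : v (1 / 2, 0) = (vB + vC) / 2 + vm)
    (hvn : v (1 / 4, t / 4) = (3 / 4 - t / 4) * vB + 1 / 4 * vC + t / 4 * vA + vn)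
    (hvp : v (3 / 4, t / 4) = (1 / 4 - t / 4) * vB + 3 / 4 * vC + t / 4 * vA + vp) :
    ∑ k, (innerPiece t k).energy u v + ∑ k, (outerPiece k).energy u v =
      ((uC - uB) * (vC - vB) + (uA - uB) * (vA - vB)) / 2
      + ((uB - uC) * (vB - vC) + (uA' - uC) * (vA' - vC)) / 2
      - 1 / 2 * um * (vA + vA' - vB - vC) - 1 / 2 * vm * (uA + uA' - uB - uC)
      + bubbleForm t um un up vm vn vp := by
  have hq : 0 < 4 - t := by linarith
  have hr : 0 < 1 - t := by linarith
  have e : ∀ k, |(innerPiece t k).det| = ![t / 8, t / 8, t / 8, 1 / 4, (4 - t) / 8, (1 - t) / 4] k :=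
    fun k => by rw [abs_of_pos (det_innerPiece_pos h0 h1 k), det_innerPiece]
  have e' : ∀ k, |(outerPiece k).det| = 1 / 2 := fun k => by rw [det_outerPiece]; norm_num
  rw [Fin.sum_univ_six, Fin.sum_univ_two]
  simp only [Triangle.energy, e, e']
  rw [show innerPiece t 0 = ⟨(0, 0), (1 / 2, 0), (1 / 4, t / 4)⟩ from rfl,
    show innerPiece t 1 = ⟨(1 / 2, 0), (3 / 4, t / 4), (1 / 4, t / 4)⟩ from rfl,
    show innerPiece t 2 = ⟨(1 / 2, 0), (1, 0), (3 / 4, t / 4)⟩ from rfl,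
    show innerPiece t 3 = ⟨(0, 0), (1 / 4, t / 4), (0, 1)⟩ from rfl,
    show innerPiece t 4 = ⟨(1 / 4, t / 4), (3 / 4, t / 4), (0, 1)⟩ from rfl,
    show innerPiece t 5 = ⟨(3 / 4, t / 4), (1, 0), (0, 1)⟩ from rfl,
    show outerPiece 0 = ⟨(0, 0), (1 / 2, 0), (1, -1)⟩ from rfl,
    show outerPiece 1 = ⟨(1 / 2, 0), (1, 0), (1, -1)⟩ from rfl]
  simp only [huA, huB, huC, huA', hum, hun, hup, hvA, hvB, hvC, hvA', hvm, hvn, hvp, bubbleForm,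
    Matrix.cons_val]
  field_simp
  ring

/-! ### Geometry of the grid -/

namespace GridTriangle

/-- The closed grid triangle, in units of the grid. -/
def Closed (T : GridTriangle) (g : ℝ × ℝ) : Prop :=
  if T.upper then g.1 ≤ T.i + 1 ∧ g.2 ≤ T.j + 1 ∧ (T.i : ℝ) + T.j + 1 ≤ g.1 + g.2
  else (T.i : ℝ) ≤ g.1 ∧ (T.j : ℝ) ≤ g.2 ∧ g.1 + g.2 ≤ T.i + T.j + 1

/-- The open grid triangle, in units of the grid. -/
def Open (T : GridTriangle) (g : ℝ × ℝ) : Prop :=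
  if T.upper then g.1 < T.i + 1 ∧ g.2 < T.j + 1 ∧ (T.i : ℝ) + T.j + 1 < g.1 + g.2
  else (T.i : ℝ) < g.1 ∧ (T.j : ℝ) < g.2 ∧ g.1 + g.2 < T.i + T.j + 1

theorem Closed.bounds {T : GridTriangle} {g : ℝ × ℝ} (h : T.Closed g) :
    (T.i : ℝ) ≤ g.1 ∧ g.1 ≤ T.i + 1 ∧ (T.j : ℝ) ≤ g.2 ∧ g.2 ≤ T.j + 1 := by
  unfold Closed at h
  split_ifs at h <;> obtain ⟨h1, h2, h3⟩ := h <;> refine ⟨?_, ?_, ?_, ?_⟩ <;> linarith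

theorem Open.bounds {T : GridTriangle} {g : ℝ × ℝ} (h : T.Open g) :
    (T.i : ℝ) < g.1 ∧ g.1 < T.i + 1 ∧ (T.j : ℝ) < g.2 ∧ g.2 < T.j + 1 := by
  unfold Open at h
  split_ifs at h <;> obtain ⟨h1, h2, h3⟩ := h <;> refine ⟨?_, ?_, ?_, ?_⟩ <;> linarith

theorem eq_of_lt_of_le {a b : ℤ} {r : ℝ} (h1 : (a : ℝ) < r) (h2 : r < a + 1) (h3 : (b : ℝ) ≤ r)
    (h4 : r ≤ b + 1) : a = b := by
  have e1 : (a : ℝ) < ((b + 1 : ℤ) : ℝ) := by push_cast; linarith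
  have e2 : (b : ℝ) < ((a + 1 : ℤ) : ℝ) := by push_cast; linarith
  rw [Int.cast_lt] at e1 e2
  omega

theorem eq_of_open_of_closed {T T' : GridTriangle} {g : ℝ × ℝ} (h : T.Open g) (h' : T'.Closed g) :
    T = T' := by
  have b := h.bounds
  have b' := h'.bounds
  have hi := eq_of_lt_of_le b.1 b.2.1 b'.1 b'.2.1
  have hj := eq_of_lt_of_le b.2.2.1 b.2.2.2 b'.2.2.1 b'.2.2.2
  rcases T with ⟨i, j, _ | _⟩ <;> rcases T' with ⟨i', j', _ | _⟩ <;> simp only at hi hj <;>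
    subst hi hj <;> simp [Open, Closed] at h h' ⊢ <;> linarith

theorem exists_closed {m n : ℕ} (hm : 0 < m) (hn : 0 < n) {g : ℝ × ℝ} (h1 : 0 ≤ g.1) (h2 : g.1 ≤ m)
    (h3 : 0 ≤ g.2) (h4 : g.2 ≤ n) : ∃ T : GridTriangle, T.InGrid m n ∧ T.Closed g := by
  have key : ∀ {r : ℝ} {k : ℕ}, 0 < k → 0 ≤ r → r ≤ k →
      ∃ i : ℤ, 0 ≤ i ∧ i < k ∧ (i : ℝ) ≤ r ∧ r ≤ i + 1 := by
    intro r k hk h0 hr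
    rcases eq_or_lt_of_le hr with h | h
    · refine ⟨k - 1, by omega, by omega, ?_, ?_⟩ <;> push_cast <;> linarith
    · exact ⟨⌊r⌋, Int.floor_nonneg.2 h0, Int.floor_lt.2 (by exact_mod_cast h), Int.floor_le r,
        (Int.lt_floor_add_one r).le⟩
  obtain ⟨i, i0, i1, i2, i3⟩ := key hm h1 h2
  obtain ⟨j, j0, j1, j2, j3⟩ := key hn h3 h4
  rcases le_total (g.1 + g.2) (i + j + 1) with h | h
  · exact ⟨⟨i, j, false⟩, ⟨i0, i1, j0, j1⟩, by simp [Closed, *]⟩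
  · exact ⟨⟨i, j, true⟩, ⟨i0, i1, j0, j1⟩, by simp [Closed, *]⟩

open Classical in
/-- The grid triangles of the grid of `m × n` squares. -/
noncomputable def grid (m n : ℕ) : Finset GridTriangle :=
  ((Finset.Ico (0 : ℤ) m ×ˢ Finset.Ico (0 : ℤ) n) ×ˢ (Finset.univ : Finset Bool)).image
    fun a => ⟨a.1.1, a.1.2, a.2⟩

theorem mem_grid {m n : ℕ} {T : GridTriangle} : T ∈ grid m n ↔ T.InGrid m n := by
  simp only [grid, Finset.mem_image, Finset.mem_product, Finset.mem_Ico, Finset.mem_univ, and_true]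
  constructor
  · rintro ⟨a, ⟨⟨h1, h2⟩, h3, h4⟩, rfl⟩
    exact ⟨h1, h2, h3, h4⟩
  · rintro ⟨h1, h2, h3, h4⟩
    exact ⟨((T.i, T.j), T.upper), ⟨⟨h1, h2⟩, h3, h4⟩, rfl⟩

end GridTriangle

open GridTriangle

namespace EmbeddedMesh
variable (𝓜 : EmbeddedMesh)

theorem mem_carrier_plainTriangle (T : GridTriangle) (x : ℝ × ℝ) :
    x ∈ (𝓜.plainTriangle T).carrier ↔ T.Closed (𝓜.gridCoord x) := by
  rw [carrier_plainTriangle, mem_carrier_place, mem_carrier_refTriangle]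
  obtain ⟨i, j, b⟩ := T
  cases hv : 𝓜.vert ⟨i, j, b⟩ <;> cases b <;>
    simp [refCoord, gridCoord, hv, GridTriangle.corner, GridTriangle.sign, GridTriangle.Closed] <;>
    grind

theorem mem_cell_plainTriangle (T : GridTriangle) (x : ℝ × ℝ) :
    x ∈ (𝓜.plainTriangle T).cell ↔ T.Open (𝓜.gridCoord x) := by
  rw [cell_plainTriangle, mem_cell_place, mem_cell_refTriangle]
  obtain ⟨i, j, b⟩ := T
  cases hv : 𝓜.vert ⟨i, j, b⟩ <;> cases b <;>
    simp [refCoord, gridCoord, hv, GridTriangle.corner, GridTriangle.sign, GridTriangle.Open] <;>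
    grind

theorem mem_domain_iff (x : ℝ × ℝ) : x ∈ 𝓜.domain ↔
    (0 < (𝓜.gridCoord x).1 ∧ (𝓜.gridCoord x).1 < 𝓜.m) ∧
      0 < (𝓜.gridCoord x).2 ∧ (𝓜.gridCoord x).2 < 𝓜.n := by
  have h := 𝓜.h_pos
  simp only [domain, mem_prod, mem_Ioo, gridCoord, lt_div_iff₀ h, div_lt_iff₀ h]
  constructor <;> rintro ⟨⟨h1, h2⟩, h3, h4⟩ <;> refine ⟨⟨?_, ?_⟩, ?_, ?_⟩ <;> linarith

theorem mem_closure_iff (x : ℝ × ℝ) : x ∈ closure 𝓜.domain ↔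
    (0 ≤ (𝓜.gridCoord x).1 ∧ (𝓜.gridCoord x).1 ≤ 𝓜.m) ∧
      0 ≤ (𝓜.gridCoord x).2 ∧ (𝓜.gridCoord x).2 ≤ 𝓜.n := by
  have h := 𝓜.h_pos
  have hm : (0 : ℝ) < 𝓜.m := Nat.cast_pos.2 𝓜.m_pos
  have hn : (0 : ℝ) < 𝓜.n := Nat.cast_pos.2 𝓜.n_pos
  have e1 : 𝓜.x₀ ≠ 𝓜.x₀ + 𝓜.m * 𝓜.h := by
    have := mul_pos hm h
    intro e; linarith
  have e2 : 𝓜.y₀ ≠ 𝓜.y₀ + 𝓜.n * 𝓜.h := by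
    have := mul_pos hn h
    intro e; linarith
  rw [domain, closure_prod_eq, closure_Ioo e1, closure_Ioo e2]
  simp only [mem_prod, mem_Icc, gridCoord, le_div_iff₀ h, div_le_iff₀ h]
  constructor <;> rintro ⟨⟨h1, h2⟩, h3, h4⟩ <;> refine ⟨⟨?_, ?_⟩, ?_, ?_⟩ <;> linarith

theorem isOpen_domain : IsOpen 𝓜.domain := isOpen_Ioo.prod isOpen_Ioo

theorem mem_frontier_iff (x : ℝ × ℝ) :
    x ∈ frontier 𝓜.domain ↔ x ∈ closure 𝓜.domain ∧ x ∉ 𝓜.domain := by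
  rw [𝓜.isOpen_domain.frontier_eq]; rfl

theorem carrier_plain_subset {T : GridTriangle} (hT : T.InGrid 𝓜.m 𝓜.n) :
    (𝓜.plainTriangle T).carrier ⊆ closure 𝓜.domain := by
  intro x hx
  rw [mem_carrier_plainTriangle] at hx
  obtain ⟨h1, h2, h3, h4⟩ := hx.bounds
  obtain ⟨i0, i1, j0, j1⟩ := hT
  have i0' : (0 : ℝ) ≤ T.i := Int.cast_nonneg i0
  have j0' : (0 : ℝ) ≤ T.j := Int.cast_nonneg j0
  have i1' : (T.i : ℝ) + 1 ≤ 𝓜.m := by exact_mod_cast i1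
  have j1' : (T.j : ℝ) + 1 ≤ 𝓜.n := by exact_mod_cast j1
  rw [mem_closure_iff]
  exact ⟨⟨by linarith, by linarith⟩, by linarith, by linarith⟩

theorem cell_plain_subset {T : GridTriangle} (hT : T.InGrid 𝓜.m 𝓜.n) :
    (𝓜.plainTriangle T).cell ⊆ 𝓜.domain := by
  intro x hx
  rw [mem_cell_plainTriangle] at hx
  obtain ⟨h1, h2, h3, h4⟩ := hx.bounds
  obtain ⟨i0, i1, j0, j1⟩ := hT
  have i0' : (0 : ℝ) ≤ T.i := Int.cast_nonneg i0
  have j0' : (0 : ℝ) ≤ T.j := Int.cast_nonneg j0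
  have i1' : (T.i : ℝ) + 1 ≤ 𝓜.m := by exact_mod_cast i1
  have j1' : (T.j : ℝ) + 1 ≤ 𝓜.n := by exact_mod_cast j1
  rw [mem_domain_iff]
  exact ⟨⟨by linarith, by linarith⟩, by linarith, by linarith⟩

theorem exists_mem_plain {x : ℝ × ℝ} (hx : x ∈ closure 𝓜.domain) :
    ∃ T : GridTriangle, T.InGrid 𝓜.m 𝓜.n ∧ x ∈ (𝓜.plainTriangle T).carrier := by
  rw [mem_closure_iff] at hx
  obtain ⟨T, hT, h⟩ := exists_closed 𝓜.m_pos 𝓜.n_pos hx.1.1 hx.1.2 hx.2.1 hx.2.2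
  exact ⟨T, hT, (𝓜.mem_carrier_plainTriangle T x).2 h⟩

theorem det_plainTriangle (T : GridTriangle) : (𝓜.plainTriangle T).det = 𝓜.h ^ 2 := by
  rcases T with ⟨i, j, _ | _⟩ <;>
    simp [plainTriangle, Triangle.det, node, GridTriangle.corner, GridTriangle.horizontalEnd,
      GridTriangle.verticalEnd] <;> ring

/-- The vertex of a grid triangle that corresponds to the vertex `A` of the reference triangle. -/
def vertA (T : GridTriangle) : ℤ × ℤ := if 𝓜.vert T then T.horizontalEnd else T.verticalEnd

/-- The vertex of a grid triangle that corresponds to the vertex `C` of the reference triangle. -/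
def vertC (T : GridTriangle) : ℤ × ℤ := if 𝓜.vert T then T.verticalEnd else T.horizontalEnd

/-- The vertex opposite to `A` of the parallelogram formed by a grid triangle and its neighbor. -/
def vertA' (T : GridTriangle) : ℤ × ℤ := T.corner + 𝓜.vertC T - 𝓜.vertA T

theorem refPoint_B (T : GridTriangle) : 𝓜.refPoint T 0 0 = 𝓜.node T.corner := by
  simp [refPoint]

theorem refPoint_C (T : GridTriangle) : 𝓜.refPoint T 1 0 = 𝓜.node (𝓜.vertC T) := by
  simp [refPoint, vertC]

theorem refPoint_A (T : GridTriangle) : 𝓜.refPoint T 0 1 = 𝓜.node (𝓜.vertA T) := by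
  simp [refPoint, vertA]

theorem refPoint_A' (T : GridTriangle) : 𝓜.refPoint T 1 (-1) = 𝓜.node (𝓜.vertA' T) := by
  have e : 𝓜.refPoint T 1 (-1) = 𝓜.node T.corner + (𝓜.node (𝓜.vertC T) - 𝓜.node T.corner)
      - (𝓜.node (𝓜.vertA T) - 𝓜.node T.corner) := by
    simp [refPoint, vertA, vertC, sub_eq_add_neg, add_comm]
  rw [e]
  simp only [node, vertA']
  ext <;> simp <;> ring

theorem corner_nbr (T : GridTriangle) : (𝓜.nbr T).corner = 𝓜.vertC T := by
  obtain ⟨i, j, b⟩ := T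
  cases hv : 𝓜.vert ⟨i, j, b⟩ <;> cases b <;>
    simp [nbr, hv, vertC, GridTriangle.acrossLeg, GridTriangle.corner,
      GridTriangle.horizontalEnd, GridTriangle.verticalEnd]

theorem vertC_mem (T : GridTriangle) : 𝓜.vertC T ∈ T.vertices := by
  unfold vertC GridTriangle.vertices; split_ifs <;> simp

theorem vertA_mem (T : GridTriangle) : 𝓜.vertA T ∈ T.vertices := by
  unfold vertA GridTriangle.vertices; split_ifs <;> simp

theorem corner_mem (T : GridTriangle) : T.corner ∈ T.vertices := by simp [GridTriangle.vertices]

theorem eq_of_common_vertex {T T' : GridTriangle} (hT : T ∈ 𝓜.partitioned)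
    (hT' : T' ∈ 𝓜.partitioned) {v : ℤ × ℤ} (h : v ∈ T.vertices) (h' : v ∈ T'.vertices) :
    T = T' := by
  by_contra hne
  exact Set.disjoint_left.1 (𝓜.separated T hT T' hT' (Ne.symm hne)) h h'

theorem nbr_injOn : InjOn 𝓜.nbr 𝓜.partitioned := by
  intro T hT T' hT' h
  refine 𝓜.eq_of_common_vertex hT hT' (𝓜.vertC_mem T) ?_
  rw [← corner_nbr, h, corner_nbr]
  exact 𝓜.vertC_mem T'

theorem nbr_ne (T : GridTriangle) : 𝓜.nbr T ≠ T := by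
  rcases T with ⟨i, j, _ | _⟩ <;> simp [nbr, GridTriangle.acrossLeg] <;> split_ifs <;> simp

theorem nbr_notMem {T : GridTriangle} (hT : T ∈ 𝓜.partitioned) : 𝓜.nbr T ∉ 𝓜.partitioned := by
  intro h
  refine 𝓜.nbr_ne T (𝓜.eq_of_common_vertex h hT (corner_mem _) ?_)
  rw [corner_nbr]
  exact 𝓜.vertC_mem T

theorem nbr_inGrid {T : GridTriangle} (hT : T ∈ 𝓜.partitioned) : (𝓜.nbr T).InGrid 𝓜.m 𝓜.n := by
  have h := 𝓜.separated_boundary T hT _ (corner_mem T)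
  obtain ⟨h1, h2, h3, h4⟩ := 𝓜.partitioned_inGrid T hT
  obtain ⟨i, j, b⟩ := T
  cases hv : 𝓜.vert ⟨i, j, b⟩ <;> cases b <;>
    simp [nbr, hv, GridTriangle.acrossLeg, GridTriangle.corner, GridTriangle.InGrid] at * <;> omega

/-- The tangent of the angle of the local mesh of a partitioned triangle. -/
noncomputable def tanα (T : GridTriangle) : ℝ := Real.tan (𝓜.α T)

theorem tanα_pos {T : GridTriangle} (hT : T ∈ 𝓜.partitioned) : 0 < 𝓜.tanα T :=
  Real.tan_pos_of_pos_of_lt_pi_div_two (𝓜.α_pos T hT)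
    ((𝓜.α_lt T hT).trans (by linarith [Real.pi_pos]))

theorem tanα_lt_one {T : GridTriangle} (hT : T ∈ 𝓜.partitioned) : 𝓜.tanα T < 1 := by
  rw [tanα, ← Real.tan_pi_div_four]
  exact Real.tan_lt_tan_of_lt_of_lt_pi_div_two (by linarith [Real.pi_pos, 𝓜.α_pos T hT])
    (by linarith [Real.pi_pos]) (𝓜.α_lt T hT)

theorem localMesh_eq (T : GridTriangle) : 𝓜.localMesh T =
    range (fun k => 𝓜.place T (innerPiece (𝓜.tanα T) k)) ∪
      range (fun k => 𝓜.place T (outerPiece k)) := by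
  ext K
  simp [localMesh, place, innerPiece, outerPiece, tanα, Fin.exists_fin_succ, eq_comm, or_assoc]

theorem inner_mem {T : GridTriangle} (hT : T ∈ 𝓜.partitioned) (k : Fin 6) :
    𝓜.place T (innerPiece (𝓜.tanα T) k) ∈ 𝓜.triangles :=
  Or.inl (mem_iUnion₂.2 ⟨T, hT, by rw [localMesh_eq]; exact Or.inl ⟨k, rfl⟩⟩)

theorem outer_mem {T : GridTriangle} (hT : T ∈ 𝓜.partitioned) (k : Fin 2) :
    𝓜.place T (outerPiece k) ∈ 𝓜.triangles :=
  Or.inl (mem_iUnion₂.2 ⟨T, hT, by rw [localMesh_eq]; exact Or.inr ⟨k, rfl⟩⟩)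

theorem plain_mem {T : GridTriangle} (hT : T.InGrid 𝓜.m 𝓜.n) (h1 : T ∉ 𝓜.partitioned)
    (h2 : ∀ T' ∈ 𝓜.partitioned, T ≠ 𝓜.nbr T') : 𝓜.plainTriangle T ∈ 𝓜.triangles :=
  Or.inr ⟨T, hT, h1, h2, rfl⟩

theorem inner_carrier_subset {T : GridTriangle} (hT : T ∈ 𝓜.partitioned) (k : Fin 6) :
    (𝓜.place T (innerPiece (𝓜.tanα T) k)).carrier ⊆ (𝓜.plainTriangle T).carrier := by
  intro x hx
  rw [carrier_plainTriangle, mem_carrier_place]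
  exact carrier_innerPiece_subset (𝓜.tanα_pos hT) (𝓜.tanα_lt_one hT) k
    ((𝓜.mem_carrier_place _ _ _).1 hx)

theorem outer_carrier_subset (T : GridTriangle) (k : Fin 2) :
    (𝓜.place T (outerPiece k)).carrier ⊆ (𝓜.plainTriangle (𝓜.nbr T)).carrier := by
  intro x hx
  rw [carrier_plainTriangle_nbr, mem_carrier_place]
  exact carrier_outerPiece_subset k ((𝓜.mem_carrier_place _ _ _).1 hx)

/-- The mesh covers the closed rectangle. -/
theorem exists_mem_triangle {x : ℝ × ℝ} (hx : x ∈ closure 𝓜.domain) :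
    ∃ K ∈ 𝓜.triangles, x ∈ K.carrier := by
  obtain ⟨T, hT, h⟩ := 𝓜.exists_mem_plain hx
  by_cases h1 : T ∈ 𝓜.partitioned
  · rw [carrier_plainTriangle, mem_carrier_place] at h
    obtain ⟨k, hk⟩ := refTriangle_subset_inner (𝓜.tanα_pos h1) (𝓜.tanα_lt_one h1) h
    exact ⟨_, 𝓜.inner_mem h1 k, (𝓜.mem_carrier_place _ _ _).2 hk⟩
  · by_cases h2 : ∃ T' ∈ 𝓜.partitioned, T = 𝓜.nbr T'
    · obtain ⟨T', hT', rfl⟩ := h2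
      rw [carrier_plainTriangle_nbr, mem_carrier_place] at h
      obtain ⟨k, hk⟩ := refNeighbor_subset_outer h
      exact ⟨_, 𝓜.outer_mem hT' k, (𝓜.mem_carrier_place _ _ _).2 hk⟩
    · push Not at h2
      exact ⟨_, 𝓜.plain_mem hT h1 h2, h⟩

/-- The mesh refines the three-line mesh. -/
theorem exists_plain_of_mem {K : Triangle} (hK : K ∈ 𝓜.triangles) :
    ∃ T : GridTriangle, T.InGrid 𝓜.m 𝓜.n ∧ K.carrier ⊆ (𝓜.plainTriangle T).carrier := by
  rcases hK with hK | ⟨T, hT, -, -, rfl⟩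
  · obtain ⟨T, hT, h⟩ := mem_iUnion₂.1 hK
    rw [localMesh_eq] at h
    rcases h with ⟨k, rfl⟩ | ⟨k, rfl⟩
    · exact ⟨T, 𝓜.partitioned_inGrid T hT, 𝓜.inner_carrier_subset hT k⟩
    · exact ⟨_, 𝓜.nbr_inGrid hT, 𝓜.outer_carrier_subset T k⟩
  · exact ⟨T, hT, subset_rfl⟩

end EmbeddedMesh

/-! ### The Dirichlet form in terms of nodal values -/

/-- The energy of the linear interpolants on a grid triangle. -/
noncomputable def GridTriangle.energy (T : GridTriangle) (U V : ℤ × ℤ → ℝ) : ℝ :=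
  ((U T.horizontalEnd - U T.corner) * (V T.horizontalEnd - V T.corner)
    + (U T.verticalEnd - U T.corner) * (V T.verticalEnd - V T.corner)) / 2

namespace EmbeddedMesh
variable (𝓜 : EmbeddedMesh)

open Classical in
/-- The partitioned triangles, as a finite set. -/
noncomputable def chosen : Finset GridTriangle := (grid 𝓜.m 𝓜.n).filter (· ∈ 𝓜.partitioned)

theorem mem_chosen {T : GridTriangle} : T ∈ 𝓜.chosen ↔ T ∈ 𝓜.partitioned := by
  simp only [chosen, Finset.mem_filter, mem_grid, and_iff_right_iff_imp]
  exact 𝓜.partitioned_inGrid T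

/-- The restriction of a function to the grid nodes. -/
def nodal (u : ℝ × ℝ → ℝ) (v : ℤ × ℤ) : ℝ := u (𝓜.node v)

/-- The jump of the normal derivative of the linear interpolant across the leg that carries the added
midpoint, multiplied by the mesh size. -/
def jump (T : GridTriangle) (U : ℤ × ℤ → ℝ) : ℝ :=
  U (𝓜.vertA T) + U (𝓜.vertA' T) - U T.corner - U (𝓜.vertC T)

/-- The deviation from linear interpolation at the added vertex `M`. -/
noncomputable def devM (T : GridTriangle) (u : ℝ × ℝ → ℝ) : ℝ :=
  u (𝓜.refPoint T (1 / 2) 0) - (𝓜.nodal u T.corner + 𝓜.nodal u (𝓜.vertC T)) / 2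

/-- The deviation from linear interpolation at the added vertex `N`. -/
noncomputable def devN (T : GridTriangle) (u : ℝ × ℝ → ℝ) : ℝ :=
  u (𝓜.refPoint T (1 / 4) (𝓜.tanα T / 4)) - ((3 / 4 - 𝓜.tanα T / 4) * 𝓜.nodal u T.corner
    + 1 / 4 * 𝓜.nodal u (𝓜.vertC T) + 𝓜.tanα T / 4 * 𝓜.nodal u (𝓜.vertA T))

/-- The deviation from linear interpolation at the added vertex `P`. -/
noncomputable def devP (T : GridTriangle) (u : ℝ × ℝ → ℝ) : ℝ :=
  u (𝓜.refPoint T (3 / 4) (𝓜.tanα T / 4)) - ((1 / 4 - 𝓜.tanα T / 4) * 𝓜.nodal u T.corner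
    + 3 / 4 * 𝓜.nodal u (𝓜.vertC T) + 𝓜.tanα T / 4 * 𝓜.nodal u (𝓜.vertA T))

/-- The contribution of a local mesh to the Dirichlet form that is not due to the linear
interpolants. -/
noncomputable def localForm (T : GridTriangle) (u v : ℝ × ℝ → ℝ) : ℝ :=
  bubbleForm (𝓜.tanα T) (𝓜.devM T u) (𝓜.devN T u) (𝓜.devP T u)
      (𝓜.devM T v) (𝓜.devN T v) (𝓜.devP T v)
    - 1 / 2 * 𝓜.devM T u * 𝓜.jump T (𝓜.nodal v) - 1 / 2 * 𝓜.devM T v * 𝓜.jump T (𝓜.nodal u)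

variable {𝓜}

theorem isAffineOn_of_mem {u : ℝ × ℝ → ℝ} (hu : u ∈ Vh 𝓜.domain 𝓜.triangles) {K : Triangle}
    (hK : K ∈ 𝓜.triangles) : IsAffineOn u K.carrier := hu.2.1 K hK

theorem integral_chosen {u v : ℝ × ℝ → ℝ} (hu : u ∈ Vh 𝓜.domain 𝓜.triangles)
    (hv : v ∈ Vh 𝓜.domain 𝓜.triangles) {T : GridTriangle} (hT : T ∈ 𝓜.partitioned) :
    IntegrableOn (gradDot u v) (𝓜.plainTriangle T).cell ∧
    ∫ x in (𝓜.plainTriangle T).cell, gradDot u v x =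
      ∑ k, (𝓜.place T (innerPiece (𝓜.tanα T) k)).energy u v := by
  have h0 := 𝓜.tanα_pos hT
  have h1 := 𝓜.tanα_lt_one hT
  have hdet : ∀ k, (𝓜.place T (innerPiece (𝓜.tanα T) k)).det ≠ 0 := fun k =>
    𝓜.det_place_ne T _ (det_innerPiece_pos h0 h1 k).ne'
  have key := setIntegral_eq_sum_cells (Finset.univ : Finset (Fin 6))
    (fun k => 𝓜.place T (innerPiece (𝓜.tanα T) k)) (fun k _ => hdet k)
    (O := (𝓜.plainTriangle T).cell) (g := gradDot u v) ?_ ?_ ?_ ?_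
  · refine ⟨key.1, key.2.trans (Finset.sum_congr rfl fun k _ => ?_)⟩
    exact Triangle.integral_cell _ (hdet k) (isAffineOn_of_mem hu (𝓜.inner_mem hT k))
      (isAffineOn_of_mem hv (𝓜.inner_mem hT k))
  · intro k _ x hx
    rw [cell_plainTriangle, mem_cell_place]
    exact cell_inner_subset h0 h1 k ((𝓜.mem_cell_place _ _ _).1 hx)
  · intro x hx
    have hx' := (𝓜.plainTriangle T).cell_subset_carrier hx
    rw [carrier_plainTriangle, mem_carrier_place] at hx'
    obtain ⟨k, hk⟩ := refTriangle_subset_inner h0 h1 hx'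
    exact mem_iUnion₂.2 ⟨k, Finset.mem_univ k, (𝓜.mem_carrier_place _ _ _).2 hk⟩
  · intro k _ l _ hkl
    rw [Set.disjoint_left]
    intro x hx hx'
    exact Set.disjoint_left.1 (disjoint_cell_innerPiece h0 h1 hkl)
      ((𝓜.mem_cell_place _ _ _).1 hx) ((𝓜.mem_cell_place _ _ _).1 hx')
  · intro k _
    exact Triangle.integrableOn_cell _ (hdet k) (isAffineOn_of_mem hu (𝓜.inner_mem hT k))
      (isAffineOn_of_mem hv (𝓜.inner_mem hT k))

theorem integral_nbr {u v : ℝ × ℝ → ℝ} (hu : u ∈ Vh 𝓜.domain 𝓜.triangles)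
    (hv : v ∈ Vh 𝓜.domain 𝓜.triangles) {T : GridTriangle} (hT : T ∈ 𝓜.partitioned) :
    IntegrableOn (gradDot u v) (𝓜.plainTriangle (𝓜.nbr T)).cell ∧
    ∫ x in (𝓜.plainTriangle (𝓜.nbr T)).cell, gradDot u v x =
      ∑ k, (𝓜.place T (outerPiece k)).energy u v := by
  have hdet : ∀ k, (𝓜.place T (outerPiece k)).det ≠ 0 := fun k =>
    𝓜.det_place_ne T _ (by rw [det_outerPiece]; norm_num)
  have key := setIntegral_eq_sum_cells (Finset.univ : Finset (Fin 2))
    (fun k => 𝓜.place T (outerPiece k)) (fun k _ => hdet k)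
    (O := (𝓜.plainTriangle (𝓜.nbr T)).cell) (g := gradDot u v) ?_ ?_ ?_ ?_
  · refine ⟨key.1, key.2.trans (Finset.sum_congr rfl fun k _ => ?_)⟩
    exact Triangle.integral_cell _ (hdet k) (isAffineOn_of_mem hu (𝓜.outer_mem hT k))
      (isAffineOn_of_mem hv (𝓜.outer_mem hT k))
  · intro k _ x hx
    rw [cell_plainTriangle_nbr, mem_cell_place]
    exact cell_outer_subset k ((𝓜.mem_cell_place _ _ _).1 hx)
  · intro x hx
    have hx' := (𝓜.plainTriangle _).cell_subset_carrier hx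
    rw [carrier_plainTriangle_nbr, mem_carrier_place] at hx'
    obtain ⟨k, hk⟩ := refNeighbor_subset_outer hx'
    exact mem_iUnion₂.2 ⟨k, Finset.mem_univ k, (𝓜.mem_carrier_place _ _ _).2 hk⟩
  · intro k _ l _ hkl
    rw [Set.disjoint_left]
    intro x hx hx'
    exact Set.disjoint_left.1 (disjoint_cell_outerPiece hkl)
      ((𝓜.mem_cell_place _ _ _).1 hx) ((𝓜.mem_cell_place _ _ _).1 hx')
  · intro k _
    exact Triangle.integrableOn_cell _ (hdet k) (isAffineOn_of_mem hu (𝓜.outer_mem hT k))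
      (isAffineOn_of_mem hv (𝓜.outer_mem hT k))

theorem energy_plainTriangle (T : GridTriangle) (u v : ℝ × ℝ → ℝ) :
    (𝓜.plainTriangle T).energy u v = T.energy (𝓜.nodal u) (𝓜.nodal v) := by
  have hh := 𝓜.h_ne
  rw [Triangle.energy, det_plainTriangle, abs_of_pos (pow_pos 𝓜.h_pos 2), GridTriangle.energy]
  simp only [nodal, plainTriangle]
  have e : ∀ T : GridTriangle,
      (𝓜.node T.horizontalEnd).2 - (𝓜.node T.corner).2 = 0 ∧
      (𝓜.node T.verticalEnd).1 - (𝓜.node T.corner).1 = 0 ∧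
      ((𝓜.node T.horizontalEnd).1 - (𝓜.node T.corner).1) ^ 2 = 𝓜.h ^ 2 ∧
      ((𝓜.node T.verticalEnd).2 - (𝓜.node T.corner).2) ^ 2 = 𝓜.h ^ 2 := by
    rintro ⟨i, j, _ | _⟩ <;>
      simp [node, GridTriangle.corner, GridTriangle.horizontalEnd, GridTriangle.verticalEnd] <;>
      constructor <;> ring
  obtain ⟨e1, e2, e3, e4⟩ := e T
  rw [e1, e2, e3, e4]
  field_simp
  ring

theorem integral_plain {u v : ℝ × ℝ → ℝ} (hu : u ∈ Vh 𝓜.domain 𝓜.triangles)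
    (hv : v ∈ Vh 𝓜.domain 𝓜.triangles) {T : GridTriangle} (hT : T.InGrid 𝓜.m 𝓜.n)
    (h1 : T ∉ 𝓜.partitioned) (h2 : ∀ T' ∈ 𝓜.partitioned, T ≠ 𝓜.nbr T') :
    IntegrableOn (gradDot u v) (𝓜.plainTriangle T).cell ∧
    ∫ x in (𝓜.plainTriangle T).cell, gradDot u v x = T.energy (𝓜.nodal u) (𝓜.nodal v) := by
  have hdet : (𝓜.plainTriangle T).det ≠ 0 := by
    rw [det_plainTriangle]; exact pow_ne_zero _ 𝓜.h_ne
  have hK := 𝓜.plain_mem hT h1 h2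
  refine ⟨Triangle.integrableOn_cell _ hdet (isAffineOn_of_mem hu hK) (isAffineOn_of_mem hv hK), ?_⟩
  rw [Triangle.integral_cell _ hdet (isAffineOn_of_mem hu hK) (isAffineOn_of_mem hv hK),
    energy_plainTriangle]

theorem integrableOn_plain {u v : ℝ × ℝ → ℝ} (hu : u ∈ Vh 𝓜.domain 𝓜.triangles)
    (hv : v ∈ Vh 𝓜.domain 𝓜.triangles) {T : GridTriangle} (hT : T.InGrid 𝓜.m 𝓜.n) :
    IntegrableOn (gradDot u v) (𝓜.plainTriangle T).cell := by
  by_cases h1 : T ∈ 𝓜.partitioned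
  · exact (integral_chosen hu hv h1).1
  · by_cases h2 : ∃ T' ∈ 𝓜.partitioned, T = 𝓜.nbr T'
    · obtain ⟨T', hT', rfl⟩ := h2
      exact (integral_nbr hu hv hT').1
    · push Not at h2
      exact (integral_plain hu hv hT h1 h2).1

theorem dirichletForm_eq_sum_integral {u v : ℝ × ℝ → ℝ} (hu : u ∈ Vh 𝓜.domain 𝓜.triangles)
    (hv : v ∈ Vh 𝓜.domain 𝓜.triangles) : dirichletForm 𝓜.domain u v =
      ∑ T ∈ grid 𝓜.m 𝓜.n, ∫ x in (𝓜.plainTriangle T).cell, gradDot u v x := by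
  refine (setIntegral_eq_sum_cells (grid 𝓜.m 𝓜.n) 𝓜.plainTriangle ?_ ?_ ?_ ?_ ?_).2
  · intro T _
    rw [det_plainTriangle]; exact pow_ne_zero _ 𝓜.h_ne
  · exact fun T hT => 𝓜.cell_plain_subset (mem_grid.1 hT)
  · intro x hx
    obtain ⟨T, hT, h⟩ := 𝓜.exists_mem_plain (subset_closure hx)
    exact mem_iUnion₂.2 ⟨T, mem_grid.2 hT, h⟩
  · intro T _ T' _ hne
    rw [Set.disjoint_left]
    intro x hx hx'
    rw [mem_cell_plainTriangle] at hx
    have hx' := (𝓜.plainTriangle T').cell_subset_carrier hx'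
    rw [mem_carrier_plainTriangle] at hx'
    exact hne (eq_of_open_of_closed hx hx')
  · exact fun T hT => integrableOn_plain hu hv (mem_grid.1 hT)

theorem energy_eq (T : GridTriangle) (U V : ℤ × ℤ → ℝ) : T.energy U V =
    ((U (𝓜.vertC T) - U T.corner) * (V (𝓜.vertC T) - V T.corner)
      + (U (𝓜.vertA T) - U T.corner) * (V (𝓜.vertA T) - V T.corner)) / 2 := by
  unfold GridTriangle.energy vertA vertC
  split_ifs <;> ring

theorem ends_nbr (T : GridTriangle) :
    ((𝓜.nbr T).horizontalEnd = T.corner ∧ (𝓜.nbr T).verticalEnd = 𝓜.vertA' T) ∨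
    ((𝓜.nbr T).horizontalEnd = 𝓜.vertA' T ∧ (𝓜.nbr T).verticalEnd = T.corner) := by
  obtain ⟨i, j, b⟩ := T
  cases hv : 𝓜.vert ⟨i, j, b⟩ <;> cases b <;>
    simp [nbr, hv, vertC, vertA, vertA', GridTriangle.acrossLeg, GridTriangle.corner,
      GridTriangle.horizontalEnd, GridTriangle.verticalEnd] <;> omega

theorem energy_nbr_eq (T : GridTriangle) (U V : ℤ × ℤ → ℝ) : (𝓜.nbr T).energy U V =
    ((U T.corner - U (𝓜.vertC T)) * (V T.corner - V (𝓜.vertC T))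
      + (U (𝓜.vertA' T) - U (𝓜.vertC T)) * (V (𝓜.vertA' T) - V (𝓜.vertC T))) / 2 := by
  rcases 𝓜.ends_nbr T with ⟨h1, h2⟩ | ⟨h1, h2⟩ <;>
    rw [GridTriangle.energy, h1, h2, corner_nbr] <;> ring

theorem integral_chosen_add_nbr {u v : ℝ × ℝ → ℝ} (hu : u ∈ Vh 𝓜.domain 𝓜.triangles)
    (hv : v ∈ Vh 𝓜.domain 𝓜.triangles) {T : GridTriangle} (hT : T ∈ 𝓜.partitioned) :
    (∫ x in (𝓜.plainTriangle T).cell, gradDot u v x)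
      + ∫ x in (𝓜.plainTriangle (𝓜.nbr T)).cell, gradDot u v x =
    T.energy (𝓜.nodal u) (𝓜.nodal v) + (𝓜.nbr T).energy (𝓜.nodal u) (𝓜.nodal v)
      + 𝓜.localForm T u v := by
  have h0 := 𝓜.tanα_pos hT
  have h1 := 𝓜.tanα_lt_one hT
  rw [(integral_chosen hu hv hT).2, (integral_nbr hu hv hT).2]
  have e : ∀ k, (outerPiece k).det ≠ 0 := fun k => by rw [det_outerPiece]; norm_num
  simp only [𝓜.energy_place T _ (det_innerPiece_pos h0 h1 _).ne', 𝓜.energy_place T _ (e _)]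
  rw [energy_local h0 h1 (fun x => u (𝓜.refPoint T x.1 x.2)) (fun x => v (𝓜.refPoint T x.1 x.2))
    (congrArg u (𝓜.refPoint_A T)) (congrArg u (𝓜.refPoint_B T)) (congrArg u (𝓜.refPoint_C T))
    (congrArg u (𝓜.refPoint_A' T)) (um := 𝓜.devM T u) (un := 𝓜.devN T u) (up := 𝓜.devP T u)
    ?_ ?_ ?_
    (congrArg v (𝓜.refPoint_A T)) (congrArg v (𝓜.refPoint_B T)) (congrArg v (𝓜.refPoint_C T))
    (congrArg v (𝓜.refPoint_A' T)) (vm := 𝓜.devM T v) (vn := 𝓜.devN T v) (vp := 𝓜.devP T v)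
    ?_ ?_ ?_]
  · rw [𝓜.energy_eq, energy_nbr_eq, localForm]
    simp only [jump, nodal]
    ring
  all_goals simp only [devM, devN, devP, nodal]; ring

/-- The Dirichlet form is the form of the three-line mesh plus a local form for every partitioned
triangle. -/
theorem dirichletForm_eq {u v : ℝ × ℝ → ℝ} (hu : u ∈ Vh 𝓜.domain 𝓜.triangles)
    (hv : v ∈ Vh 𝓜.domain 𝓜.triangles) : dirichletForm 𝓜.domain u v =
      ∑ T ∈ grid 𝓜.m 𝓜.n, T.energy (𝓜.nodal u) (𝓜.nodal v)
        + ∑ T ∈ 𝓜.chosen, 𝓜.localForm T u v := by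
  classical
  rw [dirichletForm_eq_sum_integral hu hv]
  set E : GridTriangle → ℝ := fun T => ∫ x in (𝓜.plainTriangle T).cell, gradDot u v x with hE
  set e : GridTriangle → ℝ := fun T => T.energy (𝓜.nodal u) (𝓜.nodal v) with he
  change ∑ T ∈ grid 𝓜.m 𝓜.n, E T = ∑ T ∈ grid 𝓜.m 𝓜.n, e T + _
  rw [← sub_eq_iff_eq_add', ← Finset.sum_sub_distrib]
  have hsub : 𝓜.chosen ∪ 𝓜.chosen.image 𝓜.nbr ⊆ grid 𝓜.m 𝓜.n := by
    intro T hT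
    rw [mem_grid]
    rcases Finset.mem_union.1 hT with h | h
    · exact 𝓜.partitioned_inGrid T (𝓜.mem_chosen.1 h)
    · obtain ⟨T', hT', rfl⟩ := Finset.mem_image.1 h
      exact 𝓜.nbr_inGrid (𝓜.mem_chosen.1 hT')
  rw [← Finset.sum_subset hsub, Finset.sum_union, Finset.sum_image, ← Finset.sum_add_distrib]
  · refine Finset.sum_congr rfl fun T hT => ?_
    have := integral_chosen_add_nbr hu hv (𝓜.mem_chosen.1 hT)
    simp only [hE, he]
    linarith
  · intro T hT T' hT' h
    exact 𝓜.nbr_injOn (𝓜.mem_chosen.1 hT) (𝓜.mem_chosen.1 hT') h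
  · rw [Finset.disjoint_left]
    intro T hT h
    obtain ⟨T', hT', rfl⟩ := Finset.mem_image.1 h
    exact 𝓜.nbr_notMem (𝓜.mem_chosen.1 hT') (𝓜.mem_chosen.1 hT)
  · intro T hT h
    simp only [Finset.mem_union, Finset.mem_image, not_or, not_exists, not_and] at h
    rw [sub_eq_zero]
    refine (integral_plain hu hv (mem_grid.1 hT) (fun h' => h.1 (𝓜.mem_chosen.2 h')) ?_).2
    rintro T' hT' rfl
    exact h.2 T' (𝓜.mem_chosen.2 hT') rfl

end EmbeddedMesh

/-! ### Nodal basis functions of the local mesh -/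

/-- The basis function of the vertex `M` on the reference configuration. The star of a vertex of the
local mesh is convex, so that the basis function is the positive part of a minimum of affine
functions, one for every triangle of the star. -/
noncomputable def bubbleM (t : ℝ) (x : ℝ × ℝ) : ℝ :=
  max 0 (min (min (2 * (x.1 + x.2)) (2 * (1 - x.1)))
    (min (2 * (1 - x.1 - x.2 / t)) (min (1 - 4 * (x.2 / t)) (2 * (x.1 - x.2 / t)))))

/-- The basis function of the vertex `N` on the reference configuration. -/
noncomputable def bubbleN (t : ℝ) (x : ℝ × ℝ) : ℝ :=
  max 0 (min (min (4 * (x.2 / t)) (2 * (x.2 / t) - 2 * x.1 + 1))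
    (min (6 * ((1 - x.2) / (4 - t)) - 2 * x.1) (4 * x.1)))

/-- The basis function of the vertex `P` on the reference configuration. -/
noncomputable def bubbleP (t : ℝ) (x : ℝ × ℝ) : ℝ :=
  max 0 (min (min (4 * (x.2 / t)) (4 * ((1 - x.1 - x.2) / (1 - t))))
    (min (2 * x.1 - 2 * ((1 - x.2) / (4 - t))) (2 * (x.2 / t) - 1 + 2 * x.1)))

theorem continuous_bubbleM (t : ℝ) : Continuous (bubbleM t) := by
  unfold bubbleM; fun_prop

theorem continuous_bubbleN (t : ℝ) : Continuous (bubbleN t) := by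
  unfold bubbleN; fun_prop

theorem continuous_bubbleP (t : ℝ) : Continuous (bubbleP t) := by
  unfold bubbleP; fun_prop

/-- The open parallelogram formed by the reference triangle and its neighbor. -/
def refStar : Set (ℝ × ℝ) := {x | 0 < x.1 ∧ x.1 < 1 ∧ 0 < x.1 + x.2 ∧ x.1 + x.2 < 1}

theorem bubbleM_eq_zero {t : ℝ} (h0 : 0 < t) (h1 : t < 1) {x : ℝ × ℝ} (hx : x ∉ refStar) :
    bubbleM t x = 0 := by
  refine max_eq_left ?_
  by_contra! hcon
  simp only [lt_min_iff] at hcon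
  obtain ⟨⟨a1, a2⟩, a3, a4, a5⟩ := hcon
  have e : x.2 = t * (x.2 / t) := by field_simp
  set Y := x.2 / t
  refine hx ⟨?_, by linarith, by linarith, ?_⟩
  · by_contra! hx0
    nlinarith
  · rcases le_total Y 0 with hY | hY <;> nlinarith

theorem bubbleN_eq_zero {t : ℝ} (h0 : 0 < t) (h1 : t < 1) {x : ℝ × ℝ} (hx : x ∉ refStar) :
    bubbleN t x = 0 := by
  refine max_eq_left ?_
  by_contra! hcon
  simp only [lt_min_iff] at hcon
  obtain ⟨⟨a1, a2⟩, a3, a4⟩ := hcon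
  have hy : 0 < x.2 := by
    have : 0 < x.2 / t := by linarith
    exact (div_pos_iff_of_pos_right h0).1 this
  have e : 1 - x.2 = (4 - t) * ((1 - x.2) / (4 - t)) := by
    have : 4 - t ≠ 0 := by linarith
    field_simp
  set R := (1 - x.2) / (4 - t)
  have : x.1 + x.2 < 1 := by nlinarith
  exact hx ⟨by linarith, by linarith, by linarith, this⟩

theorem bubbleP_eq_zero {t : ℝ} (h0 : 0 < t) (h1 : t < 1) {x : ℝ × ℝ} (hx : x ∉ refStar) :
    bubbleP t x = 0 := by
  refine max_eq_left ?_
  by_contra! hcon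
  simp only [lt_min_iff] at hcon
  obtain ⟨⟨a1, a2⟩, a3, a4⟩ := hcon
  have hy : 0 < x.2 := by
    have : 0 < x.2 / t := by linarith
    exact (div_pos_iff_of_pos_right h0).1 this
  have hxy : 0 < 1 - x.1 - x.2 := by
    have : 0 < (1 - x.1 - x.2) / (1 - t) := by linarith
    exact (div_pos_iff_of_pos_right (by linarith)).1 this
  have e : 1 - x.2 = (4 - t) * ((1 - x.2) / (4 - t)) := by
    have : 4 - t ≠ 0 := by linarith
    field_simp
  set R := (1 - x.2) / (4 - t)
  have : 0 < x.1 := by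
    by_contra! h
    nlinarith
  exact hx ⟨by linarith, by linarith, by linarith, by linarith⟩

/-- The linear inequalities which hold on the triangles of the local mesh. -/
theorem ineq_of_mem_innerPiece {t : ℝ} (h0 : 0 < t) (h1 : t < 1) (k : Fin 6) {x : ℝ × ℝ}
    (hx : x ∈ (innerPiece t k).carrier) :
    (![0 ≤ x.2 ∧ x.2 ≤ t * x.1 ∧ x.2 ≤ t * (1 / 2 - x.1),
    x.2 ≤ t / 4 ∧ t * (1 / 2 - x.1) ≤ x.2 ∧ t * (x.1 - 1 / 2) ≤ x.2,
    0 ≤ x.2 ∧ x.2 ≤ t * (x.1 - 1 / 2) ∧ x.2 ≤ t * (1 - x.1),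
    0 ≤ x.1 ∧ t * x.1 ≤ x.2 ∧ (4 - t) * x.1 ≤ 1 - x.2,
    t / 4 ≤ x.2 ∧ 1 - x.2 ≤ (4 - t) * x.1 ∧ (4 - t) * x.1 ≤ 3 * (1 - x.2),
    x.1 + x.2 ≤ 1 ∧ 3 * (1 - x.2) ≤ (4 - t) * x.1 ∧ t * (1 - x.1) ≤ x.2] : Fin 6 → Prop) k := by
  rw [Triangle.mem_carrier_iff] at hx
  obtain ⟨a, b, c, ha, hb, hc, h, e1, e2⟩ := hx
  have hat := mul_nonneg ha h0.le
  have hbt := mul_nonneg hb h0.le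
  have hct := mul_nonneg hc h0.le
  have hat' := mul_nonneg ha (sub_nonneg.2 h1.le)
  have hbt' := mul_nonneg hb (sub_nonneg.2 h1.le)
  have hct' := mul_nonneg hc (sub_nonneg.2 h1.le)
  have hc1 : c = 1 - a - b := by linarith
  subst hc1
  fin_cases k <;> simp [innerPiece] at e1 e2 <;> simp [e1, e2] <;>
    refine ⟨?_, ?_, ?_⟩ <;> linarith

/-- The inequalities on the triangles of the local mesh, in terms of the quotients that occur in the
basis functions. -/
theorem ineq_of_mem_innerPiece' {t : ℝ} (h0 : 0 < t) (h1 : t < 1) (k : Fin 6) {x : ℝ × ℝ}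
    (hx : x ∈ (innerPiece t k).carrier) {Y R Q : ℝ} (hY : Y = x.2 / t) (hR : R = (1 - x.2) / (4 - t))
    (hQ : Q = (1 - x.1 - x.2) / (1 - t)) :
    (![0 ≤ Y ∧ Y ≤ x.1 ∧ Y ≤ 1 / 2 - x.1, Y ≤ 1 / 4 ∧ 1 / 2 - x.1 ≤ Y ∧ x.1 - 1 / 2 ≤ Y,
    0 ≤ Y ∧ Y ≤ x.1 - 1 / 2 ∧ Y ≤ 1 - x.1, 0 ≤ x.1 ∧ x.1 ≤ Y ∧ x.1 ≤ R,
    1 / 4 ≤ Y ∧ R ≤ x.1 ∧ x.1 ≤ 3 * R, 0 ≤ Q ∧ 3 * R ≤ x.1 ∧ 1 - x.1 ≤ Y] : Fin 6 → Prop) k := by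
  have h := ineq_of_mem_innerPiece h0 h1 k hx
  have hq : 0 < 4 - t := by linarith
  have hr : 0 < 1 - t := by linarith
  have h3 : 3 * ((1 - x.2) / (4 - t)) = 3 * (1 - x.2) / (4 - t) := by ring
  subst hY hR hQ
  fin_cases k <;> simp only [Fin.zero_eta, Fin.mk_one, Fin.reduceFinMk, Matrix.cons_val] at h ⊢ <;>
    obtain ⟨k1, k2, k3⟩ := h <;>
    simp only [h3, div_le_iff₀ h0, div_le_iff₀ hq, le_div_iff₀ h0, le_div_iff₀ hq, le_div_iff₀ hr] <;>
    refine ⟨?_, ?_, ?_⟩ <;> linarith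

/-- Comparison of the quotients that occur in the basis functions, on the two sides of the lines that
separate the triangles of the local mesh. -/
theorem quotient_facts {t : ℝ} (h0 : 0 < t) (h1 : t < 1) (x : ℝ × ℝ) {Y R Q : ℝ} (hY : Y = x.2 / t)
    (hR : R = (1 - x.2) / (4 - t)) (hQ : Q = (1 - x.1 - x.2) / (1 - t)) :
    (Y ≤ 1 / 4 → 1 / 4 ≤ R ∧ R ≤ 1 / 3 - Y / 3) ∧ (1 / 4 ≤ Y → R ≤ 1 / 4 ∧ 1 / 3 - Y / 3 ≤ R) ∧
    (Y ≤ 1 - x.1 → Y ≤ Q ∧ 1 - x.1 ≤ Q) ∧ (1 - x.1 ≤ Y → Q ≤ Y ∧ Q ≤ 1 - x.1) ∧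
    (x.1 ≤ 3 * R → R ≤ Q) ∧ (3 * R ≤ x.1 → Q ≤ R) := by
  have hq : 0 < 4 - t := by linarith
  have hr : 0 < 1 - t := by linarith
  have eY : x.2 = t * Y := by rw [hY]; field_simp
  have eR : (4 - t) * R = 1 - t * Y := by rw [← eY, hR]; field_simp
  have eQ : (1 - t) * Q = 1 - x.1 - t * Y := by rw [← eY, hQ]; field_simp
  clear hY hR hQ
  refine ⟨fun h => ⟨?_, ?_⟩, fun h => ⟨?_, ?_⟩, fun h => ⟨?_, ?_⟩, fun h => ⟨?_, ?_⟩, fun h => ?_,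
    fun h => ?_⟩
  · refine le_of_mul_le_mul_left ?_ hq; nlinarith
  · refine le_of_mul_le_mul_left ?_ hq; nlinarith
  · refine le_of_mul_le_mul_left ?_ hq; nlinarith
  · refine le_of_mul_le_mul_left ?_ hq; nlinarith
  · refine le_of_mul_le_mul_left ?_ hr; nlinarith
  · refine le_of_mul_le_mul_left ?_ hr; nlinarith
  · refine le_of_mul_le_mul_left ?_ hr; nlinarith
  · refine le_of_mul_le_mul_left ?_ hr; nlinarith
  · refine le_of_mul_le_mul_left ?_ hr; nlinarith
  · refine le_of_mul_le_mul_left ?_ hr; nlinarith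

theorem posMin_eq {a b c d e : ℝ} (he : 0 ≤ e) (ha : e ≤ a) (hb : e ≤ b) (hc : e ≤ c) (hd : e ≤ d)
    (h : e = a ∨ e = b ∨ e = c ∨ e = d) : max 0 (min (min a b) (min c d)) = e := by
  refine le_antisymm (max_le he ?_)
    (le_max_of_le_right (le_min (le_min ha hb) (le_min hc hd)))
  rcases h with rfl | rfl | rfl | rfl <;> simp

theorem posMin_eq_zero {a b c d : ℝ} (h : a ≤ 0 ∨ b ≤ 0 ∨ c ≤ 0 ∨ d ≤ 0) :
    max 0 (min (min a b) (min c d)) = 0 := by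
  refine max_eq_left ?_
  simp only [min_le_iff]
  tauto

theorem bubbleM_inner {t : ℝ} (h0 : 0 < t) (h1 : t < 1) (k : Fin 6) {x : ℝ × ℝ}
    (hx : x ∈ (innerPiece t k).carrier) : bubbleM t x = ![2 * (x.1 - x.2 / t),
      1 - 4 * (x.2 / t), 2 * (1 - x.1 - x.2 / t), 0, 0, 0] k := by
  have hI := ineq_of_mem_innerPiece' h0 h1 k hx rfl rfl rfl
  have ht : 0 ≤ x.2 := ((mem_carrier_refTriangle x).1 (carrier_innerPiece_subset h0 h1 k hx)).2.1
  rw [bubbleM]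
  generalize x.2 / t = Y at *
  fin_cases k <;> simp only [Fin.zero_eta, Fin.mk_one, Fin.reduceFinMk, Matrix.cons_val] at hI ⊢ <;>
    obtain ⟨k1, k2, k3⟩ := hI
  · refine posMin_eq (by linarith) (by linarith) (by linarith) (by linarith)
      (le_min (by linarith) le_rfl) (Or.inr (Or.inr (Or.inr ?_)))
    exact (min_eq_right (by linarith)).symm
  · refine posMin_eq (by linarith) (by linarith) (by linarith) (by linarith)
      (le_min le_rfl (by linarith)) (Or.inr (Or.inr (Or.inr ?_)))
    exact (min_eq_left (by linarith)).symm
  · exact posMin_eq (by linarith) (by linarith) (by linarith) le_rfl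
      (le_min (by linarith) (by linarith)) (by simp)
  · exact posMin_eq_zero (Or.inr (Or.inr (Or.inr (min_le_of_right_le (by linarith)))))
  · exact posMin_eq_zero (Or.inr (Or.inr (Or.inr (min_le_of_left_le (by linarith)))))
  · exact posMin_eq_zero (Or.inr (Or.inr (Or.inl (by linarith))))

theorem bubbleN_inner {t : ℝ} (h0 : 0 < t) (h1 : t < 1) (k : Fin 6) {x : ℝ × ℝ}
    (hx : x ∈ (innerPiece t k).carrier) : bubbleN t x = ![4 * (x.2 / t),
      2 * (x.2 / t) - 2 * x.1 + 1, 0, 4 * x.1, 6 * ((1 - x.2) / (4 - t)) - 2 * x.1, 0] k := by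
  have hI := ineq_of_mem_innerPiece' h0 h1 k hx rfl rfl rfl
  obtain ⟨f1, f2, f3, f4, f5, f6⟩ := quotient_facts h0 h1 x rfl rfl rfl
  rw [bubbleN]
  generalize x.2 / t = Y at *
  generalize (1 - x.2) / (4 - t) = R at *
  fin_cases k <;> simp only [Fin.zero_eta, Fin.mk_one, Fin.reduceFinMk, Matrix.cons_val] at hI ⊢ <;>
    obtain ⟨k1, k2, k3⟩ := hI
  · obtain ⟨f1, f1'⟩ := f1 (by linarith)
    exact posMin_eq (by linarith) (by linarith) (by linarith) (by linarith) (by linarith) (by simp)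
  · obtain ⟨f1, f1'⟩ := f1 (by linarith)
    exact posMin_eq (by linarith) (by linarith) (by linarith) (by linarith) (by linarith) (by simp)
  · exact posMin_eq_zero (Or.inr (Or.inl (by linarith)))
  · refine posMin_eq (by linarith) (by linarith) ?_ (by linarith) (by linarith) (by simp)
    rcases le_total Y (1 / 4) with h | h
    · linarith
    · linarith [f2 h]
  · obtain ⟨f2, f2'⟩ := f2 (by linarith)
    exact posMin_eq (by linarith) (by linarith) (by linarith) (by linarith) (by linarith) (by simp)
  · exact posMin_eq_zero (Or.inr (Or.inr (Or.inl (by linarith))))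

theorem bubbleP_inner {t : ℝ} (h0 : 0 < t) (h1 : t < 1) (k : Fin 6) {x : ℝ × ℝ}
    (hx : x ∈ (innerPiece t k).carrier) : bubbleP t x = ![0, 2 * (x.2 / t) - 1 + 2 * x.1,
      4 * (x.2 / t), 0, 2 * x.1 - 2 * ((1 - x.2) / (4 - t)),
      4 * ((1 - x.1 - x.2) / (1 - t))] k := by
  have hI := ineq_of_mem_innerPiece' h0 h1 k hx rfl rfl rfl
  obtain ⟨f1, f2, f3, f4, f5, f6⟩ := quotient_facts h0 h1 x rfl rfl rfl
  rw [bubbleP]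
  generalize x.2 / t = Y at *
  generalize (1 - x.2) / (4 - t) = R at *
  generalize (1 - x.1 - x.2) / (1 - t) = Q at *
  fin_cases k <;> simp only [Fin.zero_eta, Fin.mk_one, Fin.reduceFinMk, Matrix.cons_val] at hI ⊢ <;>
    obtain ⟨k1, k2, k3⟩ := hI
  · exact posMin_eq_zero (Or.inr (Or.inr (Or.inr (by linarith))))
  · obtain ⟨f1, f1'⟩ := f1 (by linarith)
    obtain ⟨f3, f3'⟩ := f3 (by linarith)
    exact posMin_eq (by linarith) (by linarith) (by linarith) (by linarith) (by linarith) (by simp)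
  · obtain ⟨f1, f1'⟩ := f1 (by linarith)
    obtain ⟨f3, f3'⟩ := f3 (by linarith)
    exact posMin_eq (by linarith) (by linarith) (by linarith) (by linarith) (by linarith) (by simp)
  · exact posMin_eq_zero (Or.inr (Or.inr (Or.inl (by linarith))))
  · obtain ⟨f2, f2'⟩ := f2 (by linarith)
    have f5 := f5 (by linarith)
    exact posMin_eq (by linarith) (by linarith) (by linarith) (by linarith) (by linarith) (by simp)
  · obtain ⟨f4, f4'⟩ := f4 (by linarith)
    have f6 := f6 (by linarith)
    refine posMin_eq (by linarith) (by linarith) (by linarith) (by linarith) ?_ (by simp)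
    rcases le_total Y (1 / 4) with h | h
    · linarith [f1 h]
    · linarith [f2 h]

theorem isAffineOn_bubbleM_inner {t : ℝ} (h0 : 0 < t) (h1 : t < 1) (k : Fin 6) :
    IsAffineOn (bubbleM t) (innerPiece t k).carrier := by
  refine ⟨(![2, 0, -2, 0, 0, 0] : Fin 6 → ℝ) k, (![-2 / t, -4 / t, -2 / t, 0, 0, 0] : Fin 6 → ℝ) k,
    (![0, 1, 2, 0, 0, 0] : Fin 6 → ℝ) k, fun x hx => ?_⟩
  rw [bubbleM_inner h0 h1 k hx]
  fin_cases k <;> simp <;> ring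

theorem isAffineOn_bubbleN_inner {t : ℝ} (h0 : 0 < t) (h1 : t < 1) (k : Fin 6) :
    IsAffineOn (bubbleN t) (innerPiece t k).carrier := by
  refine ⟨(![0, -2, 0, 4, -2, 0] : Fin 6 → ℝ) k,
    (![4 / t, 2 / t, 0, 0, -6 / (4 - t), 0] : Fin 6 → ℝ) k,
    (![0, 1, 0, 0, 6 / (4 - t), 0] : Fin 6 → ℝ) k, fun x hx => ?_⟩
  rw [bubbleN_inner h0 h1 k hx]
  fin_cases k <;> simp <;> ring

theorem isAffineOn_bubbleP_inner {t : ℝ} (h0 : 0 < t) (h1 : t < 1) (k : Fin 6) :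
    IsAffineOn (bubbleP t) (innerPiece t k).carrier := by
  refine ⟨(![0, 2, 0, 0, 2, -4 / (1 - t)] : Fin 6 → ℝ) k,
    (![0, 2 / t, 4 / t, 0, 2 / (4 - t), -4 / (1 - t)] : Fin 6 → ℝ) k,
    (![0, -1, 0, 0, -2 / (4 - t), 4 / (1 - t)] : Fin 6 → ℝ) k, fun x hx => ?_⟩
  rw [bubbleP_inner h0 h1 k hx]
  fin_cases k <;> simp <;> ring

theorem isAffineOn_bubbleM_outer {t : ℝ} (h0 : 0 < t) (k : Fin 2) :
    IsAffineOn (bubbleM t) (outerPiece k).carrier := by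
  refine ⟨(![2, -2] : Fin 2 → ℝ) k, (![2, 0] : Fin 2 → ℝ) k, (![0, 2] : Fin 2 → ℝ) k,
    fun x hx => ?_⟩
  obtain ⟨n1, n2, n3⟩ := (mem_carrier_refNeighbor x).1 (carrier_outerPiece_subset k hx)
  have hY : x.2 / t ≤ 0 := div_nonpos_of_nonpos_of_nonneg n2 h0.le
  rw [Triangle.mem_carrier_iff] at hx
  obtain ⟨a, b, c, ha, hb, hc, h, e1, e2⟩ := hx
  rw [bubbleM]
  generalize x.2 / t = Y at *
  fin_cases k <;> simp [outerPiece] at e1 e2 ⊢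
  · exact posMin_eq (by linarith) (by linarith) (by linarith) (by linarith)
      (le_min (by linarith) (by linarith)) (Or.inl (by ring))
  · exact posMin_eq (by linarith) (by linarith) (by linarith) (by linarith)
      (le_min (by linarith) (by linarith)) (Or.inr (Or.inl (by ring)))

theorem isAffineOn_bubbleN_outer {t : ℝ} (h0 : 0 < t) (k : Fin 2) :
    IsAffineOn (bubbleN t) (outerPiece k).carrier := by
  refine ⟨0, 0, 0, fun x hx => ?_⟩
  obtain ⟨n1, n2, n3⟩ := (mem_carrier_refNeighbor x).1 (carrier_outerPiece_subset k hx)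
  have hY : x.2 / t ≤ 0 := div_nonpos_of_nonpos_of_nonneg n2 h0.le
  rw [bubbleN, posMin_eq_zero (Or.inl (by linarith))]
  ring

theorem isAffineOn_bubbleP_outer {t : ℝ} (h0 : 0 < t) (k : Fin 2) :
    IsAffineOn (bubbleP t) (outerPiece k).carrier := by
  refine ⟨0, 0, 0, fun x hx => ?_⟩
  obtain ⟨n1, n2, n3⟩ := (mem_carrier_refNeighbor x).1 (carrier_outerPiece_subset k hx)
  have hY : x.2 / t ≤ 0 := div_nonpos_of_nonpos_of_nonneg n2 h0.le
  rw [bubbleP, posMin_eq_zero (Or.inl (by linarith))]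
  ring

theorem bubbleM_values {t : ℝ} (h0 : 0 < t) : bubbleM t (1 / 2, 0) = 1 ∧
    bubbleM t (1 / 4, t / 4) = 0 ∧ bubbleM t (3 / 4, t / 4) = 0 := by
  have e : t / 4 / t = 1 / 4 := by field_simp
  simp only [bubbleM, e]
  norm_num

theorem bubbleN_values {t : ℝ} (h0 : 0 < t) (h1 : t < 1) : bubbleN t (1 / 2, 0) = 0 ∧
    bubbleN t (1 / 4, t / 4) = 1 ∧ bubbleN t (3 / 4, t / 4) = 0 := by
  have e : t / 4 / t = 1 / 4 := by field_simp
  have e' : (1 - t / 4) / (4 - t) = 1 / 4 := by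
    have : 4 - t ≠ 0 := by linarith
    field_simp
  simp only [bubbleN, e, e']
  refine ⟨posMin_eq_zero (Or.inl (by simp)), by norm_num, posMin_eq_zero (Or.inr (Or.inl ?_))⟩
  norm_num

theorem bubbleP_values {t : ℝ} (h0 : 0 < t) (h1 : t < 1) : bubbleP t (1 / 2, 0) = 0 ∧
    bubbleP t (1 / 4, t / 4) = 0 ∧ bubbleP t (3 / 4, t / 4) = 1 := by
  have e : t / 4 / t = 1 / 4 := by field_simp
  have e' : (1 - t / 4) / (4 - t) = 1 / 4 := by
    have : 4 - t ≠ 0 := by linarith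
    field_simp
  have e2 : (1 - 3 / 4 - t / 4) / (1 - t) = 1 / 4 := by
    have : 1 - t ≠ 0 := by linarith
    field_simp
    ring
  simp only [bubbleP, e, e', e2]
  refine ⟨posMin_eq_zero (Or.inl (by simp)), posMin_eq_zero (Or.inr (Or.inr (Or.inl ?_))), ?_⟩ <;>
    norm_num

/-! ### Basis functions on the rectangle -/

/-- The positions of all nodes of the grid of `m × n` squares. -/
def boxNodes (m n : ℕ) : Set (ℤ × ℤ) := {v | 0 ≤ v.1 ∧ v.1 ≤ m ∧ 0 ≤ v.2 ∧ v.2 ≤ n}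

/-- The positions of the interior nodes of the grid of `m × n` squares. -/
def innerNodes (m n : ℕ) : Set (ℤ × ℤ) := {v | 0 < v.1 ∧ v.1 < m ∧ 0 < v.2 ∧ v.2 < n}

namespace EmbeddedMesh
variable {𝓜 : EmbeddedMesh}

theorem eq_or_eq_of_mem_refStar {T T' : GridTriangle} {x : ℝ × ℝ} (hx : 𝓜.refCoord T x ∈ refStar)
    (hx' : x ∈ (𝓜.plainTriangle T').carrier) : T' = T ∨ T' = 𝓜.nbr T := by
  rw [mem_carrier_plainTriangle] at hx'
  obtain ⟨b1, b2, b3, b4⟩ := hx'.bounds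
  obtain ⟨i, j, b⟩ := T
  obtain ⟨i', j', b'⟩ := T'
  simp only at b1 b2 b3 b4
  -- The sum of the coordinates lies between consecutive integers on every grid triangle.
  have hsum : ((i' + j' + (if b' then 1 else 0) : ℤ) : ℝ) ≤
        (𝓜.gridCoord x).1 + (𝓜.gridCoord x).2 ∧
      (𝓜.gridCoord x).1 + (𝓜.gridCoord x).2 ≤ ((i' + j' + (if b' then 1 else 0) : ℤ) : ℝ) + 1 := by
    cases b' <;> simp [Closed] at hx' ⊢ <;> constructor <;> linarith
  obtain ⟨s1, s2⟩ := hsum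
  cases hv : 𝓜.vert ⟨i, j, b⟩ <;> cases b <;>
    simp only [refCoord, hv, refStar, GridTriangle.sign, GridTriangle.corner, gridCoord, nbr,
      GridTriangle.acrossLeg, mem_ofPred_eq, if_true, Bool.false_eq_true, if_false]
      at hx s1 s2 b1 b2 b3 b4 ⊢ <;>
    obtain ⟨h1, h2, h3, h4⟩ := hx
  all_goals
    generalize (x.1 - 𝓜.x₀) / 𝓜.h = X at *
    generalize (x.2 - 𝓜.y₀) / 𝓜.h = Y at *
    push_cast at h1 h2 h3 h4
  · have hi : i = i' := eq_of_lt_of_le (by linarith) (by linarith) b1 b2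
    have hk := eq_of_lt_of_le (a := i + j) (by push_cast; linarith) (by push_cast; linarith) s1 s2
    cases b' <;> simp at hk ⊢ <;> omega
  · have hi : i = i' := eq_of_lt_of_le (by linarith) (by linarith) b1 b2
    have hk := eq_of_lt_of_le (a := i + j + 1) (by push_cast; linarith) (by push_cast; linarith)
      s1 s2
    cases b' <;> simp at hk ⊢ <;> omega
  · have hi : j = j' := eq_of_lt_of_le (by linarith) (by linarith) b3 b4
    have hk := eq_of_lt_of_le (a := i + j) (by push_cast; linarith) (by push_cast; linarith) s1 s2
    cases b' <;> simp at hk ⊢ <;> omega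
  · have hi : j = j' := eq_of_lt_of_le (by linarith) (by linarith) b3 b4
    have hk := eq_of_lt_of_le (a := i + j + 1) (by push_cast; linarith) (by push_cast; linarith)
      s1 s2
    cases b' <;> simp at hk ⊢ <;> omega

theorem interior_closure_domain : interior (closure 𝓜.domain) = 𝓜.domain := by
  have h := 𝓜.h_pos
  have hm : (0 : ℝ) < 𝓜.m := Nat.cast_pos.2 𝓜.m_pos
  have hn : (0 : ℝ) < 𝓜.n := Nat.cast_pos.2 𝓜.n_pos
  have e1 : 𝓜.x₀ ≠ 𝓜.x₀ + 𝓜.m * 𝓜.h := by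
    have := mul_pos hm h
    intro e; linarith
  have e2 : 𝓜.y₀ ≠ 𝓜.y₀ + 𝓜.n * 𝓜.h := by
    have := mul_pos hn h
    intro e; linarith
  rw [domain, closure_prod_eq, closure_Ioo e1, closure_Ioo e2, interior_prod_eq, interior_Icc,
    interior_Icc]

theorem isOpen_refStar : IsOpen refStar := by
  refine (isOpen_lt continuous_const continuous_fst).inter
    ((isOpen_lt continuous_fst continuous_const).inter
    ((isOpen_lt continuous_const (continuous_fst.add continuous_snd)).inter
      (isOpen_lt (continuous_fst.add continuous_snd) continuous_const)))

theorem mem_domain_of_mem_refStar {T : GridTriangle} (hT : T ∈ 𝓜.partitioned) {x : ℝ × ℝ}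
    (hx : 𝓜.refCoord T x ∈ refStar) : x ∈ 𝓜.domain := by
  rw [← interior_closure_domain]
  refine mem_interior.2 ⟨𝓜.refCoord T ⁻¹' refStar, ?_,
    isOpen_refStar.preimage (𝓜.continuous_refCoord T), hx⟩
  rintro y ⟨h1, h2, h3, h4⟩
  rcases le_total 0 (𝓜.refCoord T y).2 with h | h
  · refine 𝓜.carrier_plain_subset (𝓜.partitioned_inGrid T hT) ?_
    rw [carrier_plainTriangle, mem_carrier_place, mem_carrier_refTriangle]
    exact ⟨h1.le, h, h4.le⟩
  · refine 𝓜.carrier_plain_subset (𝓜.nbr_inGrid hT) ?_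
    rw [carrier_plainTriangle_nbr, mem_carrier_place, mem_carrier_refNeighbor]
    exact ⟨h2.le, h, h3.le⟩

/-- A continuous function on the reference configuration that vanishes outside of the star and is
affine on the triangles of the local mesh gives rise to a finite element function. -/
theorem comp_refCoord_mem_V0 {T : GridTriangle} (hT : T ∈ 𝓜.partitioned) {β : ℝ × ℝ → ℝ}
    (hβ : Continuous β) (h0 : ∀ x, x ∉ refStar → β x = 0)
    (h1 : ∀ k, IsAffineOn β (innerPiece (𝓜.tanα T) k).carrier)
    (h2 : ∀ k, IsAffineOn β (outerPiece k).carrier) :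
    (fun x => β (𝓜.refCoord T x)) ∈ V0 𝓜.domain 𝓜.triangles := by
  have hz : ∀ x, x ∉ 𝓜.domain → β (𝓜.refCoord T x) = 0 := fun x hx =>
    h0 _ fun h => hx (mem_domain_of_mem_refStar hT h)
  have hplain : ∀ {T' : GridTriangle} {K : Triangle}, T' ≠ T → T' ≠ 𝓜.nbr T →
      K.carrier ⊆ (𝓜.plainTriangle T').carrier →
      IsAffineOn (fun x => β (𝓜.refCoord T x)) K.carrier := by
    intro T' K hne hne' hsub
    refine ⟨0, 0, 0, fun x hx => ?_⟩
    simp only [zero_mul, add_zero]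
    refine h0 _ fun h => ?_
    rcases eq_or_eq_of_mem_refStar h (hsub hx) with h | h
    exacts [hne h, hne' h]
  refine ⟨⟨(hβ.comp (𝓜.continuous_refCoord T)).continuousOn, fun K hK => ?_,
    fun x hx => hz x fun h => hx (subset_closure h)⟩,
    fun x hx => hz x ((𝓜.mem_frontier_iff x).1 hx).2⟩
  rcases hK with hK | ⟨T', hT', hn1, hn2, rfl⟩
  · obtain ⟨T', hT', h⟩ := mem_iUnion₂.1 hK
    rw [localMesh_eq] at h
    by_cases hTT : T' = T
    · subst hTT
      rcases h with ⟨k, rfl⟩ | ⟨k, rfl⟩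
      · exact 𝓜.isAffineOn_place T' (h1 k)
      · exact 𝓜.isAffineOn_place T' (h2 k)
    · rcases h with ⟨k, rfl⟩ | ⟨k, rfl⟩
      · refine hplain hTT ?_ (𝓜.inner_carrier_subset hT' k)
        rintro rfl
        exact 𝓜.nbr_notMem hT hT'
      · refine hplain ?_ ?_ (𝓜.outer_carrier_subset T' k)
        · rintro rfl
          exact 𝓜.nbr_notMem hT' hT
        · exact fun h => hTT (𝓜.nbr_injOn hT' hT h)
  · refine hplain ?_ (hn2 T hT) subset_rfl
    rintro rfl
    exact hn1 hT

theorem refCoord_node_notMem (T : GridTriangle) (v : ℤ × ℤ) :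
    𝓜.refCoord T (𝓜.node v) ∉ refStar := by
  have h := 𝓜.gridCoord_node v
  simp only [gridCoord, Prod.mk.injEq] at h
  obtain ⟨e1, e2⟩ := h
  have key : ∀ a b : ℤ, 0 < T.sign * ((a : ℝ) - b) → T.sign * ((a : ℝ) - b) < 1 → False := by
    intro a b h1 h2
    unfold GridTriangle.sign at h1 h2
    have k1 : ∀ c : ℤ, (0 : ℝ) < c → (c : ℝ) < 1 → False := by
      intro c h1 h2
      have h1' : 0 < c := by exact_mod_cast h1
      have h2' : c < 1 := by exact_mod_cast h2
      omega
    split_ifs at h1 h2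
    · exact k1 (b - a) (by push_cast; linarith) (by push_cast; linarith)
    · exact k1 (a - b) (by push_cast; linarith) (by push_cast; linarith)
  rintro ⟨h1, h2, -, -⟩
  simp only [refCoord, e1, e2] at h1 h2
  split_ifs at h1 h2
  · exact key _ _ h1 h2
  · exact key _ _ h1 h2

/-- The points added to a partitioned triangle lie in this triangle. -/
theorem added_mem {T : GridTriangle} (hT : T ∈ 𝓜.partitioned) :
    𝓜.refPoint T (1 / 2) 0 ∈ (𝓜.plainTriangle T).carrier ∧
    𝓜.refPoint T (1 / 4) (𝓜.tanα T / 4) ∈ (𝓜.plainTriangle T).carrier ∧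
    𝓜.refPoint T (3 / 4) (𝓜.tanα T / 4) ∈ (𝓜.plainTriangle T).carrier := by
  have h0 := 𝓜.tanα_pos hT
  have h1 := 𝓜.tanα_lt_one hT
  simp only [carrier_plainTriangle, mem_carrier_place, refCoord_refPoint, mem_carrier_refTriangle]
  refine ⟨⟨?_, ?_, ?_⟩, ⟨?_, ?_, ?_⟩, ?_, ?_, ?_⟩ <;> linarith

theorem comp_refCoord_node {T : GridTriangle} {β : ℝ × ℝ → ℝ} (h0 : ∀ x, x ∉ refStar → β x = 0)
    (v : ℤ × ℤ) : β (𝓜.refCoord T (𝓜.node v)) = 0 := h0 _ (refCoord_node_notMem T v)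

theorem comp_refCoord_of_ne {T T' : GridTriangle} (hT : T ∈ 𝓜.partitioned)
    (hT' : T' ∈ 𝓜.partitioned) (hne : T' ≠ T) {β : ℝ × ℝ → ℝ}
    (h0 : ∀ x, x ∉ refStar → β x = 0) {x : ℝ × ℝ} (hx : x ∈ (𝓜.plainTriangle T').carrier) :
    β (𝓜.refCoord T x) = 0 := by
  refine h0 _ fun h => ?_
  rcases eq_or_eq_of_mem_refStar h hx with h | rfl
  · exact hne h
  · exact 𝓜.nbr_notMem hT hT'

/-! ### The hat functions of the three-line mesh -/

/-- The basis function of the origin on the three-line mesh with unit squares. -/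
def refHat (x : ℝ × ℝ) : ℝ := max 0 (1 - max |x.1| (max |x.2| |x.1 + x.2|))

variable (𝓜) in
/-- The basis function of a grid node on the three-line mesh. -/
noncomputable def hat (v : ℤ × ℤ) (x : ℝ × ℝ) : ℝ :=
  refHat ((𝓜.gridCoord x).1 - v.1, (𝓜.gridCoord x).2 - v.2)

theorem refHat_eq_zero {x : ℝ × ℝ} (h : 1 ≤ |x.1| ∨ 1 ≤ |x.2| ∨ 1 ≤ |x.1 + x.2|) :
    refHat x = 0 := by
  refine max_eq_left ?_
  rw [sub_nonpos]
  simp only [le_max_iff]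
  exact h

theorem refHat_eq {x : ℝ × ℝ} {r : ℝ} (h0 : |x.1| ≤ r) (h1 : |x.2| ≤ r) (h2 : |x.1 + x.2| ≤ r)
    (h3 : r ≤ 1) (h : r = |x.1| ∨ r = |x.2| ∨ r = |x.1 + x.2|) : refHat x = 1 - r := by
  have : max |x.1| (max |x.2| |x.1 + x.2|) = r := by
    refine le_antisymm (max_le h0 (max_le h1 h2)) ?_
    simp only [le_max_iff]
    rcases h with h | h | h
    · exact Or.inl h.le
    · exact Or.inr (Or.inl h.le)
    · exact Or.inr (Or.inr h.le)
  rw [refHat, this]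
  exact max_eq_right (by linarith)

theorem isAffineOn_refHat (a b : ℤ) (upper : Bool) :
    IsAffineOn refHat {x | GridTriangle.Closed ⟨a, b, upper⟩ x} := by
  have zero : (∀ x : ℝ × ℝ, GridTriangle.Closed ⟨a, b, upper⟩ x →
      1 ≤ |x.1| ∨ 1 ≤ |x.2| ∨ 1 ≤ |x.1 + x.2|) →
      IsAffineOn refHat {x | GridTriangle.Closed ⟨a, b, upper⟩ x} := fun h =>
    ⟨0, 0, 0, fun x hx => by rw [refHat_eq_zero (h x hx)]; ring⟩
  have far : ∀ {c : ℤ} {r : ℝ}, (c : ℝ) ≤ r → r ≤ c + 1 → (1 ≤ c ∨ c ≤ -2) → 1 ≤ |r| := by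
    rintro c r h1 h2 (h | h)
    · have : (1 : ℝ) ≤ c := by exact_mod_cast h
      exact le_trans (by linarith) (le_abs_self r)
    · have : (c : ℝ) ≤ -2 := by exact_mod_cast h
      exact le_trans (by linarith) (neg_le_abs r)
  by_cases ha : 1 ≤ a ∨ a ≤ -2
  · exact zero fun x hx => Or.inl (far hx.bounds.1 hx.bounds.2.1 ha)
  by_cases hb : 1 ≤ b ∨ b ≤ -2
  · exact zero fun x hx => Or.inr (Or.inl (far hx.bounds.2.2.1 hx.bounds.2.2.2 hb))
  have ha' : a = 0 ∨ a = -1 := by omega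
  have hb' : b = 0 ∨ b = -1 := by omega
  rcases ha' with rfl | rfl <;> rcases hb' with rfl | rfl <;> cases upper
  · refine ⟨-1, -1, 1, fun x hx => ?_⟩
    simp only [mem_ofPred_eq, Closed] at hx
    norm_num at hx
    obtain ⟨h1, h2, h3⟩ := hx
    rw [refHat_eq (r := x.1 + x.2)] <;> grind
  · refine zero fun x hx => Or.inr (Or.inr ?_)
    simp only [Closed] at hx
    norm_num at hx
    grind
  · refine ⟨0, 1, 1, fun x hx => ?_⟩
    simp only [mem_ofPred_eq, Closed] at hx
    norm_num at hx
    rw [refHat_eq (r := -x.2)] <;> grind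
  · refine ⟨-1, 0, 1, fun x hx => ?_⟩
    simp only [mem_ofPred_eq, Closed] at hx
    norm_num at hx
    rw [refHat_eq (r := x.1)] <;> grind
  · refine ⟨1, 0, 1, fun x hx => ?_⟩
    simp only [mem_ofPred_eq, Closed] at hx
    norm_num at hx
    rw [refHat_eq (r := -x.1)] <;> grind
  · refine ⟨0, -1, 1, fun x hx => ?_⟩
    simp only [mem_ofPred_eq, Closed] at hx
    norm_num at hx
    rw [refHat_eq (r := x.2)] <;> grind
  · refine zero fun x hx => Or.inr (Or.inr ?_)
    simp only [Closed] at hx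
    norm_num at hx
    grind
  · refine ⟨1, 1, 1, fun x hx => ?_⟩
    simp only [mem_ofPred_eq, Closed] at hx
    norm_num at hx
    rw [refHat_eq (r := -(x.1 + x.2))] <;> grind

theorem isAffineOn_hat (v : ℤ × ℤ) (T : GridTriangle) :
    IsAffineOn (𝓜.hat v) (𝓜.plainTriangle T).carrier := by
  obtain ⟨a, b, c, h⟩ := isAffineOn_refHat (T.i - v.1) (T.j - v.2) T.upper
  refine ⟨a / 𝓜.h, b / 𝓜.h, a * (-𝓜.x₀ / 𝓜.h - v.1) + b * (-𝓜.y₀ / 𝓜.h - v.2) + c,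
    fun x hx => ?_⟩
  rw [mem_carrier_plainTriangle] at hx
  rw [hat, h]
  · simp only [gridCoord]
    ring
  · simp only [mem_ofPred_eq, Closed] at hx ⊢
    push_cast
    split_ifs at hx ⊢ <;> refine ⟨?_, ?_, ?_⟩ <;> linarith

theorem hat_node (v w : ℤ × ℤ) : 𝓜.hat v (𝓜.node w) = if w = v then 1 else 0 := by
  rw [hat, gridCoord_node]
  split_ifs with h
  · subst h; simp [refHat]
  · refine refHat_eq_zero ?_
    have key : ∀ a b : ℤ, a ≠ b → (1 : ℝ) ≤ |(a : ℝ) - b| := by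
      intro a b hab
      have := Int.one_le_abs (sub_ne_zero.2 hab)
      exact_mod_cast this
    by_cases h1 : w.1 = v.1
    · exact Or.inr (Or.inl (key _ _ fun h2 => h (Prod.ext h1 h2)))
    · exact Or.inl (key _ _ h1)

theorem continuous_hat (v : ℤ × ℤ) : Continuous (𝓜.hat v) := by
  unfold hat refHat gridCoord
  fun_prop

theorem hat_mem_V0 {v : ℤ × ℤ} (hv : v ∈ innerNodes 𝓜.m 𝓜.n) :
    𝓜.hat v ∈ V0 𝓜.domain 𝓜.triangles := by
  obtain ⟨v1, v2, v3, v4⟩ := hv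
  have hz : ∀ x, x ∉ 𝓜.domain → 𝓜.hat v x = 0 := by
    intro x hx
    rw [hat]
    refine refHat_eq_zero ?_
    by_contra! hcon
    obtain ⟨h1, h2, -⟩ := hcon
    rw [abs_lt] at h1 h2
    refine hx ((𝓜.mem_domain_iff x).2 ?_)
    have k1 : (1 : ℝ) ≤ v.1 := by exact_mod_cast v1
    have k2 : (v.1 : ℝ) + 1 ≤ 𝓜.m := by exact_mod_cast v2
    have k3 : (1 : ℝ) ≤ v.2 := by exact_mod_cast v3
    have k4 : (v.2 : ℝ) + 1 ≤ 𝓜.n := by exact_mod_cast v4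
    simp only at h1 h2
    exact ⟨⟨by linarith, by linarith⟩, by linarith, by linarith⟩
  refine ⟨⟨(continuous_hat v).continuousOn, fun K hK => ?_,
    fun x hx => hz x fun h => hx (subset_closure h)⟩,
    fun x hx => hz x ((𝓜.mem_frontier_iff x).1 hx).2⟩
  obtain ⟨T, -, hsub⟩ := 𝓜.exists_plain_of_mem hK
  obtain ⟨a, b, c, h⟩ := isAffineOn_hat v T
  exact ⟨a, b, c, fun x hx => h x (hsub hx)⟩

/-- A function that is affine on a partitioned triangle does not deviate from linear
interpolation. -/
theorem dev_eq_zero {u : ℝ × ℝ → ℝ} {T : GridTriangle} (hT : T ∈ 𝓜.partitioned)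
    (hu : IsAffineOn u (𝓜.plainTriangle T).carrier) :
    𝓜.devM T u = 0 ∧ 𝓜.devN T u = 0 ∧ 𝓜.devP T u = 0 := by
  obtain ⟨a, b, c, h⟩ := hu
  obtain ⟨hM, hN, hP⟩ := added_mem hT
  have hB : 𝓜.node T.corner ∈ (𝓜.plainTriangle T).carrier := Triangle.p_mem _
  have hC : 𝓜.node (𝓜.vertC T) ∈ (𝓜.plainTriangle T).carrier := by
    unfold vertC; split_ifs
    exacts [Triangle.r_mem _, Triangle.q_mem _]
  have hA : 𝓜.node (𝓜.vertA T) ∈ (𝓜.plainTriangle T).carrier := by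
    unfold vertA; split_ifs
    exacts [Triangle.q_mem _, Triangle.r_mem _]
  simp only [devM, devN, devP, nodal, h _ hM, h _ hN, h _ hP, h _ hB, h _ hC, h _ hA]
  simp only [← refPoint_A, ← refPoint_B, ← refPoint_C, refPoint_eq]
  refine ⟨?_, ?_, ?_⟩ <;> split_ifs <;> ring

end EmbeddedMesh

/-! ### A perturbed discrete Laplacian is monotone -/

/-- The sum over the four neighbors of a grid position. -/
def nbrSum (w : ℤ × ℤ → ℝ) (v : ℤ × ℤ) : ℝ :=
  w (v.1 + 1, v.2) + w (v.1 - 1, v.2) + w (v.1, v.2 + 1) + w (v.1, v.2 - 1)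

/-- Two grid positions are neighbors. -/
def Adj (v l : ℤ × ℤ) : Prop :=
  l = (v.1 + 1, v.2) ∨ l = (v.1 - 1, v.2) ∨ l = (v.1, v.2 + 1) ∨ l = (v.1, v.2 - 1)

theorem Adj.symm {v l : ℤ × ℤ} (h : Adj v l) : Adj l v := by
  obtain ⟨a, b⟩ := v
  rcases h with rfl | rfl | rfl | rfl <;> simp [Adj]

theorem Adj.mem_box {m n : ℕ} {v l : ℤ × ℤ} (hv : v ∈ innerNodes m n) (h : Adj v l) :
    l ∈ boxNodes m n := by
  obtain ⟨h1, h2, h3, h4⟩ := hv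
  rcases h with rfl | rfl | rfl | rfl <;> refine ⟨?_, ?_, ?_, ?_⟩ <;> simp only <;> omega

theorem innerNodes_subset (m n : ℕ) : innerNodes m n ⊆ boxNodes m n :=
  fun _ ⟨h1, h2, h3, h4⟩ => ⟨h1.le, h2.le, h3.le, h4.le⟩

section Monotone

variable {m n : ℕ} {w : ℤ × ℤ → ℝ}

theorem nbrSum_nonneg (hw : ∀ v ∈ boxNodes m n, 0 ≤ w v) {v : ℤ × ℤ} (hv : v ∈ innerNodes m n) :
    0 ≤ nbrSum w v := by
  have h := fun l (hl : Adj v l) => hw l (hl.mem_box hv)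
  have h1 := h _ (Or.inl rfl)
  have h2 := h _ (Or.inr (Or.inl rfl))
  have h3 := h _ (Or.inr (Or.inr (Or.inl rfl)))
  have h4 := h _ (Or.inr (Or.inr (Or.inr rfl)))
  unfold nbrSum
  linarith

theorem le_nbrSum (hw : ∀ v ∈ boxNodes m n, 0 ≤ w v) {v l : ℤ × ℤ} (hv : v ∈ innerNodes m n)
    (hl : Adj v l) : w l ≤ nbrSum w v := by
  have h := fun l (hl : Adj v l) => hw l (hl.mem_box hv)
  have h1 := h _ (Or.inl rfl)
  have h2 := h _ (Or.inr (Or.inl rfl))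
  have h3 := h _ (Or.inr (Or.inr (Or.inl rfl)))
  have h4 := h _ (Or.inr (Or.inr (Or.inr rfl)))
  unfold nbrSum
  rcases hl with rfl | rfl | rfl | rfl <;> linarith

open Classical in
/-- The restriction of a function to the interior nodes, extended by zero. -/
noncomputable def innerPart (m n : ℕ) (w : ℤ × ℤ → ℝ) (v : ℤ × ℤ) : ℝ :=
  if v ∈ innerNodes m n then w v else 0

theorem innerPart_nbrSum_nonneg (hw : ∀ v ∈ boxNodes m n, 0 ≤ w v) (v : ℤ × ℤ) :
    0 ≤ innerPart m n (nbrSum w) v := by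
  unfold innerPart
  split_ifs with h
  exacts [nbrSum_nonneg hw h, le_rfl]

theorem le_nbrSum_nbrSum (hw : ∀ v ∈ boxNodes m n, 0 ≤ w v) {v l k : ℤ × ℤ}
    (hl : l ∈ innerNodes m n) (hvl : Adj v l) (hlk : Adj l k) :
    w k ≤ nbrSum (innerPart m n (nbrSum w)) v := by
  have h1 : w k ≤ innerPart m n (nbrSum w) l := by
    rw [innerPart, if_pos hl]
    exact le_nbrSum hw hl hlk
  have h := innerPart_nbrSum_nonneg hw
  refine h1.trans ?_
  generalize innerPart m n (nbrSum w) = f at *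
  unfold nbrSum
  rcases hvl with rfl | rfl | rfl | rfl <;> linarith [h (v.1 + 1, v.2), h (v.1 - 1, v.2),
    h (v.1, v.2 + 1), h (v.1, v.2 - 1)]

theorem nbrSum_innerPart_nbrSum_nonneg (hw : ∀ v ∈ boxNodes m n, 0 ≤ w v) (v : ℤ × ℤ) :
    0 ≤ nbrSum (innerPart m n (nbrSum w)) v := by
  have h := innerPart_nbrSum_nonneg hw
  exact add_nonneg (add_nonneg (add_nonneg (h _) (h _)) (h _)) (h _)

/-- The four vertices of a parallelogram of two grid triangles. The path `A B C A'` of grid edges runs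
through interior nodes up to its end, which may lie on the boundary. -/
structure Quad (m n : ℕ) where
  A : ℤ × ℤ
  B : ℤ × ℤ
  C : ℤ × ℤ
  A' : ℤ × ℤ
  A_mem : A ∈ innerNodes m n
  B_mem : B ∈ innerNodes m n
  C_mem : C ∈ innerNodes m n
  adj_AB : Adj A B
  adj_BC : Adj B C
  adj_CA' : Adj C A'
  A_ne_C : A ≠ C
  A_ne_A' : A ≠ A'
  B_ne_A' : B ≠ A'

theorem Adj.ne {v l : ℤ × ℤ} (h : Adj v l) : v ≠ l := by
  obtain ⟨a, b⟩ := v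
  rcases h with rfl | rfl | rfl | rfl <;> simp <;> omega

/-- The combination of nodal values that measures the jump of the normal derivative. -/
def Quad.jump (q : Quad m n) (w : ℤ × ℤ → ℝ) : ℝ := w q.A + w q.A' - w q.B - w q.C

/-- The nodal values of the basis function of a grid node. -/
def delta (v : ℤ × ℤ) (l : ℤ × ℤ) : ℝ := if l = v then 1 else 0

/-- The position is a vertex of the parallelogram. -/
def Quad.Has (q : Quad m n) (v : ℤ × ℤ) : Prop := v = q.A ∨ v = q.B ∨ v = q.C ∨ v = q.A'

theorem Quad.jump_delta_of_not (q : Quad m n) {v : ℤ × ℤ} (h : ¬q.Has v) : q.jump (delta v) = 0 := by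
  simp only [Quad.Has, not_or] at h
  obtain ⟨h1, h2, h3, h4⟩ := h
  simp [Quad.jump, delta, Ne.symm h1, Ne.symm h2, Ne.symm h3, Ne.symm h4]

theorem Quad.jump_delta_A (q : Quad m n) : q.jump (delta q.A) = 1 := by
  simp [Quad.jump, delta, q.A_ne_C.symm, q.A_ne_A'.symm, q.adj_AB.ne.symm]

theorem Quad.jump_delta_A' (q : Quad m n) : q.jump (delta q.A') = 1 := by
  simp [Quad.jump, delta, q.A_ne_A', q.B_ne_A', q.adj_CA'.ne]

theorem Quad.jump_delta_B (q : Quad m n) : q.jump (delta q.B) = -1 := by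
  simp [Quad.jump, delta, q.B_ne_A'.symm, q.adj_AB.ne, q.adj_BC.ne.symm]

theorem Quad.jump_delta_C (q : Quad m n) : q.jump (delta q.C) = -1 := by
  simp [Quad.jump, delta, q.A_ne_C, q.adj_BC.ne, q.adj_CA'.ne.symm]

/-- The coefficients of the perturbation that have the wrong sign belong to neighbors of `v` and to
nodes that are connected to `v` by a path of length two through an interior node. -/
theorem Quad.jump_mul_jump_ge (q : Quad m n) (hw : ∀ v ∈ boxNodes m n, 0 ≤ w v) {v : ℤ × ℤ}
    (hv : v ∈ innerNodes m n) (h : q.Has v) :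
    -(nbrSum w v + nbrSum (innerPart m n (nbrSum w)) v) ≤ q.jump (delta v) * q.jump w := by
  have hA := hw _ (innerNodes_subset m n q.A_mem)
  have hB := hw _ (innerNodes_subset m n q.B_mem)
  have hC := hw _ (innerNodes_subset m n q.C_mem)
  have hA' := hw _ (q.adj_CA'.mem_box q.C_mem)
  rcases h with rfl | rfl | rfl | rfl
  · have h1 := le_nbrSum hw hv q.adj_AB
    have h2 := le_nbrSum_nbrSum hw q.B_mem q.adj_AB q.adj_BC
    rw [q.jump_delta_A, Quad.jump]
    linarith
  · have h1 := le_nbrSum hw hv q.adj_AB.symm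
    have h2 := le_nbrSum_nbrSum hw q.C_mem q.adj_BC q.adj_CA'
    rw [q.jump_delta_B, Quad.jump]
    linarith
  · have h1 := le_nbrSum hw hv q.adj_CA'
    have h2 := le_nbrSum_nbrSum hw q.B_mem q.adj_BC.symm q.adj_AB.symm
    rw [q.jump_delta_C, Quad.jump]
    linarith
  · have h1 := le_nbrSum hw hv q.adj_CA'.symm
    have h2 := le_nbrSum_nbrSum hw q.C_mem q.adj_CA'.symm q.adj_BC.symm
    rw [q.jump_delta_A', Quad.jump]
    linarith

open Classical in
/-- The constant is `1 / 40 = 50 / 2000`, the bound on the number of parallelograms at a node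
times the bound on the coefficients. -/
theorem sum_jump_ge {ι : Type*} (s : Finset ι) (q : ι → Quad m n) (g : ι → ℝ)
    (hg0 : ∀ T ∈ s, 0 ≤ g T) (hg1 : ∀ T ∈ s, g T ≤ 1 / 2000)
    (hw : ∀ v ∈ boxNodes m n, 0 ≤ w v) {v : ℤ × ℤ}
    (hv : v ∈ innerNodes m n) (hcard : (s.filter fun T => (q T).Has v).card ≤ 50) :
    -(1 / 40 * (nbrSum w v + nbrSum (innerPart m n (nbrSum w)) v)) ≤
      ∑ T ∈ s, g T * ((q T).jump (delta v) * (q T).jump w) := by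
  set X := nbrSum w v + nbrSum (innerPart m n (nbrSum w)) v with hX
  have hX0 : 0 ≤ X := add_nonneg (nbrSum_nonneg hw hv) (nbrSum_innerPart_nbrSum_nonneg hw v)
  have h1 : ∑ T ∈ s, g T * ((q T).jump (delta v) * (q T).jump w)
      = ∑ T ∈ s.filter fun T => (q T).Has v, g T * ((q T).jump (delta v) * (q T).jump w) := by
    rw [Finset.sum_filter]
    refine Finset.sum_congr rfl fun T _ => ?_
    split_ifs with h
    · rfl
    · rw [(q T).jump_delta_of_not h]; ring
  have h2 : ∑ _T ∈ s.filter fun T => (q T).Has v, -(1 / 2000 * X) ≤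
      ∑ T ∈ s.filter fun T => (q T).Has v, g T * ((q T).jump (delta v) * (q T).jump w) := by
    refine Finset.sum_le_sum fun T hT => ?_
    obtain ⟨hTs, hT⟩ := Finset.mem_filter.1 hT
    have h3 := (q T).jump_mul_jump_ge hw hv hT
    have h4 := mul_le_mul_of_nonneg_left h3 (hg0 T hTs)
    have h5 := mul_le_mul_of_nonneg_right (hg1 T hTs) hX0
    linarith
  rw [h1]
  refine le_trans ?_ h2
  rw [Finset.sum_const, nsmul_eq_mul]
  have h3 : ((s.filter fun T => (q T).Has v).card : ℝ) ≤ 50 := by exact_mod_cast hcard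
  nlinarith

open Classical in
/-- The discrete Laplacian remains monotone under small perturbations of the given form: up to
nonnegative terms it is the product of `4 - (3 / 8) N` and `1 - (3 / 32) N`, where `N` is the sum
over neighbors, because products of entries of `N` dominate the entries of the perturbation that
have the wrong sign. -/
theorem le_of_perturbed_superharmonic {ι : Type*} (s : Finset ι) (q : ι → Quad m n) (g : ι → ℝ)
    (hg0 : ∀ T ∈ s, 0 ≤ g T) (hg1 : ∀ T ∈ s, g T ≤ 1 / 2000)
    (hcard : ∀ v, (s.filter fun T => (q T).Has v).card ≤ 50) {U : ℤ × ℤ → ℝ} {c : ℝ}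
    (hb : ∀ v ∈ boxNodes m n, v ∉ innerNodes m n → c ≤ U v)
    (hU : ∀ v ∈ innerNodes m n,
      0 ≤ 4 * U v - nbrSum U v - ∑ T ∈ s, g T * ((q T).jump (delta v) * (q T).jump U)) :
    ∀ v ∈ boxNodes m n, c ≤ U v := by
  have hfin : (boxNodes m n).Finite := by
    refine ((Set.finite_Icc (0 : ℤ) m).prod (Set.finite_Icc (0 : ℤ) n)).subset ?_
    rintro v ⟨h1, h2, h3, h4⟩
    exact ⟨⟨h1, h2⟩, h3, h4⟩
  by_contra! hcon
  obtain ⟨v', hv', hlt⟩ := hcon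
  obtain ⟨v₀, hv₀, hmin⟩ := Set.exists_min_image _ U hfin ⟨v', hv'⟩
  have hv₀c : U v₀ < c := (hmin v' hv').trans_lt hlt
  -- If the minimum of `U` is smaller than `c`, it is attained at interior nodes only.
  set w : ℤ × ℤ → ℝ := fun v => U v - U v₀ with hwdef
  have hw : ∀ v ∈ boxNodes m n, 0 ≤ w v := fun v hv => sub_nonneg.2 (hmin v hv)
  have hwb : ∀ v ∈ boxNodes m n, w v = 0 → v ∈ innerNodes m n := by
    intro v hv h0
    by_contra hvi
    have := hb v hv hvi
    simp only [hwdef] at h0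
    linarith
  have hjump : ∀ T, (q T).jump w = (q T).jump U := fun T => by simp only [Quad.jump, hwdef]; ring
  have hsup : ∀ v ∈ innerNodes m n, nbrSum w v -
      1 / 40 * (nbrSum w v + nbrSum (innerPart m n (nbrSum w)) v) ≤ 4 * w v := by
    intro v hv
    have h1 := hU v hv
    have h2 := sum_jump_ge s q g hg0 hg1 hw hv (hcard v)
    simp only [hjump] at h2
    have h3 : 4 * w v - nbrSum w v = 4 * U v - nbrSum U v := by
      simp only [hwdef, nbrSum]; ring
    linarith
  -- The product of the two factors, applied to `w`, is nonnegative. Hence the first factor, applied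
  -- to `w`, has no negative minimum.
  set z : ℤ × ℤ → ℝ := fun v => 4 * w v - 3 / 8 * nbrSum w v with hz
  have hz0 : ∀ v ∈ innerNodes m n, 0 ≤ z v := by
    obtain ⟨v₁, hv₁, hmin₁⟩ := Set.exists_min_image _ z (hfin.subset (innerNodes_subset m n))
      ⟨v₀, hwb v₀ hv₀ (sub_self _)⟩
    have hle : ∀ l, innerPart m n z l ≤
        4 * innerPart m n w l - 3 / 8 * innerPart m n (nbrSum w) l := by
      intro l
      unfold innerPart
      split_ifs <;> simp [hz]
    have hge : ∀ l, min (z v₁) 0 ≤ innerPart m n z l := by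
      intro l
      unfold innerPart
      split_ifs with h
      · exact (min_le_left _ _).trans (hmin₁ l h)
      · exact min_le_right _ _
    have hpart : nbrSum (innerPart m n w) v₁ ≤ nbrSum w v₁ := by
      have : ∀ l, Adj v₁ l → innerPart m n w l ≤ w l := by
        intro l hl
        unfold innerPart
        split_ifs
        exacts [le_rfl, hw l (hl.mem_box hv₁)]
      exact add_le_add (add_le_add (add_le_add (this _ (Or.inl rfl)) (this _ (Or.inr (Or.inl rfl))))
        (this _ (Or.inr (Or.inr (Or.inl rfl))))) (this _ (Or.inr (Or.inr (Or.inr rfl))))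
    have hZ : nbrSum (innerPart m n z) v₁ ≤
        4 * nbrSum (innerPart m n w) v₁ - 3 / 8 * nbrSum (innerPart m n (nbrSum w)) v₁ := by
      simp only [nbrSum]
      have := hle (v₁.1 + 1, v₁.2)
      have := hle (v₁.1 - 1, v₁.2)
      have := hle (v₁.1, v₁.2 + 1)
      have := hle (v₁.1, v₁.2 - 1)
      simp only [nbrSum] at *
      linarith
    have hZ' : 4 * min (z v₁) 0 ≤ nbrSum (innerPart m n z) v₁ := by
      simp only [nbrSum]
      linarith [hge (v₁.1 + 1, v₁.2), hge (v₁.1 - 1, v₁.2), hge (v₁.1, v₁.2 + 1),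
        hge (v₁.1, v₁.2 - 1)]
    have h1 := hsup v₁ hv₁
    have h2 := nbrSum_nonneg hw hv₁
    have h3 := nbrSum_innerPart_nbrSum_nonneg hw v₁
    have h4 : 3 / 32 * nbrSum (innerPart m n z) v₁ ≤ z v₁ := by
      have : z v₁ = 4 * w v₁ - 3 / 8 * nbrSum w v₁ := rfl
      linarith
    intro v hv
    refine le_trans ?_ (hmin₁ v hv)
    by_contra! hneg
    rw [min_eq_left hneg.le] at hZ'
    linarith
  -- The zeros of `w` propagate to the left, until they reach the boundary.
  obtain ⟨v₂, ⟨hv₂, hw₂⟩, hmin₂⟩ := Set.exists_min_image {v | v ∈ boxNodes m n ∧ w v = 0} Prod.fst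
    (hfin.subset fun v hv => hv.1) ⟨v₀, hv₀, sub_self _⟩
  have hi := hwb v₂ hv₂ hw₂
  have hz₂ : 0 ≤ 4 * w v₂ - 3 / 8 * nbrSum w v₂ := hz0 v₂ hi
  have hadj : Adj v₂ (v₂.1 - 1, v₂.2) := Or.inr (Or.inl rfl)
  have hle := le_nbrSum hw hi hadj
  have hbox := hadj.mem_box hi
  have h0 := hw _ hbox
  have := hmin₂ (v₂.1 - 1, v₂.2) ⟨hbox, by linarith⟩
  simp only at this
  omega

end Monotone

theorem sum_Ico_delta {m n : ℕ} (v : ℤ × ℤ) {a b : ℤ} (h1 : 0 ≤ v.1 - a) (h2 : v.1 - a < m)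
    (h3 : 0 ≤ v.2 - b) (h4 : v.2 - b < n) (G : ℤ → ℤ → ℝ) :
    ∑ p ∈ Finset.Ico (0 : ℤ) m ×ˢ Finset.Ico (0 : ℤ) n, delta v (p.1 + a, p.2 + b) * G p.1 p.2
      = G (v.1 - a) (v.2 - b) := by
  rw [Finset.sum_eq_single (v.1 - a, v.2 - b)]
  · simp [delta]
  · intro p _ hp
    rw [delta, if_neg, zero_mul]
    intro h
    apply hp
    rw [← h]
    simp
  · intro h
    simp only [Finset.mem_product, Finset.mem_Ico] at h
    exact absurd ⟨⟨h1, h2⟩, h3, h4⟩ h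

/-- The stiffness matrix of the three-line mesh is the five-point discrete Laplacian. -/
theorem sum_energy_delta {m n : ℕ} {v : ℤ × ℤ} (hv : v ∈ innerNodes m n) (U : ℤ × ℤ → ℝ) :
    ∑ T ∈ grid m n, T.energy U (delta v) = 4 * U v - nbrSum U v := by
  classical
  obtain ⟨h1, h2, h3, h4⟩ := hv
  rw [grid, Finset.sum_image, Finset.sum_product]
  · have e : ∀ p : ℤ × ℤ, ∑ b : Bool, (GridTriangle.mk p.1 p.2 b).energy U (delta v) =
        delta v (p.1 + 0, p.2 + 0) * ((2 * U (p.1, p.2) - U (p.1 + 1, p.2) - U (p.1, p.2 + 1)) / 2)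
        + delta v (p.1 + 1, p.2 + 0) *
          ((2 * U (p.1 + 1, p.2) - U (p.1, p.2) - U (p.1 + 1, p.2 + 1)) / 2)
        + delta v (p.1 + 0, p.2 + 1) *
          ((2 * U (p.1, p.2 + 1) - U (p.1, p.2) - U (p.1 + 1, p.2 + 1)) / 2)
        + delta v (p.1 + 1, p.2 + 1) *
          ((2 * U (p.1 + 1, p.2 + 1) - U (p.1, p.2 + 1) - U (p.1 + 1, p.2)) / 2) := by
      intro p
      simp [GridTriangle.energy, GridTriangle.corner, GridTriangle.horizontalEnd,
        GridTriangle.verticalEnd]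
      ring
    simp only [e, Finset.sum_add_distrib]
    rw [sum_Ico_delta v (by omega) (by omega) (by omega) (by omega)
        (fun i j => (2 * U (i, j) - U (i + 1, j) - U (i, j + 1)) / 2),
      sum_Ico_delta v (by omega) (by omega) (by omega) (by omega)
        (fun i j => (2 * U (i + 1, j) - U (i, j) - U (i + 1, j + 1)) / 2),
      sum_Ico_delta v (by omega) (by omega) (by omega) (by omega)
        (fun i j => (2 * U (i, j + 1) - U (i, j) - U (i + 1, j + 1)) / 2),
      sum_Ico_delta v (by omega) (by omega) (by omega) (by omega)
        (fun i j => (2 * U (i + 1, j + 1) - U (i, j + 1) - U (i + 1, j)) / 2)]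
    simp [nbrSum]
    ring
  · rintro ⟨⟨a, b⟩, c⟩ - ⟨⟨a', b'⟩, c'⟩ - h
    simp only [GridTriangle.mk.injEq] at h
    obtain ⟨rfl, rfl, rfl⟩ := h
    rfl

/-! ### The stiffness matrix of the added vertices is monotone for small angles -/

/-- For small `t`, the stiffness matrix of the vertices `M`, `N` and `P` has a nonnegative inverse
with small entries. Multiplied by `t`, the matrix converges to the stiffness matrix of the three thin
triangles as `t` tends to zero, and the inverse of this limit is positive. -/
theorem exists_bubbleForm_inverse : ∃ t₀ : ℝ, 0 < t₀ ∧ ∀ t : ℝ, 0 < t → t < t₀ →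
    ∃ gMM gMN gMP gNN gNP gPP : ℝ, (0 ≤ gMM ∧ 0 ≤ gMN ∧ 0 ≤ gMP ∧ 0 ≤ gNN ∧ 0 ≤ gNP ∧ 0 ≤ gPP) ∧
      (gMM ≤ 1 / 500 ∧ gMN ≤ 1 / 4 ∧ gMP ≤ 1 / 4 ∧ t ≤ 1 / 2) ∧
      ∀ m n p : ℝ,
        m = gMM * bubbleForm t m n p 1 0 0 + gMN * bubbleForm t m n p 0 1 0
          + gMP * bubbleForm t m n p 0 0 1 ∧
        n = gMN * bubbleForm t m n p 1 0 0 + gNN * bubbleForm t m n p 0 1 0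
          + gNP * bubbleForm t m n p 0 0 1 ∧
        p = gMP * bubbleForm t m n p 1 0 0 + gNP * bubbleForm t m n p 0 1 0
          + gPP * bubbleForm t m n p 0 0 1 := by
  -- The matrix, multiplied by `t`, has the diagonal `a, b, d` and the off-diagonal entries
  -- `-1, -1, e`; its determinant is `D`.
  set a : ℝ → ℝ := fun t => 3 / 2 + t ^ 2 / 2 + 3 * t with ha
  set b : ℝ → ℝ := fun t => 5 / 4 + t ^ 2 / 4 + 9 * t / (4 * (4 - t)) + t * (4 - t) / 4 + 2 * t with hb
  set d : ℝ → ℝ := fun t => 5 / 4 + t ^ 2 / 4 + t / (4 * (4 - t)) + t * (4 - t) / 4 + 4 * t / (1 - t)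
    with hd
  set e : ℝ → ℝ := fun t => (1 - t ^ 2) / 4 - 3 * t / (4 * (4 - t)) - t * (4 - t) / 4 with he
  set D : ℝ → ℝ := fun t => a t * (b t * d t - e t ^ 2) - (d t - e t) - (b t - e t) with hD
  have ca : ContinuousAt a 0 := by simp only [ha]; fun_prop
  have cb : ContinuousAt b 0 := by simp only [hb]; fun_prop (disch := norm_num)
  have cd : ContinuousAt d 0 := by simp only [hd]; fun_prop (disch := norm_num)
  have ce : ContinuousAt e 0 := by simp only [he]; fun_prop (disch := norm_num)
  have cD : ContinuousAt D 0 := by simp only [hD]; fun_prop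
  have a0 : a 0 = 3 / 2 := by simp [ha]
  have b0 : b 0 = 5 / 4 := by simp [hb]
  have d0 : d 0 = 5 / 4 := by simp [hd]
  have e0 : e 0 = 1 / 4 := by simp [he]
  have pos : ∀ f : ℝ → ℝ, ContinuousAt f 0 → 0 < f 0 → ∀ᶠ t in nhds 0, 0 < f t :=
    fun f hf h => Filter.Tendsto.eventually_const_lt h hf
  have key := (pos D cD (by simp only [hD, a0, b0, d0, e0]; norm_num)).and
    ((pos (fun t => b t * d t - e t ^ 2) (by fun_prop) (by simp only [b0, d0, e0]; norm_num)).and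
    ((pos (fun t => d t - e t) (by fun_prop) (by simp only [d0, e0]; norm_num)).and
    ((pos (fun t => b t - e t) (by fun_prop) (by simp only [b0, e0]; norm_num)).and
    ((pos (fun t => a t * d t - 1) (by fun_prop) (by simp only [a0, d0]; norm_num)).and
    ((pos (fun t => 1 - a t * e t) (by fun_prop) (by simp only [a0, e0]; norm_num)).and
    ((pos (fun t => a t * b t - 1) (by fun_prop) (by simp only [a0, b0]; norm_num)).and
    ((pos (fun t => 1 / 500 * D t - t * (b t * d t - e t ^ 2)) (by fun_prop)
      (by simp only [hD, a0, b0, d0, e0]; norm_num)).and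
    ((pos (fun t => 1 / 4 * D t - t * (d t - e t)) (by fun_prop)
      (by simp only [hD, a0, b0, d0, e0]; norm_num)).and
    ((pos (fun t => 1 / 4 * D t - t * (b t - e t)) (by fun_prop)
      (by simp only [hD, a0, b0, d0, e0]; norm_num)).and
    (pos (fun t => 1 / 2 - t) (by fun_prop) (by norm_num)))))))))))
  obtain ⟨t₀, ht₀, hball⟩ := Metric.eventually_nhds_iff.1 key
  refine ⟨t₀, ht₀, fun t ht htt => ?_⟩
  obtain ⟨k1, k2, k3, k4, k5, k6, k7, k8, k9, k10, k11⟩ :=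
    @hball t (by rw [Real.dist_eq, sub_zero, abs_of_pos ht]; exact htt)
  have hD0 : D t ≠ 0 := k1.ne'
  have h4 : 4 - t ≠ 0 := by linarith
  have h1 : 1 - t ≠ 0 := by linarith
  have f1 : ∀ m n p, bubbleForm t m n p 1 0 0 = (a t * m - n - p) / t := by
    intro m n p; simp only [bubbleForm, ha]; field_simp; ring
  have f2 : ∀ m n p, bubbleForm t m n p 0 1 0 = (-m + b t * n + e t * p) / t := by
    intro m n p; simp only [bubbleForm, hb, he]; field_simp; ring
  have f3 : ∀ m n p, bubbleForm t m n p 0 0 1 = (-m + e t * n + d t * p) / t := by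
    intro m n p; simp only [bubbleForm, hd, he]; field_simp; ring
  refine ⟨t * (b t * d t - e t ^ 2) / D t, t * (d t - e t) / D t, t * (b t - e t) / D t,
    t * (a t * d t - 1) / D t, t * (1 - a t * e t) / D t, t * (a t * b t - 1) / D t,
    ⟨by positivity, by positivity, by positivity, by positivity, by positivity, by positivity⟩,
    ⟨?_, ?_, ?_, by linarith⟩, fun m n p => ?_⟩
  · rw [div_le_iff₀ k1]; linarith
  · rw [div_le_iff₀ k1]; linarith
  · rw [div_le_iff₀ k1]; linarith
  · rw [f1, f2, f3]
    clear_value a b d e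
    refine ⟨?_, ?_, ?_⟩ <;> field_simp <;> simp only [hD] <;> ring

/-! ### The parallelograms of the partitioned triangles -/

namespace EmbeddedMesh
variable {𝓜 : EmbeddedMesh}

theorem vertA_inner {T : GridTriangle} (hT : T ∈ 𝓜.partitioned) :
    𝓜.vertA T ∈ innerNodes 𝓜.m 𝓜.n := 𝓜.separated_boundary T hT _ (𝓜.vertA_mem T)

theorem vertC_inner {T : GridTriangle} (hT : T ∈ 𝓜.partitioned) :
    𝓜.vertC T ∈ innerNodes 𝓜.m 𝓜.n := 𝓜.separated_boundary T hT _ (𝓜.vertC_mem T)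

theorem corner_inner {T : GridTriangle} (hT : T ∈ 𝓜.partitioned) :
    T.corner ∈ innerNodes 𝓜.m 𝓜.n := 𝓜.separated_boundary T hT _ (corner_mem T)

theorem adj_and_ne (T : GridTriangle) : Adj (𝓜.vertA T) T.corner ∧ Adj T.corner (𝓜.vertC T) ∧
    Adj (𝓜.vertC T) (𝓜.vertA' T) ∧ 𝓜.vertA T ≠ 𝓜.vertC T ∧ 𝓜.vertA T ≠ 𝓜.vertA' T ∧
    T.corner ≠ 𝓜.vertA' T := by
  obtain ⟨i, j, b⟩ := T
  cases hv : 𝓜.vert ⟨i, j, b⟩ <;> cases b <;>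
    simp [hv, vertC, vertA, vertA', GridTriangle.corner, Adj,
      GridTriangle.horizontalEnd, GridTriangle.verticalEnd] <;> omega

variable (𝓜) in
/-- The parallelogram formed by a partitioned triangle and its bisected neighbor. -/
def quad (T : 𝓜.partitioned) : Quad 𝓜.m 𝓜.n where
  A := 𝓜.vertA T
  B := T.1.corner
  C := 𝓜.vertC T
  A' := 𝓜.vertA' T
  A_mem := vertA_inner T.2
  B_mem := corner_inner T.2
  C_mem := vertC_inner T.2
  adj_AB := (adj_and_ne T.1).1
  adj_BC := (adj_and_ne T.1).2.1
  adj_CA' := (adj_and_ne T.1).2.2.1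
  A_ne_C := (adj_and_ne T.1).2.2.2.1
  A_ne_A' := (adj_and_ne T.1).2.2.2.2.1
  B_ne_A' := (adj_and_ne T.1).2.2.2.2.2

theorem vertA'_box {T : GridTriangle} (hT : T ∈ 𝓜.partitioned) :
    𝓜.vertA' T ∈ boxNodes 𝓜.m 𝓜.n := (adj_and_ne T).2.2.1.mem_box (vertC_inner hT)

theorem near_of_has (T : 𝓜.partitioned) {v : ℤ × ℤ} (h : (𝓜.quad T).Has v) :
    (-2 ≤ T.1.i - v.1 ∧ T.1.i - v.1 ≤ 2) ∧ -2 ≤ T.1.j - v.2 ∧ T.1.j - v.2 ≤ 2 := by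
  obtain ⟨⟨i, j, b⟩, hT⟩ := T
  simp only [Quad.Has, quad] at h
  cases hv : 𝓜.vert ⟨i, j, b⟩ <;> cases b <;>
    simp [hv, vertC, vertA, vertA', GridTriangle.corner,
      GridTriangle.horizontalEnd, GridTriangle.verticalEnd, Prod.ext_iff] at h ⊢ <;> omega

open Classical in
/-- A node belongs to few parallelograms. The separation of the triangles would give a better bound,
but the position of the triangle relative to the node suffices. -/
theorem card_has_le (s : Finset 𝓜.partitioned) (v : ℤ × ℤ) :
    (s.filter fun T => (𝓜.quad T).Has v).card ≤ 50 := by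
  have hcard : ((Finset.Icc (-2 : ℤ) 2 ×ˢ Finset.Icc (-2 : ℤ) 2) ×ˢ
      (Finset.univ : Finset Bool)).card = 50 := by decide
  rw [← hcard]
  refine Finset.card_le_card_of_injOn
    (fun T => ((T.1.i - v.1, T.1.j - v.2), T.1.upper)) ?_ ?_
  · intro T hT
    obtain ⟨⟨h1, h2⟩, h3, h4⟩ := near_of_has T (Finset.mem_filter.1 hT).2
    simp only [Finset.coe_product, Finset.coe_Icc, mem_prod, mem_Icc, Finset.coe_univ, mem_univ,
      and_true]
    exact ⟨⟨h1, h2⟩, h3, h4⟩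
  · rintro ⟨⟨i, j, b⟩, hT⟩ - ⟨⟨i', j', b'⟩, hT'⟩ - h
    simp only [Prod.mk.injEq] at h
    obtain ⟨⟨h1, h2⟩, rfl⟩ := h
    have e1 : i = i' := by omega
    have e2 : j = j' := by omega
    subst e1 e2
    rfl

/-! ### Bilinearity of the Dirichlet form -/

theorem dirichletForm_add_smul {u v v' : ℝ × ℝ → ℝ} (hu : u ∈ Vh 𝓜.domain 𝓜.triangles)
    (hv : v ∈ Vh 𝓜.domain 𝓜.triangles) (hv' : v' ∈ Vh 𝓜.domain 𝓜.triangles) (r : ℝ) :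
    dirichletForm 𝓜.domain u (v + r • v') =
      dirichletForm 𝓜.domain u v + r * dirichletForm 𝓜.domain u v' := by
  rw [dirichletForm_eq hu hv, dirichletForm_eq hu hv',
    dirichletForm_eq hu (Submodule.add_mem _ hv (Submodule.smul_mem _ r hv')), mul_add,
    Finset.mul_sum, Finset.mul_sum, add_add_add_comm, ← Finset.sum_add_distrib,
    ← Finset.sum_add_distrib]
  congr 1
  · refine Finset.sum_congr rfl fun T _ => ?_
    simp only [GridTriangle.energy, nodal, Pi.add_apply, Pi.smul_apply, smul_eq_mul]
    ring
  · refine Finset.sum_congr rfl fun T _ => ?_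
    simp only [localForm, bubbleForm, devM, devN, devP, jump, nodal, Pi.add_apply, Pi.smul_apply,
      smul_eq_mul]
    ring

theorem dirichletForm_comm (D : Set (ℝ × ℝ)) (u v : ℝ × ℝ → ℝ) :
    dirichletForm D u v = dirichletForm D v u := by
  unfold dirichletForm
  congr 1
  ext x
  ring

variable (𝓜) in
/-- The Dirichlet form as a bilinear form on the finite element space. -/
noncomputable def form : Vh 𝓜.domain 𝓜.triangles →ₗ[ℝ] Vh 𝓜.domain 𝓜.triangles →ₗ[ℝ] ℝ :=
  LinearMap.mk₂ ℝ (fun u v => dirichletForm 𝓜.domain u v)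
    (fun u u' v => by
      have h := dirichletForm_add_smul v.2 u.2 u'.2 1
      simp only [one_smul, one_mul] at h
      simpa only [dirichletForm_comm _ _ (v : ℝ × ℝ → ℝ), Submodule.coe_add] using h)
    (fun r u v => by
      have h := dirichletForm_add_smul v.2 (Submodule.zero_mem _) u.2 r
      have h0 := dirichletForm_add_smul v.2 (Submodule.zero_mem _)
        (Submodule.zero_mem (Vh 𝓜.domain 𝓜.triangles)) 1
      simp only [smul_zero, add_zero, zero_add, one_mul] at h h0
      rw [smul_eq_mul, dirichletForm_comm, dirichletForm_comm _ (u : ℝ × ℝ → ℝ), Submodule.coe_smul,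
        h]
      linarith)
    (fun u v v' => by
      have h := dirichletForm_add_smul u.2 v.2 v'.2 1
      simpa only [one_smul, one_mul, Submodule.coe_add] using h)
    (fun r u v => by
      have h := dirichletForm_add_smul u.2 (Submodule.zero_mem _) v.2 r
      have h0 := dirichletForm_add_smul u.2 (Submodule.zero_mem _)
        (Submodule.zero_mem (Vh 𝓜.domain 𝓜.triangles)) 1
      simp only [smul_zero, add_zero, zero_add, one_mul] at h h0
      rw [smul_eq_mul, Submodule.coe_smul, h]
      linarith)

theorem form_apply (u v : Vh 𝓜.domain 𝓜.triangles) :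
    𝓜.form u v = dirichletForm 𝓜.domain u v := rfl

/-! ### The vertices of the mesh -/

variable (𝓜) in
/-- The added vertex `M` of a partitioned triangle. -/
noncomputable def ptM (T : GridTriangle) : ℝ × ℝ := 𝓜.refPoint T (1 / 2) 0

variable (𝓜) in
/-- The added vertex `N` of a partitioned triangle. -/
noncomputable def ptN (T : GridTriangle) : ℝ × ℝ := 𝓜.refPoint T (1 / 4) (𝓜.tanα T / 4)

variable (𝓜) in
/-- The added vertex `P` of a partitioned triangle. -/
noncomputable def ptP (T : GridTriangle) : ℝ × ℝ := 𝓜.refPoint T (3 / 4) (𝓜.tanα T / 4)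

theorem meshVertices_cases {Q : ℝ × ℝ} (hQ : Q ∈ meshVertices 𝓜.triangles) :
    (∃ v ∈ boxNodes 𝓜.m 𝓜.n, Q = 𝓜.node v) ∨
      ∃ T ∈ 𝓜.partitioned, Q = 𝓜.ptM T ∨ Q = 𝓜.ptN T ∨ Q = 𝓜.ptP T := by
  obtain ⟨K, hK, hQ⟩ := hQ
  rcases hK with hK | ⟨T, ⟨h1, h2, h3, h4⟩, -, -, rfl⟩
  · obtain ⟨T, hT, h⟩ := mem_iUnion₂.1 hK
    have hA : ∃ v ∈ boxNodes 𝓜.m 𝓜.n, 𝓜.refPoint T 0 1 = 𝓜.node v :=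
      ⟨_, innerNodes_subset _ _ (vertA_inner hT), 𝓜.refPoint_A T⟩
    have hB : ∃ v ∈ boxNodes 𝓜.m 𝓜.n, 𝓜.refPoint T 0 0 = 𝓜.node v :=
      ⟨_, innerNodes_subset _ _ (corner_inner hT), 𝓜.refPoint_B T⟩
    have hC : ∃ v ∈ boxNodes 𝓜.m 𝓜.n, 𝓜.refPoint T 1 0 = 𝓜.node v :=
      ⟨_, innerNodes_subset _ _ (vertC_inner hT), 𝓜.refPoint_C T⟩
    have hA' : ∃ v ∈ boxNodes 𝓜.m 𝓜.n, 𝓜.refPoint T 1 (-1) = 𝓜.node v :=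
      ⟨_, vertA'_box hT, 𝓜.refPoint_A' T⟩
    have hM : ∃ T ∈ 𝓜.partitioned, 𝓜.ptM T = 𝓜.ptM T ∨ 𝓜.ptM T = 𝓜.ptN T ∨ 𝓜.ptM T = 𝓜.ptP T :=
      ⟨T, hT, Or.inl rfl⟩
    simp only [localMesh, mem_insert_iff, mem_singleton_iff] at h
    have hQ' : Q = 𝓜.refPoint T 0 0 ∨ Q = 𝓜.refPoint T 1 0 ∨ Q = 𝓜.refPoint T 0 1 ∨
        Q = 𝓜.refPoint T 1 (-1) ∨ Q = 𝓜.ptM T ∨ Q = 𝓜.ptN T ∨ Q = 𝓜.ptP T := by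
      rcases h with rfl | rfl | rfl | rfl | rfl | rfl | rfl | rfl <;>
        rcases hQ with rfl | rfl | rfl <;> simp [ptM, ptN, ptP, tanα]
    rcases hQ' with rfl | rfl | rfl | rfl | h | h | h
    · exact Or.inl hB
    · exact Or.inl hC
    · exact Or.inl hA
    · exact Or.inl hA'
    · exact Or.inr ⟨T, hT, Or.inl h⟩
    · exact Or.inr ⟨T, hT, Or.inr (Or.inl h)⟩
    · exact Or.inr ⟨T, hT, Or.inr (Or.inr h)⟩
  · left
    have hbox : ∀ v ∈ T.vertices, v ∈ boxNodes 𝓜.m 𝓜.n := by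
      rcases T with ⟨i, j, _ | _⟩ <;>
        simp [GridTriangle.vertices, GridTriangle.corner, GridTriangle.horizontalEnd,
          GridTriangle.verticalEnd, boxNodes] at h1 h2 h3 h4 ⊢ <;> omega
    rcases hQ with rfl | rfl | rfl
    · exact ⟨_, hbox _ (by simp [GridTriangle.vertices]), rfl⟩
    · exact ⟨_, hbox _ (by simp [GridTriangle.vertices]), rfl⟩
    · exact ⟨_, hbox _ (by simp [GridTriangle.vertices]), rfl⟩

theorem pt_mem {T : GridTriangle} (hT : T ∈ 𝓜.partitioned) :
    𝓜.ptM T ∈ meshVertices 𝓜.triangles ∧ 𝓜.ptN T ∈ meshVertices 𝓜.triangles ∧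
      𝓜.ptP T ∈ meshVertices 𝓜.triangles := by
  refine ⟨⟨_, 𝓜.inner_mem hT 1, Or.inl rfl⟩, ⟨_, 𝓜.inner_mem hT 1, Or.inr (Or.inr rfl)⟩,
    ⟨_, 𝓜.inner_mem hT 1, Or.inr (Or.inl rfl)⟩⟩

theorem finite_meshVertices : (meshVertices 𝓜.triangles).Finite := by
  have h1 : (boxNodes 𝓜.m 𝓜.n).Finite := by
    refine ((Set.finite_Icc (0 : ℤ) 𝓜.m).prod (Set.finite_Icc (0 : ℤ) 𝓜.n)).subset ?_
    rintro v ⟨h1, h2, h3, h4⟩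
    exact ⟨⟨h1, h2⟩, h3, h4⟩
  have h2 : 𝓜.partitioned.Finite := 𝓜.chosen.finite_toSet.subset fun T hT => 𝓜.mem_chosen.2 hT
  refine ((h1.image 𝓜.node).union ((h2.image 𝓜.ptM).union
    ((h2.image 𝓜.ptN).union (h2.image 𝓜.ptP)))).subset ?_
  intro Q hQ
  rcases meshVertices_cases hQ with ⟨v, hv, rfl⟩ | ⟨T, hT, rfl | rfl | rfl⟩
  · exact Or.inl ⟨v, hv, rfl⟩
  · exact Or.inr (Or.inl ⟨T, hT, rfl⟩)
  · exact Or.inr (Or.inr (Or.inl ⟨T, hT, rfl⟩))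
  · exact Or.inr (Or.inr (Or.inr ⟨T, hT, rfl⟩))

/-- A finite element function is bounded below by its values at the vertices. -/
theorem le_of_le_vertices {u : ℝ × ℝ → ℝ} (hu : u ∈ Vh 𝓜.domain 𝓜.triangles) {c : ℝ}
    (h : ∀ Q ∈ meshVertices 𝓜.triangles, c ≤ u Q) : ∀ x ∈ closure 𝓜.domain, c ≤ u x := by
  intro x hx
  obtain ⟨K, hK, hxK⟩ := 𝓜.exists_mem_triangle hx
  obtain ⟨a, b, d, haff⟩ := hu.2.1 K hK
  have hp := h K.p ⟨K, hK, Or.inl rfl⟩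
  have hq := h K.q ⟨K, hK, Or.inr (Or.inl rfl)⟩
  have hr := h K.r ⟨K, hK, Or.inr (Or.inr rfl)⟩
  rw [haff _ K.p_mem] at hp
  rw [haff _ K.q_mem] at hq
  rw [haff _ K.r_mem] at hr
  rw [haff x hxK]
  obtain ⟨r, s, t, hr0, hs0, ht0, hsum, e1, e2⟩ := (K.mem_carrier_iff x).1 hxK
  rw [e1, e2]
  have h1 := mul_le_mul_of_nonneg_left hp hr0
  have h2 := mul_le_mul_of_nonneg_left hq hs0
  have h3 := mul_le_mul_of_nonneg_left hr ht0
  have hr' : r = 1 - s - t := by linarith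
  subst hr'
  linarith

theorem eq_zero_of_vertices {u : ℝ × ℝ → ℝ} (hu : u ∈ Vh 𝓜.domain 𝓜.triangles)
    (h : ∀ Q ∈ meshVertices 𝓜.triangles, u Q = 0) : u = 0 := by
  ext x
  by_cases hx : x ∈ closure 𝓜.domain
  · have h1 := le_of_le_vertices hu (c := 0) (fun Q hQ => (h Q hQ).ge) x hx
    have h2 := le_of_le_vertices (Submodule.neg_mem _ hu) (c := 0)
      (fun Q hQ => by simp [h Q hQ]) x hx
    simp only [Pi.neg_apply] at h2
    simp only [Pi.zero_apply]
    linarith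
  · exact hu.2.2 x hx

/-! ### The nodal basis functions of the added vertices -/

section Bubble

variable {T : GridTriangle} {β : ℝ × ℝ → ℝ}

/-- A bubble function vanishes at the grid nodes, so that its deviations are its values. -/
theorem dev_comp_refCoord (h0 : ∀ x, x ∉ refStar → β x = 0) :
    𝓜.devM T (fun x => β (𝓜.refCoord T x)) = β (1 / 2, 0) ∧
    𝓜.devN T (fun x => β (𝓜.refCoord T x)) = β (1 / 4, 𝓜.tanα T / 4) ∧
    𝓜.devP T (fun x => β (𝓜.refCoord T x)) = β (3 / 4, 𝓜.tanα T / 4) := by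
  simp [devM, devN, devP, nodal, comp_refCoord_node h0, refCoord_refPoint]

/-- The equation that results from a bubble function involves a single partitioned triangle. -/
theorem dirichletForm_bubble {u : ℝ × ℝ → ℝ} (hu : u ∈ Vh 𝓜.domain 𝓜.triangles)
    (hT : T ∈ 𝓜.partitioned) (h0 : ∀ x, x ∉ refStar → β x = 0)
    (hβ : (fun x => β (𝓜.refCoord T x)) ∈ V0 𝓜.domain 𝓜.triangles) :
    dirichletForm 𝓜.domain u (fun x => β (𝓜.refCoord T x)) =
      bubbleForm (𝓜.tanα T) (𝓜.devM T u) (𝓜.devN T u) (𝓜.devP T u)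
        (β (1 / 2, 0)) (β (1 / 4, 𝓜.tanα T / 4)) (β (3 / 4, 𝓜.tanα T / 4))
      - 1 / 2 * β (1 / 2, 0) * 𝓜.jump T (𝓜.nodal u) := by
  have hz : 𝓜.nodal (fun x => β (𝓜.refCoord T x)) = fun _ => 0 :=
    funext fun v => comp_refCoord_node h0 v
  obtain ⟨eM, eN, eP⟩ := dev_comp_refCoord (𝓜 := 𝓜) (T := T) h0
  rw [dirichletForm_eq hu hβ.1, Finset.sum_eq_zero, Finset.sum_eq_single T]
  · rw [localForm, eM, eN, eP, hz]
    simp only [jump]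
    ring
  · intro T' hT' hne
    have hT'' := 𝓜.mem_chosen.1 hT'
    obtain ⟨aM, aN, aP⟩ := added_mem hT''
    have dM : 𝓜.devM T' (fun x => β (𝓜.refCoord T x)) = 0 := by
      rw [devM, hz, comp_refCoord_of_ne hT hT'' hne h0 aM]; ring
    have dN : 𝓜.devN T' (fun x => β (𝓜.refCoord T x)) = 0 := by
      rw [devN, hz, comp_refCoord_of_ne hT hT'' hne h0 aN]; ring
    have dP : 𝓜.devP T' (fun x => β (𝓜.refCoord T x)) = 0 := by
      rw [devP, hz, comp_refCoord_of_ne hT hT'' hne h0 aP]; ring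
    rw [localForm, dM, dN, dP, hz]
    simp only [jump, bubbleForm]
    ring
  · exact fun h => absurd (𝓜.mem_chosen.2 hT) h
  · intro T' _
    rw [hz, GridTriangle.energy]
    ring

theorem bubble_of_ne (hT : T ∈ 𝓜.partitioned) (h0 : ∀ x, x ∉ refStar → β x = 0)
    {T' : GridTriangle} (hT' : T' ∈ 𝓜.partitioned) (hne : T' ≠ T) :
    β (𝓜.refCoord T (𝓜.ptM T')) = 0 ∧ β (𝓜.refCoord T (𝓜.ptN T')) = 0 ∧
      β (𝓜.refCoord T (𝓜.ptP T')) = 0 := by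
  obtain ⟨aM, aN, aP⟩ := added_mem hT'
  exact ⟨comp_refCoord_of_ne hT hT' hne h0 aM, comp_refCoord_of_ne hT hT' hne h0 aN,
    comp_refCoord_of_ne hT hT' hne h0 aP⟩

theorem isNodalAt_bubble (hT : T ∈ 𝓜.partitioned) (h0 : ∀ x, x ∉ refStar → β x = 0) {P : ℝ × ℝ}
    (hP : β (𝓜.refCoord T P) = 1)
    (hM : 𝓜.ptM T = P ∨ β (𝓜.refCoord T (𝓜.ptM T)) = 0)
    (hN : 𝓜.ptN T = P ∨ β (𝓜.refCoord T (𝓜.ptN T)) = 0)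
    (hP' : 𝓜.ptP T = P ∨ β (𝓜.refCoord T (𝓜.ptP T)) = 0) :
    IsNodalAt 𝓜.triangles P (fun x => β (𝓜.refCoord T x)) := by
  refine ⟨hP, fun Q hQ hne => ?_⟩
  rcases meshVertices_cases hQ with ⟨v, -, rfl⟩ | ⟨T', hT', h⟩
  · exact comp_refCoord_node h0 v
  by_cases hTT : T' = T
  · subst hTT
    rcases h with rfl | rfl | rfl
    · exact hM.resolve_left hne
    · exact hN.resolve_left hne
    · exact hP'.resolve_left hne
  · obtain ⟨h1, h2, h3⟩ := bubble_of_ne hT h0 hT' hTT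
    rcases h with rfl | rfl | rfl
    exacts [h1, h2, h3]

end Bubble

variable (𝓜) in
/-- The nodal basis function of the added vertex `M`. -/
noncomputable def basisM (T : GridTriangle) (x : ℝ × ℝ) : ℝ := bubbleM (𝓜.tanα T) (𝓜.refCoord T x)

variable (𝓜) in
/-- The nodal basis function of the added vertex `N`. -/
noncomputable def basisN (T : GridTriangle) (x : ℝ × ℝ) : ℝ := bubbleN (𝓜.tanα T) (𝓜.refCoord T x)

variable (𝓜) in
/-- The nodal basis function of the added vertex `P`. -/
noncomputable def basisP (T : GridTriangle) (x : ℝ × ℝ) : ℝ := bubbleP (𝓜.tanα T) (𝓜.refCoord T x)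

theorem basisM_mem {T : GridTriangle} (hT : T ∈ 𝓜.partitioned) :
    𝓜.basisM T ∈ V0 𝓜.domain 𝓜.triangles :=
  comp_refCoord_mem_V0 hT (continuous_bubbleM _)
    (fun _ => bubbleM_eq_zero (𝓜.tanα_pos hT) (𝓜.tanα_lt_one hT))
    (isAffineOn_bubbleM_inner (𝓜.tanα_pos hT) (𝓜.tanα_lt_one hT))
    (isAffineOn_bubbleM_outer (𝓜.tanα_pos hT))

theorem basisM_values {T : GridTriangle} (hT : T ∈ 𝓜.partitioned) :
    𝓜.basisM T (𝓜.ptM T) = 1 ∧ 𝓜.basisM T (𝓜.ptN T) = 0 ∧ 𝓜.basisM T (𝓜.ptP T) = 0 := by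
  have h0 := 𝓜.tanα_pos hT
  have h1 := 𝓜.tanα_lt_one hT
  simpa only [basisM, ptM, ptN, ptP, refCoord_refPoint] using bubbleM_values h0

theorem basisM_of_ne {T T' : GridTriangle} (hT : T ∈ 𝓜.partitioned)
    (hT' : T' ∈ 𝓜.partitioned) (hne : T' ≠ T) :
    𝓜.basisM T (𝓜.ptM T') = 0 ∧ 𝓜.basisM T (𝓜.ptN T') = 0 ∧ 𝓜.basisM T (𝓜.ptP T') = 0 :=
  bubble_of_ne hT (fun _ => bubbleM_eq_zero (𝓜.tanα_pos hT) (𝓜.tanα_lt_one hT)) hT' hne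

theorem basisM_node {T : GridTriangle} (hT : T ∈ 𝓜.partitioned) (v : ℤ × ℤ) :
    𝓜.basisM T (𝓜.node v) = 0 :=
  comp_refCoord_node (fun _ => bubbleM_eq_zero (𝓜.tanα_pos hT) (𝓜.tanα_lt_one hT)) v

theorem isNodalAt_basisM {T : GridTriangle} (hT : T ∈ 𝓜.partitioned) :
    IsNodalAt 𝓜.triangles (𝓜.ptM T) (𝓜.basisM T) := by
  obtain ⟨hM, hN, hP⟩ := basisM_values hT
  exact isNodalAt_bubble hT (fun _ => bubbleM_eq_zero (𝓜.tanα_pos hT) (𝓜.tanα_lt_one hT)) hM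
    (Or.inl rfl) (Or.inr hN) (Or.inr hP)

theorem dirichletForm_basisM {u : ℝ × ℝ → ℝ} (hu : u ∈ Vh 𝓜.domain 𝓜.triangles)
    {T : GridTriangle} (hT : T ∈ 𝓜.partitioned) : dirichletForm 𝓜.domain u (𝓜.basisM T) =
      bubbleForm (𝓜.tanα T) (𝓜.devM T u) (𝓜.devN T u) (𝓜.devP T u) 1 0 0 - 𝓜.jump T (𝓜.nodal u) / 2 := by
  have h0 := 𝓜.tanα_pos hT
  have h1 := 𝓜.tanα_lt_one hT
  obtain ⟨hM, hN, hP⟩ := bubbleM_values h0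
  have h := dirichletForm_bubble hu hT (fun _ => bubbleM_eq_zero h0 h1) (basisM_mem hT)
  rw [hM, hN, hP] at h
  exact h.trans (by ring)

theorem basisN_mem {T : GridTriangle} (hT : T ∈ 𝓜.partitioned) :
    𝓜.basisN T ∈ V0 𝓜.domain 𝓜.triangles :=
  comp_refCoord_mem_V0 hT (continuous_bubbleN _)
    (fun _ => bubbleN_eq_zero (𝓜.tanα_pos hT) (𝓜.tanα_lt_one hT))
    (isAffineOn_bubbleN_inner (𝓜.tanα_pos hT) (𝓜.tanα_lt_one hT))
    (isAffineOn_bubbleN_outer (𝓜.tanα_pos hT))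

theorem basisN_values {T : GridTriangle} (hT : T ∈ 𝓜.partitioned) :
    𝓜.basisN T (𝓜.ptM T) = 0 ∧ 𝓜.basisN T (𝓜.ptN T) = 1 ∧ 𝓜.basisN T (𝓜.ptP T) = 0 := by
  have h0 := 𝓜.tanα_pos hT
  have h1 := 𝓜.tanα_lt_one hT
  simpa only [basisN, ptM, ptN, ptP, refCoord_refPoint] using bubbleN_values h0 h1

theorem basisN_of_ne {T T' : GridTriangle} (hT : T ∈ 𝓜.partitioned)
    (hT' : T' ∈ 𝓜.partitioned) (hne : T' ≠ T) :
    𝓜.basisN T (𝓜.ptM T') = 0 ∧ 𝓜.basisN T (𝓜.ptN T') = 0 ∧ 𝓜.basisN T (𝓜.ptP T') = 0 :=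
  bubble_of_ne hT (fun _ => bubbleN_eq_zero (𝓜.tanα_pos hT) (𝓜.tanα_lt_one hT)) hT' hne

theorem basisN_node {T : GridTriangle} (hT : T ∈ 𝓜.partitioned) (v : ℤ × ℤ) :
    𝓜.basisN T (𝓜.node v) = 0 :=
  comp_refCoord_node (fun _ => bubbleN_eq_zero (𝓜.tanα_pos hT) (𝓜.tanα_lt_one hT)) v

theorem isNodalAt_basisN {T : GridTriangle} (hT : T ∈ 𝓜.partitioned) :
    IsNodalAt 𝓜.triangles (𝓜.ptN T) (𝓜.basisN T) := by
  obtain ⟨hM, hN, hP⟩ := basisN_values hT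
  exact isNodalAt_bubble hT (fun _ => bubbleN_eq_zero (𝓜.tanα_pos hT) (𝓜.tanα_lt_one hT)) hN
    (Or.inr hM) (Or.inl rfl) (Or.inr hP)

theorem dirichletForm_basisN {u : ℝ × ℝ → ℝ} (hu : u ∈ Vh 𝓜.domain 𝓜.triangles)
    {T : GridTriangle} (hT : T ∈ 𝓜.partitioned) : dirichletForm 𝓜.domain u (𝓜.basisN T) =
      bubbleForm (𝓜.tanα T) (𝓜.devM T u) (𝓜.devN T u) (𝓜.devP T u) 0 1 0 := by
  have h0 := 𝓜.tanα_pos hT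
  have h1 := 𝓜.tanα_lt_one hT
  obtain ⟨hM, hN, hP⟩ := bubbleN_values h0 h1
  have h := dirichletForm_bubble hu hT (fun _ => bubbleN_eq_zero h0 h1) (basisN_mem hT)
  rw [hM, hN, hP] at h
  exact h.trans (by ring)

theorem basisP_mem {T : GridTriangle} (hT : T ∈ 𝓜.partitioned) :
    𝓜.basisP T ∈ V0 𝓜.domain 𝓜.triangles :=
  comp_refCoord_mem_V0 hT (continuous_bubbleP _)
    (fun _ => bubbleP_eq_zero (𝓜.tanα_pos hT) (𝓜.tanα_lt_one hT))
    (isAffineOn_bubbleP_inner (𝓜.tanα_pos hT) (𝓜.tanα_lt_one hT))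
    (isAffineOn_bubbleP_outer (𝓜.tanα_pos hT))

theorem basisP_values {T : GridTriangle} (hT : T ∈ 𝓜.partitioned) :
    𝓜.basisP T (𝓜.ptM T) = 0 ∧ 𝓜.basisP T (𝓜.ptN T) = 0 ∧ 𝓜.basisP T (𝓜.ptP T) = 1 := by
  have h0 := 𝓜.tanα_pos hT
  have h1 := 𝓜.tanα_lt_one hT
  simpa only [basisP, ptM, ptN, ptP, refCoord_refPoint] using bubbleP_values h0 h1

theorem basisP_of_ne {T T' : GridTriangle} (hT : T ∈ 𝓜.partitioned)
    (hT' : T' ∈ 𝓜.partitioned) (hne : T' ≠ T) :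
    𝓜.basisP T (𝓜.ptM T') = 0 ∧ 𝓜.basisP T (𝓜.ptN T') = 0 ∧ 𝓜.basisP T (𝓜.ptP T') = 0 :=
  bubble_of_ne hT (fun _ => bubbleP_eq_zero (𝓜.tanα_pos hT) (𝓜.tanα_lt_one hT)) hT' hne

theorem basisP_node {T : GridTriangle} (hT : T ∈ 𝓜.partitioned) (v : ℤ × ℤ) :
    𝓜.basisP T (𝓜.node v) = 0 :=
  comp_refCoord_node (fun _ => bubbleP_eq_zero (𝓜.tanα_pos hT) (𝓜.tanα_lt_one hT)) v

theorem isNodalAt_basisP {T : GridTriangle} (hT : T ∈ 𝓜.partitioned) :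
    IsNodalAt 𝓜.triangles (𝓜.ptP T) (𝓜.basisP T) := by
  obtain ⟨hM, hN, hP⟩ := basisP_values hT
  exact isNodalAt_bubble hT (fun _ => bubbleP_eq_zero (𝓜.tanα_pos hT) (𝓜.tanα_lt_one hT)) hP
    (Or.inr hM) (Or.inr hN) (Or.inl rfl)

theorem dirichletForm_basisP {u : ℝ × ℝ → ℝ} (hu : u ∈ Vh 𝓜.domain 𝓜.triangles)
    {T : GridTriangle} (hT : T ∈ 𝓜.partitioned) : dirichletForm 𝓜.domain u (𝓜.basisP T) =
      bubbleForm (𝓜.tanα T) (𝓜.devM T u) (𝓜.devN T u) (𝓜.devP T u) 0 0 1 := by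
  have h0 := 𝓜.tanα_pos hT
  have h1 := 𝓜.tanα_lt_one hT
  obtain ⟨hM, hN, hP⟩ := bubbleP_values h0 h1
  have h := dirichletForm_bubble hu hT (fun _ => bubbleP_eq_zero h0 h1) (basisP_mem hT)
  rw [hM, hN, hP] at h
  exact h.trans (by ring)

theorem node_mem_meshVertices {v : ℤ × ℤ} (hv : v ∈ innerNodes 𝓜.m 𝓜.n) :
    𝓜.node v ∈ meshVertices 𝓜.triangles := by
  obtain ⟨v1, v2, v3, v4⟩ := hv
  have hT : GridTriangle.InGrid 𝓜.m 𝓜.n ⟨v.1, v.2, false⟩ := ⟨v1.le, v2, v3.le, v4⟩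
  have hc : GridTriangle.corner ⟨v.1, v.2, false⟩ = v := rfl
  by_cases h1 : (⟨v.1, v.2, false⟩ : GridTriangle) ∈ 𝓜.partitioned
  · refine ⟨_, 𝓜.inner_mem h1 0, Or.inl ?_⟩
    rw [← hc]
    exact (𝓜.refPoint_B _).symm
  by_cases h2 : ∃ T' ∈ 𝓜.partitioned, (⟨v.1, v.2, false⟩ : GridTriangle) = 𝓜.nbr T'
  · obtain ⟨T', hT', h⟩ := h2
    refine ⟨_, 𝓜.inner_mem hT' 2, Or.inr (Or.inl ?_)⟩
    rw [h, corner_nbr] at hc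
    rw [← hc]
    exact (𝓜.refPoint_C _).symm
  · push Not at h2
    exact ⟨_, 𝓜.plain_mem hT h1 h2, Or.inl (congrArg 𝓜.node hc.symm)⟩

/-! ### The nodal basis functions of the grid nodes -/

variable (𝓜) in
/-- The part of the hat function of a grid node that is spanned by the basis functions of the
vertices added to the triangle `T`. -/
noncomputable def hatPart (v : ℤ × ℤ) (T : GridTriangle) : ℝ × ℝ → ℝ :=
  𝓜.hat v (𝓜.ptM T) • 𝓜.basisM T + 𝓜.hat v (𝓜.ptN T) • 𝓜.basisN T
    + 𝓜.hat v (𝓜.ptP T) • 𝓜.basisP T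

theorem hatPart_mem (v : ℤ × ℤ) {T : GridTriangle} (hT : T ∈ 𝓜.partitioned) :
    𝓜.hatPart v T ∈ V0 𝓜.domain 𝓜.triangles :=
  Submodule.add_mem _ (Submodule.add_mem _ (Submodule.smul_mem _ _ (basisM_mem hT))
    (Submodule.smul_mem _ _ (basisN_mem hT))) (Submodule.smul_mem _ _ (basisP_mem hT))

theorem dirichletForm_hatPart {u : ℝ × ℝ → ℝ} (hu : u ∈ Vh 𝓜.domain 𝓜.triangles) (v : ℤ × ℤ)
    {T : GridTriangle} (hT : T ∈ 𝓜.partitioned) :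
    dirichletForm 𝓜.domain u (𝓜.hatPart v T) =
      𝓜.hat v (𝓜.ptM T) * dirichletForm 𝓜.domain u (𝓜.basisM T)
      + 𝓜.hat v (𝓜.ptN T) * dirichletForm 𝓜.domain u (𝓜.basisN T)
      + 𝓜.hat v (𝓜.ptP T) * dirichletForm 𝓜.domain u (𝓜.basisP T) := by
  have hM := (basisM_mem hT).1
  have hN := (basisN_mem hT).1
  have hP := (basisP_mem hT).1
  change 𝓜.form ⟨u, hu⟩ (𝓜.hat v (𝓜.ptM T) • ⟨_, hM⟩ + 𝓜.hat v (𝓜.ptN T) • ⟨_, hN⟩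
    + 𝓜.hat v (𝓜.ptP T) • ⟨_, hP⟩) = _
  rw [map_add, map_add, map_smul, map_smul, map_smul]
  rfl

theorem dirichletForm_sub_sum {u w : ℝ × ℝ → ℝ} (hu : u ∈ Vh 𝓜.domain 𝓜.triangles)
    (hw : w ∈ Vh 𝓜.domain 𝓜.triangles) {ψ : GridTriangle → ℝ × ℝ → ℝ} (s : Finset GridTriangle)
    (hψ : ∀ T ∈ s, ψ T ∈ Vh 𝓜.domain 𝓜.triangles) :
    dirichletForm 𝓜.domain u (w - ∑ T ∈ s, ψ T) =
      dirichletForm 𝓜.domain u w - ∑ T ∈ s, dirichletForm 𝓜.domain u (ψ T) := by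
  have h : 𝓜.form ⟨u, hu⟩ (⟨w, hw⟩ - ∑ T ∈ s.attach, ⟨ψ T, hψ T T.2⟩) =
      𝓜.form ⟨u, hu⟩ ⟨w, hw⟩ - ∑ T ∈ s.attach, 𝓜.form ⟨u, hu⟩ ⟨ψ T, hψ T T.2⟩ := by
    rw [map_sub, map_sum]
  simp only [form_apply, Submodule.coe_sub, Submodule.coe_sum] at h
  rwa [Finset.sum_attach s fun T => ψ T,
    Finset.sum_attach s fun T => dirichletForm 𝓜.domain u (ψ T)] at h

variable (𝓜) in
/-- The nodal basis function of a grid node. The hat function of the three-line mesh does not vanish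
at the added vertices, where it has to be corrected. -/
noncomputable def basis (v : ℤ × ℤ) : ℝ × ℝ → ℝ := 𝓜.hat v - ∑ T ∈ 𝓜.chosen, 𝓜.hatPart v T

theorem basis_mem {v : ℤ × ℤ} (hv : v ∈ innerNodes 𝓜.m 𝓜.n) :
    𝓜.basis v ∈ V0 𝓜.domain 𝓜.triangles :=
  Submodule.sub_mem _ (hat_mem_V0 hv)
    (Submodule.sum_mem _ fun _ hT => hatPart_mem v (𝓜.mem_chosen.1 hT))

theorem isNodalAt_basis (v : ℤ × ℤ) : IsNodalAt 𝓜.triangles (𝓜.node v) (𝓜.basis v) := by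
  have hnode : ∀ w, 𝓜.basis v (𝓜.node w) = if w = v then 1 else 0 := by
    intro w
    rw [basis, Pi.sub_apply, Finset.sum_apply, Finset.sum_eq_zero, hat_node, sub_zero]
    intro T hT
    have hT := 𝓜.mem_chosen.1 hT
    simp [hatPart, basisM_node hT, basisN_node hT, basisP_node hT]
  refine ⟨by rw [hnode, if_pos rfl], fun Q hQ hne => ?_⟩
  rcases meshVertices_cases hQ with ⟨w, -, rfl⟩ | ⟨T, hT, h⟩
  · rw [hnode, if_neg]
    rintro rfl
    exact hne rfl
  · obtain ⟨mm, mn, mp⟩ := basisM_values hT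
    obtain ⟨nm, nn, np⟩ := basisN_values hT
    obtain ⟨pm, pn, pp⟩ := basisP_values hT
    have hsum : ∀ Q, Q = 𝓜.ptM T ∨ Q = 𝓜.ptN T ∨ Q = 𝓜.ptP T →
        (∑ T' ∈ 𝓜.chosen, 𝓜.hatPart v T') Q = 𝓜.hatPart v T Q := by
      intro Q hQ
      rw [Finset.sum_apply]
      refine Finset.sum_eq_single T (fun T' hT' hne => ?_)
        fun h => absurd (𝓜.mem_chosen.2 hT) h
      have hT' := 𝓜.mem_chosen.1 hT'
      obtain ⟨a1, a2, a3⟩ := basisM_of_ne hT' hT hne.symm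
      obtain ⟨b1, b2, b3⟩ := basisN_of_ne hT' hT hne.symm
      obtain ⟨c1, c2, c3⟩ := basisP_of_ne hT' hT hne.symm
      rcases hQ with rfl | rfl | rfl <;> simp [hatPart, *]
    rw [basis, Pi.sub_apply, hsum Q h]
    rcases h with rfl | rfl | rfl <;> simp [hatPart, *]

/-- Hat functions have no deviations, so that only the five-point form and the coupling with the
deviations at the vertices `M` remain. -/
theorem dirichletForm_hat {u : ℝ × ℝ → ℝ} (hu : u ∈ Vh 𝓜.domain 𝓜.triangles) {v : ℤ × ℤ}
    (hv : v ∈ innerNodes 𝓜.m 𝓜.n) : dirichletForm 𝓜.domain u (𝓜.hat v) =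
      4 * 𝓜.nodal u v - nbrSum (𝓜.nodal u) v
        - ∑ T ∈ 𝓜.chosen, 1 / 2 * 𝓜.devM T u * 𝓜.jump T (delta v) := by
  have hz : 𝓜.nodal (𝓜.hat v) = delta v := funext fun w => hat_node v w
  rw [dirichletForm_eq hu (hat_mem_V0 hv).1, hz, sum_energy_delta hv, sub_eq_add_neg _ (∑ _ ∈ _, _),
    ← Finset.sum_neg_distrib]
  congr 1
  refine Finset.sum_congr rfl fun T hT => ?_
  obtain ⟨h1, h2, h3⟩ := dev_eq_zero (𝓜.mem_chosen.1 hT) (isAffineOn_hat v T)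
  rw [localForm, h1, h2, h3, hz, bubbleForm]
  ring

/-- The hat function of a grid node at the vertices added to a partitioned triangle. -/
theorem hat_added (v : ℤ × ℤ) {T : GridTriangle} (hT : T ∈ 𝓜.partitioned) :
    𝓜.hat v (𝓜.ptM T) = (delta v T.corner + delta v (𝓜.vertC T)) / 2 ∧
    𝓜.hat v (𝓜.ptN T) = (3 / 4 - 𝓜.tanα T / 4) * delta v T.corner
      + 1 / 4 * delta v (𝓜.vertC T) + 𝓜.tanα T / 4 * delta v (𝓜.vertA T) ∧
    𝓜.hat v (𝓜.ptP T) = (1 / 4 - 𝓜.tanα T / 4) * delta v T.corner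
      + 3 / 4 * delta v (𝓜.vertC T) + 𝓜.tanα T / 4 * delta v (𝓜.vertA T) := by
  have hz : 𝓜.nodal (𝓜.hat v) = delta v := funext fun w => hat_node v w
  obtain ⟨h1, h2, h3⟩ := dev_eq_zero hT (isAffineOn_hat v T)
  rw [devM, hz, sub_eq_zero] at h1
  rw [devN, hz, sub_eq_zero] at h2
  rw [devP, hz, sub_eq_zero] at h3
  exact ⟨h1, h2, h3⟩

/-! ### The maximum principle -/

theorem delta_nonneg (v l : ℤ × ℤ) : 0 ≤ delta v l := by
  unfold delta
  split_ifs <;> norm_num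

theorem frontier_of_boxNodes {v : ℤ × ℤ} (hv : v ∈ boxNodes 𝓜.m 𝓜.n)
    (hv' : v ∉ innerNodes 𝓜.m 𝓜.n) : 𝓜.node v ∈ frontier 𝓜.domain := by
  rw [mem_frontier_iff, mem_closure_iff, mem_domain_iff, gridCoord_node]
  dsimp only
  obtain ⟨h1, h2, h3, h4⟩ := hv
  refine ⟨⟨⟨?_, ?_⟩, ?_, ?_⟩, fun h => hv' ?_⟩
  · exact_mod_cast h1
  · exact_mod_cast h2
  · exact_mod_cast h3
  · exact_mod_cast h4
  · obtain ⟨⟨k1, k2⟩, k3, k4⟩ := h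
    refine ⟨?_, ?_, ?_, ?_⟩
    · exact_mod_cast k1
    · exact_mod_cast k2
    · exact_mod_cast k3
    · exact_mod_cast k4

/-- The maximum principle holds on the mesh: a discretely superharmonic finite element function is
bounded below by its boundary values. -/
def HasMaxPrinciple (𝓜 : EmbeddedMesh) : Prop :=
  ∀ u ∈ Vh 𝓜.domain 𝓜.triangles,
    (∀ P ∈ meshVertices 𝓜.triangles, ∀ φ ∈ V0 𝓜.domain 𝓜.triangles,
      IsNodalAt 𝓜.triangles P φ → 0 ≤ dirichletForm 𝓜.domain u φ) →
    ∀ c : ℝ, (∀ x ∈ frontier 𝓜.domain, c ≤ u x) → ∀ x ∈ closure 𝓜.domain, c ≤ u x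

/-- The maximum principle holds if the added triangles are thin. The equations at the added vertices
express the deviations from linear interpolation by `½ s_T` with nonnegative coefficients; inserted
into the equations at the grid nodes, they yield the perturbed five-point equation. -/
theorem exists_hasMaxPrinciple : ∃ t₀ : ℝ, 0 < t₀ ∧ ∀ 𝓜 : EmbeddedMesh,
    (∀ T ∈ 𝓜.partitioned, 𝓜.tanα T < t₀) → 𝓜.HasMaxPrinciple := by
  obtain ⟨t₀, ht₀, hG⟩ := exists_bubbleForm_inverse
  refine ⟨t₀, ht₀, fun 𝓜 hα u hu hnn c hc => ?_⟩
  choose gMM gMN gMP gNN gNP gPP hG using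
    fun T : 𝓜.partitioned => hG _ (𝓜.tanα_pos T.2) (hα T.1 T.2)
  have fM : ∀ T : 𝓜.partitioned, 0 ≤ dirichletForm 𝓜.domain u (𝓜.basisM T) := fun T =>
    hnn _ (pt_mem T.2).1 _ (basisM_mem T.2) (isNodalAt_basisM T.2)
  have fN : ∀ T : 𝓜.partitioned, 0 ≤ dirichletForm 𝓜.domain u (𝓜.basisN T) := fun T =>
    hnn _ (pt_mem T.2).2.1 _ (basisN_mem T.2) (isNodalAt_basisN T.2)
  have fP : ∀ T : 𝓜.partitioned, 0 ≤ dirichletForm 𝓜.domain u (𝓜.basisP T) := fun T =>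
    hnn _ (pt_mem T.2).2.2 _ (basisP_mem T.2) (isNodalAt_basisP T.2)
  -- The deviations at the added vertices in terms of the values of the form.
  have hdev : ∀ T : 𝓜.partitioned,
      𝓜.devM T u = gMM T * (dirichletForm 𝓜.domain u (𝓜.basisM T) + 𝓜.jump T (𝓜.nodal u) / 2)
        + gMN T * dirichletForm 𝓜.domain u (𝓜.basisN T)
        + gMP T * dirichletForm 𝓜.domain u (𝓜.basisP T) ∧
      𝓜.devN T u = gMN T * (dirichletForm 𝓜.domain u (𝓜.basisM T) + 𝓜.jump T (𝓜.nodal u) / 2)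
        + gNN T * dirichletForm 𝓜.domain u (𝓜.basisN T)
        + gNP T * dirichletForm 𝓜.domain u (𝓜.basisP T) ∧
      𝓜.devP T u = gMP T * (dirichletForm 𝓜.domain u (𝓜.basisM T) + 𝓜.jump T (𝓜.nodal u) / 2)
        + gNP T * dirichletForm 𝓜.domain u (𝓜.basisN T)
        + gPP T * dirichletForm 𝓜.domain u (𝓜.basisP T) := by
    intro T
    rw [dirichletForm_basisM hu T.2, dirichletForm_basisN hu T.2, dirichletForm_basisP hu T.2,
      sub_add_cancel]
    exact (hG T).2.2 _ _ _
  -- The values at the grid nodes form a supersolution of a perturbed five-point equation.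
  have hnodes : ∀ v ∈ boxNodes 𝓜.m 𝓜.n, c ≤ 𝓜.nodal u v := by
    classical
    refine le_of_perturbed_superharmonic (𝓜.chosen.subtype (· ∈ 𝓜.partitioned)) 𝓜.quad
      (fun T => gMM T / 4) (fun T _ => ?_) (fun T _ => ?_) (card_has_le _)
      (fun v hv hv' => hc _ (frontier_of_boxNodes hv hv')) (fun v hv => ?_)
    · have := (hG T).1.1
      positivity
    · have := (hG T).2.1.1
      linarith
    have h := hnn _ (node_mem_meshVertices hv) _ (basis_mem hv) (isNodalAt_basis v)
    rw [basis, dirichletForm_sub_sum hu (hat_mem_V0 hv).1 _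
      (fun T hT => (hatPart_mem v (𝓜.mem_chosen.1 hT)).1), dirichletForm_hat hu hv, sub_sub,
      ← Finset.sum_add_distrib] at h
    refine h.trans (sub_le_sub_left ?_ _)
    have hsub := Finset.sum_subtype_of_mem (p := (· ∈ 𝓜.partitioned)) (s := 𝓜.chosen)
      (fun T => 1 / 2 * 𝓜.devM T u * 𝓜.jump T (delta v)
        + dirichletForm 𝓜.domain u (𝓜.hatPart v T)) (fun T hT => 𝓜.mem_chosen.1 hT)
    rw [← hsub]
    refine Finset.sum_le_sum fun T _ => ?_
    obtain ⟨⟨n1, n2, n3, -, -, -⟩, ⟨b1, b2, b3, b4⟩, -⟩ := hG T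
    have ht := 𝓜.tanα_pos T.2
    obtain ⟨eM, eN, eP⟩ := hat_added v T.2
    rw [dirichletForm_hatPart hu v T.2, (hdev T).1, eM, eN, eP]
    change gMM T / 4 * (𝓜.jump T (delta v) * 𝓜.jump T (𝓜.nodal u)) ≤ _
    generalize 𝓜.jump T (𝓜.nodal u) = j
    have hA : 0 ≤ delta v (𝓜.vertA T) := delta_nonneg _ _
    have hA' : 0 ≤ delta v (𝓜.vertA' T) := delta_nonneg _ _
    have hB : 0 ≤ delta v T.1.corner := delta_nonneg _ _
    have hC : 0 ≤ delta v (𝓜.vertC T) := delta_nonneg _ _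
    simp only [jump]
    generalize delta v (𝓜.vertA T) = dA at *
    generalize delta v (𝓜.vertA' T) = dA' at *
    generalize delta v T.1.corner = dB at *
    generalize delta v (𝓜.vertC T) = dC at *
    generalize 𝓜.tanα T = t at *
    have k1 : 0 ≤ gMM T * (dA + dA' - dB - dC) / 2 + (dB + dC) / 2 := by
      nlinarith [mul_nonneg n1 hA, mul_nonneg n1 hA']
    have k2 : 0 ≤ gMN T * (dA + dA' - dB - dC) / 2
        + ((3 / 4 - t / 4) * dB + 1 / 4 * dC + t / 4 * dA) := by
      nlinarith [mul_nonneg n2 hA, mul_nonneg n2 hA', mul_nonneg ht.le hA,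
        mul_nonneg hB (sub_nonneg.2 b2), mul_nonneg hC (sub_nonneg.2 b2),
        mul_nonneg hB (sub_nonneg.2 b4)]
    have k3 : 0 ≤ gMP T * (dA + dA' - dB - dC) / 2
        + ((1 / 4 - t / 4) * dB + 3 / 4 * dC + t / 4 * dA) := by
      nlinarith [mul_nonneg n3 hA, mul_nonneg n3 hA', mul_nonneg ht.le hA,
        mul_nonneg hB (sub_nonneg.2 b3), mul_nonneg hC (sub_nonneg.2 b3),
        mul_nonneg hB (sub_nonneg.2 b4)]
    have l1 := mul_nonneg k1 (fM T)
    have l2 := mul_nonneg k2 (fN T)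
    have l3 := mul_nonneg k3 (fP T)
    linarith
  refine le_of_le_vertices hu fun Q hQ => ?_
  rcases meshVertices_cases hQ with ⟨v, hv, rfl⟩ | ⟨T, hT, hQ⟩
  · exact hnodes v hv
  obtain ⟨dM, dN, dP⟩ := hdev ⟨T, hT⟩
  obtain ⟨⟨n1, n2, n3, n4, n5, n6⟩, ⟨b1, b2, b3, b4⟩, -⟩ := hG ⟨T, hT⟩
  have ht := 𝓜.tanα_pos hT
  have m1 := fM ⟨T, hT⟩
  have m2 := fN ⟨T, hT⟩
  have m3 := fP ⟨T, hT⟩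
  have hA := sub_nonneg.2 (hnodes _ (innerNodes_subset _ _ (vertA_inner hT)))
  have hB := sub_nonneg.2 (hnodes _ (innerNodes_subset _ _ (corner_inner hT)))
  have hC := sub_nonneg.2 (hnodes _ (innerNodes_subset _ _ (vertC_inner hT)))
  have hA' := sub_nonneg.2 (hnodes _ (vertA'_box hT))
  simp only at dM dN dP m1 m2 m3
  simp only [devM, devN, devP, jump] at dM dN dP
  rw [sub_eq_iff_eq_add] at dM dN dP
  generalize 𝓜.nodal u (𝓜.vertA T) = dA at *
  generalize 𝓜.nodal u (𝓜.vertA' T) = dA' at *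
  generalize 𝓜.nodal u T.corner = dB at *
  generalize 𝓜.nodal u (𝓜.vertC T) = dC at *
  rcases hQ with rfl | rfl | rfl
  · rw [ptM, dM, ← sub_nonneg]
    generalize 𝓜.tanα T = t at *
    nlinarith [mul_nonneg n1 m1, mul_nonneg n2 m2, mul_nonneg n3 m3, mul_nonneg n1 hA,
      mul_nonneg n1 hA', mul_nonneg hB (sub_nonneg.2 b1), mul_nonneg hC (sub_nonneg.2 b1)]
  · rw [ptN, dN, ← sub_nonneg]
    generalize 𝓜.tanα T = t at *
    nlinarith [mul_nonneg n2 m1, mul_nonneg n4 m2, mul_nonneg n5 m3, mul_nonneg n2 hA,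
      mul_nonneg n2 hA', mul_nonneg hB (sub_nonneg.2 b2), mul_nonneg hC (sub_nonneg.2 b2),
      mul_nonneg ht.le hA, mul_nonneg hB (sub_nonneg.2 b4)]
  · rw [ptP, dP, ← sub_nonneg]
    generalize 𝓜.tanα T = t at *
    nlinarith [mul_nonneg n3 m1, mul_nonneg n5 m2, mul_nonneg n6 m3, mul_nonneg n3 hA,
      mul_nonneg n3 hA', mul_nonneg hB (sub_nonneg.2 b3), mul_nonneg hC (sub_nonneg.2 b3),
      mul_nonneg ht.le hA, mul_nonneg hB (sub_nonneg.2 b4)]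

/-! ### The solution operator -/

theorem finite_V0 : Module.Finite ℝ (V0 𝓜.domain 𝓜.triangles) := by
  have := (finite_meshVertices (𝓜 := 𝓜)).to_subtype
  refine Module.Finite.of_injective ((LinearMap.funLeft ℝ ℝ
    (Subtype.val : meshVertices 𝓜.triangles → ℝ × ℝ)).comp (V0 𝓜.domain 𝓜.triangles).subtype)
    ((injective_iff_map_eq_zero _).2 fun w hw => ?_)
  exact Subtype.ext (eq_zero_of_vertices w.2.1 fun Q hQ => congrFun hw ⟨Q, hQ⟩)

variable (𝓜) in
/-- The linear operator of the finite element equations with homogeneous boundary values. -/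
noncomputable def stiffness :
    V0 𝓜.domain 𝓜.triangles →ₗ[ℝ] Module.Dual ℝ (V0 𝓜.domain 𝓜.triangles) :=
  let ι := Submodule.inclusion fun (u : ℝ × ℝ → ℝ) (hu : u ∈ V0 𝓜.domain 𝓜.triangles) => hu.1
  𝓜.form.compl₁₂ ι ι

/-- The maximum principle for `w` and `-w` shows that the homogeneous problem has no nontrivial
solution. -/
theorem HasMaxPrinciple.eq_zero (h : 𝓜.HasMaxPrinciple) {w : V0 𝓜.domain 𝓜.triangles}
    (hw : 𝓜.stiffness w = 0) : w = 0 := by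
  have key : ∀ w : V0 𝓜.domain 𝓜.triangles, 𝓜.stiffness w = 0 →
      ∀ x ∈ closure 𝓜.domain, 0 ≤ (w : ℝ × ℝ → ℝ) x := fun w hw =>
    h w w.2.1 (fun P _ φ hφ _ => (LinearMap.congr_fun hw ⟨φ, hφ⟩).ge) 0
      fun x hx => (w.2.2 x hx).ge
  ext x
  by_cases hx : x ∈ closure 𝓜.domain
  · have h1 := key w hw x hx
    have h2 := key (-w) (by rw [map_neg, hw, neg_zero]) x hx
    simp only [Submodule.coe_neg, Pi.neg_apply] at h2
    simp only [Submodule.coe_zero, Pi.zero_apply]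
    linarith
  · exact w.2.1.2.2 x hx

theorem HasMaxPrinciple.bijective (h : 𝓜.HasMaxPrinciple) : Function.Bijective 𝓜.stiffness := by
  have := finite_V0 (𝓜 := 𝓜)
  have hinj : Function.Injective 𝓜.stiffness :=
    (injective_iff_map_eq_zero _).2 fun _ => h.eq_zero
  exact ⟨hinj, (LinearMap.injective_iff_surjective_of_finrank_eq_finrank
    Subspace.dual_finrank_eq.symm).1 hinj⟩

/-- The maximum principle implies that the finite element equations are uniquely solvable. -/
theorem HasMaxPrinciple.existsUnique (h : 𝓜.HasMaxPrinciple)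
    (f : Module.Dual ℝ (V0 𝓜.domain 𝓜.triangles)) (ub : VhBoundary 𝓜.domain 𝓜.triangles) :
    ∃! u : Vh 𝓜.domain 𝓜.triangles,
      (∀ x : frontier 𝓜.domain, (u : ℝ × ℝ → ℝ) x = (ub : frontier 𝓜.domain → ℝ) x) ∧
        ∀ v : V0 𝓜.domain 𝓜.triangles,
          dirichletForm 𝓜.domain (u : ℝ × ℝ → ℝ) (v : ℝ × ℝ → ℝ) = f v := by
  obtain ⟨u₀, hu₀, hub⟩ := ub.2
  let ι := Submodule.inclusion fun (u : ℝ × ℝ → ℝ) (hu : u ∈ V0 𝓜.domain 𝓜.triangles) => hu.1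
  obtain ⟨w, hw⟩ := h.bijective.2 (f - (𝓜.form ⟨u₀, hu₀⟩).comp ι)
  refine ⟨⟨u₀, hu₀⟩ + ι w, ⟨fun x => ?_, fun v => ?_⟩, ?_⟩
  · have h0 := w.2.2 x x.2
    have h1 := congrFun hub x
    simp only [LinearMap.funLeft_apply] at h1
    rw [← h1]
    simp [ι, h0]
  · have h1 := LinearMap.congr_fun hw v
    have h2 := LinearMap.congr_fun (map_add 𝓜.form ⟨u₀, hu₀⟩ (ι w)) (ι v)
    change dirichletForm 𝓜.domain w v = f v - dirichletForm 𝓜.domain u₀ v at h1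
    change _ = dirichletForm 𝓜.domain u₀ v + dirichletForm 𝓜.domain w v at h2
    rw [h1, add_sub_cancel] at h2
    exact h2
  · rintro u ⟨hu1, hu2⟩
    have hmem : (u : ℝ × ℝ → ℝ) - u₀ ∈ V0 𝓜.domain 𝓜.triangles := by
      refine ⟨Submodule.sub_mem _ u.2 hu₀, fun x hx => ?_⟩
      have h1 := congrFun hub ⟨x, hx⟩
      simp only [LinearMap.funLeft_apply] at h1
      rw [Pi.sub_apply, h1, hu1 ⟨x, hx⟩, sub_self]
    have hsol : 𝓜.stiffness ⟨_, hmem⟩ = 𝓜.stiffness w := by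
      rw [hw]
      ext v
      have h2 := LinearMap.congr_fun (map_sub 𝓜.form u ⟨u₀, hu₀⟩) (ι v)
      change _ = dirichletForm 𝓜.domain u v - dirichletForm 𝓜.domain u₀ v at h2
      rw [hu2] at h2
      exact h2
    have := congrArg Subtype.val (h.bijective.1 hsol)
    refine Subtype.ext ?_
    exact sub_eq_iff_eq_add'.1 this

theorem frontier_nonempty : (frontier 𝓜.domain).Nonempty := by
  refine ⟨𝓜.node (0, 0), frontier_of_boxNodes ?_ ?_⟩
  · exact ⟨le_rfl, by positivity, le_rfl, by positivity⟩
  · exact fun h => lt_irrefl _ h.1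

theorem isCompact_frontier : IsCompact (frontier 𝓜.domain) :=
  ((Metric.isBounded_Ioo _ _).prod (Metric.isBounded_Ioo _ _)).isCompact_closure.of_isClosed_subset
    isClosed_frontier frontier_subset_closure

/-- On a mesh with the maximum principle, the solution operator exists and satisfies the weak discrete
maximum principle. -/
theorem HasMaxPrinciple.exists_operator (h : 𝓜.HasMaxPrinciple) :
    ∃ S : Module.Dual ℝ (V0 𝓜.domain 𝓜.triangles) →
        VhBoundary 𝓜.domain 𝓜.triangles → Vh 𝓜.domain 𝓜.triangles,
      IsPoissonSolutionOperator 𝓜.domain 𝓜.triangles S ∧ WDMPA 𝓜.domain 𝓜.triangles S := by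
  choose S hS hS' using h.existsUnique
  refine ⟨S, fun f ub u => ⟨?_, fun hu => (hS' f ub u hu).symm⟩, fun f hf ub => ?_⟩
  · rintro rfl
    exact hS f ub
  obtain ⟨hb, hv⟩ := hS f ub
  have hmem := (S f ub).2
  obtain ⟨y, hy, hmin⟩ := isCompact_frontier.exists_isMinOn frontier_nonempty
    (hmem.1.mono frontier_subset_closure)
  refine ⟨⟨y, hy⟩, fun z => ?_, ?_⟩
  · rw [← hb, ← hb]
    exact hmin z.2
  · rw [← hb]
    refine h _ hmem (fun P hP φ hφ hφ' => ?_) _ fun x hx => hmin hx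
    exact (hf P hP ⟨φ, hφ⟩ hφ').trans_eq (hv ⟨φ, hφ⟩).symm

end EmbeddedMesh
end DMP

theorem corollary5p6 :
    ∃ α₀ : ℝ, 0 < α₀ ∧
      ∀ 𝓜 : DMP.EmbeddedMesh, (∀ T ∈ 𝓜.partitioned, 𝓜.α T < α₀) →
        ∃ S : Module.Dual ℝ (DMP.V0 𝓜.domain 𝓜.triangles) →
            DMP.VhBoundary 𝓜.domain 𝓜.triangles → DMP.Vh 𝓜.domain 𝓜.triangles,
          DMP.IsPoissonSolutionOperator 𝓜.domain 𝓜.triangles S ∧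
            DMP.WDMPA 𝓜.domain 𝓜.triangles S := by
  -- `tan α < t₀` for the angles below `arctan t₀`.
  obtain ⟨t₀, ht₀, H⟩ := DMP.EmbeddedMesh.exists_hasMaxPrinciple
  refine ⟨Real.arctan t₀, Real.arctan_pos.2 ht₀, fun 𝓜 h𝓜 => ?_⟩
  refine DMP.EmbeddedMesh.HasMaxPrinciple.exists_operator (H 𝓜 fun T hT => ?_)
  rw [DMP.EmbeddedMesh.tanα, ← Real.tan_arctan t₀]
  refine Real.tan_lt_tan_of_lt_of_lt_pi_div_two ?_ (Real.arctan_lt_pi_div_two _) (h𝓜 T hT)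
  linarith [𝓜.α_pos T hT, Real.pi_pos]
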